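/- Let $k$ be a field and let $A=A^0\oplus A^1\oplus\cdots$ be a differential graded (DG) $k$-algebra, with differential of degree $+1$, of finite type (each $A^n$ is finite-dimensional). Let $C=DA$ be its graded dual, $C_n=\operatorname{Hom}_k(A^n,k)$, with the DG coalgebra structure dual to the DG algebra structure of $A$. A left (resp. right) DG $A$-module which is bounded above ($M^p=0$ for $p\gg0$) is regarded as a right (resp. left) DG $C$-comodule, via the coaction dual to the action (with the usual Koszul signs). We write $V_n=V^{-n}$. As in Eilenberg and Moore's relative homological algebra, injectivity of DG comodules and DG bimodules is understood relative to DG $k$-vector spaces: an object $I$ is injective if every homomorphism $Y\to I$ extends along every homomorphism $Y\to Z$ that has a retraction of DG $k$-vector spaces; and an injective resolution $0\to X\to I^0\to I^1\to\cdots$ consists of injective objects and has a contracting homotopy made of maps of DG $k$-vector spaces. * For a right DG $C$-comodule $X$ and a left DG $C$-comodule $Y$, let $X\,\square_C\,Y\subseteq X\otimes_kY$ be the kernel of $\Delta_X\otimes1-1\otimes\Delta_Y\colon X\otimes Y\to X\otimes C\otimes Y$. If $X\to I^*$ and $Y\to J^*$ are injective resolutions of DG comodules, $\mathrm{Cotor}^C_n(X,Y)$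 is the $n$-th homology of the product total complex of $(I^{-i}\,\square_C\,J^{-j})_l$, where $l$ is the internal degree; that is, the cohomology in degree $-n$ of the complex which in degree $m$ is $\prod_{i,j\ge0}(I^i\,\square_C\,J^j)^{m-i-j}$. * For a DG $A$-bimodule $B$ with an injective resolution $B\to E^*$ of DG bimodules, the DG Hochschild cohomology $H^n_{DG}(A,B)$ is the $n$-th cohomology of the product total complex of $\operatorname{Hom}_{A^e}(A,E^*)$, which in degree $n$ is $\prod_{p\ge0}\operatorname{Hom}_{A^e}^{n-p}(A,E^p)$. Here $\operatorname{Hom}^q_{A^e}(A,E)$ consists of the $k$-linear maps $f\colon A\to E$ of degree $q$ with $f(ab)=(-1)^{q|a|}af(b)$ and $f(ba)=f(b)a$. **Theorem.** Let $M$ be a bounded-above left DG $A$-module and $N$ a bounded-above right DG $A$-module, and regard $M\otimes_kN$ as a DG $A$-bimodule by $a(m\otimes n)b=am\otimes nb$. Then for each $n\in\mathbb Z$ there is a natural isomorphism of $k$-vector spaces $$\mathrm{Cotor}^C_n(M,N)\;\cong\;H_{DG}^{-n}(A,M\otimes N).$$ In detail: the comodules $M$, $N$ and the bimodule $M\otimes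 N$ have injective resolutions; homomorphisms $f\colon M\to M'$, $g\colon N\to N'$ of bounded-above DG modules, and $f\otimes g$, lift to maps between any chosen injective resolutions; and for all bounded-above $M$, $N$, all choices of injective resolutions $I$ of $M$, $J$ of $N$ and $E$ of $M\otimes N$, and all $n$, there are isomorphisms as above that commute with the maps induced by all lifts of $f$, $g$ and $f\otimes g$ to these resolutions. -/

import Mathlib

open scoped TensorProduct

universe u

noncomputable section

namespace DGCotor

/-- The Koszul sign `(-1) ^ n`, as an element of `k`. -/
def sgn (k : Type u) [Field k] (n : ℤ) : k := ((n.negOnePow : ℤ) : k)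

section Signs
variable {k : Type u} [Field k]

theorem sgn_add (a b : ℤ) : sgn k (a + b) = sgn k a * sgn k b := by
  simp [sgn, Int.negOnePow_add]

theorem sgn_even {a : ℤ} (h : Even a) : sgn k a = 1 := by
  simp [sgn, Int.negOnePow_even a h]

theorem sgn_odd {a : ℤ} (h : Odd a) : sgn k a = -1 := by
  simp [sgn, Int.negOnePow_odd a h]

theorem sgn_zero : sgn k 0 = 1 := sgn_even (by simp)

theorem sgn_one : sgn k 1 = -1 := sgn_odd (by simp)

theorem sgn_mul_self (a : ℤ) : sgn k a * sgn k a = 1 := by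
  rw [← sgn_add]; exact sgn_even (by simp)

theorem sgn_congr {a b : ℤ} (h : Even (a + b)) : sgn k a = sgn k b := by
  rcases Int.even_or_odd a with ha | ha
  · rw [sgn_even ha, sgn_even ((Int.even_add.mp h).mp ha)]
  · have hb : Odd b := by
      rw [← Int.not_even_iff_odd] at ha ⊢
      exact fun hb => ha ((Int.even_add.mp h).mpr hb)
    rw [sgn_odd ha, sgn_odd hb]

end Signs

/-! ### Differential graded vector spaces -/

/-- A DG vector space over `k` (cochain notation): a `k`-module with an internal `ℤ`-grading and a
differential of degree `1`.  The chain notation is obtained by `V_n = V^{-n}`. -/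
structure DGVect (k : Type u) [Field k] where
  carrier : Type u
  [addCommGroup : AddCommGroup carrier]
  [module : Module k carrier]
  gr : ℤ → Submodule k carrier
  internal : DirectSum.IsInternal gr
  d : carrier →ₗ[k] carrier
  d_mem : ∀ {n : ℤ} {x : carrier}, x ∈ gr n → d x ∈ gr (n + 1)
  d_d : ∀ x : carrier, d (d x) = 0

instance (k : Type u) [Field k] : CoeSort (DGVect k) (Type u) := ⟨DGVect.carrier⟩

attribute [instance] DGVect.addCommGroup DGVect.module

namespace DGVect
variable {k : Type u} [Field k]

theorem bijective_coe (X : DGVect k) : Function.Bijective (DirectSum.coeLinearMap X.gr) :=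
  X.internal

/-- A linear map out of a DG vector space, defined on homogeneous elements. -/
def desc (X : DGVect k) {V : Type u} [AddCommMonoid V] [Module k V]
    (f : ∀ n, X.gr n →ₗ[k] V) : X →ₗ[k] V :=
  DirectSum.toModule k ℤ V f ∘ₗ
    (LinearEquiv.ofBijective (DirectSum.coeLinearMap X.gr) X.bijective_coe).symm.toLinearMap

theorem desc_apply (X : DGVect k) {V : Type u} [AddCommMonoid V] [Module k V]
    (f : ∀ n, X.gr n →ₗ[k] V) {n : ℤ} {x : X} (hx : x ∈ X.gr n) :
    X.desc f x = f n ⟨x, hx⟩ := by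
  have : (LinearEquiv.ofBijective (DirectSum.coeLinearMap X.gr) X.bijective_coe).symm x
      = DirectSum.lof k ℤ (fun i => X.gr i) n ⟨x, hx⟩ := by
    rw [LinearEquiv.symm_apply_eq]
    exact (DirectSum.coeLinearMap_lof X.gr n ⟨x, hx⟩).symm
  simp only [desc, LinearMap.comp_apply, LinearEquiv.coe_coe, this]
  simp

theorem iSup_gr (X : DGVect k) : ⨆ n, X.gr n = ⊤ := X.internal.submodule_iSup_eq_top

theorem induction (X : DGVect k) {P : X → Prop} (h : ∀ n, ∀ x ∈ X.gr n, P x)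
    (hadd : ∀ x y, P x → P y → P (x + y)) (x : X) : P x := by
  have hx : x ∈ ⨆ n, X.gr n := by rw [iSup_gr]; trivial
  exact Submodule.iSup_induction X.gr (motive := P) hx h (h 0 0 (zero_mem _)) hadd

theorem hom_ext (X : DGVect k) {V : Type u} [AddCommMonoid V] [Module k V] {f g : X →ₗ[k] V}
    (h : ∀ n, ∀ x ∈ X.gr n, f x = g x) : f = g :=
  LinearMap.ext fun x => X.induction (P := fun x => f x = g x) h
    (fun x y hx hy => by simp only [map_add, hx, hy]) x

/-- The linear map `x ↦ (-1) ^ (p * |x|) x`. -/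
def twist (X : DGVect k) (p : ℤ) : X →ₗ[k] X :=
  X.desc fun n => sgn k (p * n) • (X.gr n).subtype

theorem twist_apply (X : DGVect k) (p : ℤ) {n : ℤ} {x : X} (hx : x ∈ X.gr n) :
    X.twist p x = sgn k (p * n) • x := by
  simp [twist, desc_apply _ _ hx]

/-- The degree `n` part of `X ⊗ Y`. -/
def tensorGr (X Y : DGVect k) (n : ℤ) : Submodule k (X ⊗[k] Y) :=
  Submodule.span k {t | ∃ i j : ℤ, i + j = n ∧ ∃ x ∈ X.gr i, ∃ y ∈ Y.gr j, x ⊗ₜ[k] y = t}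

theorem tmul_mem_tensorGr {X Y : DGVect k} {i j n : ℤ} (h : i + j = n) {x : X} {y : Y}
    (hx : x ∈ X.gr i) (hy : y ∈ Y.gr j) : x ⊗ₜ[k] y ∈ tensorGr X Y n :=
  Submodule.subset_span ⟨i, j, h, x, hx, y, hy, rfl⟩

theorem tensorGr_le {X Y : DGVect k} {n : ℤ} {P : Submodule k (X ⊗[k] Y)}
    (h : ∀ i j : ℤ, i + j = n → ∀ x ∈ X.gr i, ∀ y ∈ Y.gr j, x ⊗ₜ[k] y ∈ P) :
    tensorGr X Y n ≤ P := by
  refine Submodule.span_le.mpr ?_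
  rintro _ ⟨i, j, hij, x, hx, y, hy, rfl⟩
  exact h i j hij x hx y hy

theorem map_tensorGr {X Y X' Y' : DGVect k} {f : X →ₗ[k] X'} {g : Y →ₗ[k] Y'} {p q n m : ℤ}
    (hf : ∀ i, ∀ x ∈ X.gr i, f x ∈ X'.gr (i + p)) (hg : ∀ i, ∀ y ∈ Y.gr i, g y ∈ Y'.gr (i + q))
    (hm : n + p + q = m) {t : X ⊗[k] Y} (ht : t ∈ tensorGr X Y n) :
    TensorProduct.map f g t ∈ tensorGr X' Y' m := by
  refine tensorGr_le (P := (tensorGr X' Y' m).comap (TensorProduct.map f g)) ?_ ht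
  intro i j hij x hx y hy
  exact tmul_mem_tensorGr (by omega) (hf i x hx) (hg j y hy)

/-- The differential `d (x ⊗ y) = d x ⊗ y + (-1) ^ |x| x ⊗ d y`. -/
def tensorD (X Y : DGVect k) : X ⊗[k] Y →ₗ[k] X ⊗[k] Y :=
  X.d.rTensor Y + TensorProduct.map (X.twist 1) Y.d

theorem tensorD_tmul {X Y : DGVect k} {i : ℤ} {x : X} (hx : x ∈ X.gr i) (y : Y) :
    tensorD X Y (x ⊗ₜ y) = X.d x ⊗ₜ y + sgn k i • x ⊗ₜ[k] Y.d y := by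
  simp [tensorD, twist_apply _ _ hx, TensorProduct.smul_tmul']

theorem tensor_hom_ext {X Y : DGVect k} {V : Type u} [AddCommMonoid V] [Module k V]
    {f g : X ⊗[k] Y →ₗ[k] V}
    (h : ∀ i, ∀ x ∈ X.gr i, ∀ j, ∀ y ∈ Y.gr j, f (x ⊗ₜ y) = g (x ⊗ₜ y)) : f = g := by
  apply TensorProduct.ext
  apply X.hom_ext
  intro i x hx
  apply Y.hom_ext
  intro j y hy
  exact h i x hx j y hy

theorem tensorD_mem {X Y : DGVect k} {n : ℤ} {t : X ⊗[k] Y} (ht : t ∈ tensorGr X Y n) :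
    tensorD X Y t ∈ tensorGr X Y (n + 1) := by
  refine tensorGr_le (P := (tensorGr X Y (n + 1)).comap (tensorD X Y)) ?_ ht
  intro i j hij x hx y hy
  rw [Submodule.mem_comap, tensorD_tmul hx]
  exact add_mem (tmul_mem_tensorGr (by omega) (X.d_mem hx) hy)
    (Submodule.smul_mem _ _ (tmul_mem_tensorGr (by omega) hx (Y.d_mem hy)))

theorem tensorD_tensorD (X Y : DGVect k) (t : X ⊗[k] Y) : tensorD X Y (tensorD X Y t) = 0 := by
  have : tensorD X Y ∘ₗ tensorD X Y = 0 := by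
    apply tensor_hom_ext
    intro i x hx j y hy
    simp only [LinearMap.comp_apply, tensorD_tmul hx, map_add, map_smul,
      tensorD_tmul (X.d_mem hx), X.d_d, Y.d_d, sgn_add, sgn_one]
    simp
  exact LinearMap.congr_fun this t

/-- The decomposition of `X ⊗ Y` into homogeneous components. -/
def tensorDecompose (X Y : DGVect k) : X ⊗[k] Y →ₗ[k] DirectSum ℤ (fun n => tensorGr X Y n) :=
  TensorProduct.lift <| X.desc fun i => LinearMap.flip <| Y.desc fun j => LinearMap.flip <|
    LinearMap.mk₂ k (fun (x : X.gr i) (y : Y.gr j) => DirectSum.lof k ℤ (fun n => tensorGr X Y n) (i + j)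
      ⟨(x : X) ⊗ₜ[k] (y : Y), tmul_mem_tensorGr rfl x.2 y.2⟩)
      (fun x x' y => by
        rw [← map_add]; congr 1; ext; simp [TensorProduct.add_tmul])
      (fun c x y => by
        rw [← map_smul]; congr 1)
      (fun x y y' => by
        rw [← map_add]; congr 1; ext; simp [TensorProduct.tmul_add])
      (fun c x y => by
        rw [← map_smul]; congr 1; ext; simp)

theorem tensorDecompose_tmul {X Y : DGVect k} {i j : ℤ} {x : X} {y : Y} (hx : x ∈ X.gr i)
    (hy : y ∈ Y.gr j) : tensorDecompose X Y (x ⊗ₜ y) =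
      DirectSum.lof k ℤ (fun n => tensorGr X Y n) (i + j)
        ⟨x ⊗ₜ[k] y, tmul_mem_tensorGr rfl hx hy⟩ := by
  simp [tensorDecompose, desc_apply _ _ hx, desc_apply _ _ hy]

theorem tensorDecompose_of_mem {X Y : DGVect k} {n : ℤ} {t : X ⊗[k] Y}
    (ht : t ∈ tensorGr X Y n) : tensorDecompose X Y t =
      DirectSum.lof k ℤ (fun n => tensorGr X Y n) n ⟨t, ht⟩ := by
  induction ht using Submodule.span_induction with
  | mem t h =>
    obtain ⟨i, j, rfl, x, hx, y, hy, rfl⟩ := h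
    exact tensorDecompose_tmul hx hy
  | zero => rw [map_zero]; symm; exact map_zero _
  | add x y _ _ hx hy => rw [map_add, hx, hy, ← map_add]; rfl
  | smul a x _ hx => rw [map_smul, hx, ← map_smul]; rfl

theorem tensor_internal (X Y : DGVect k) : DirectSum.IsInternal (tensorGr X Y) := by
  have h1 : DirectSum.coeLinearMap (tensorGr X Y) ∘ₗ tensorDecompose X Y = LinearMap.id := by
    apply tensor_hom_ext
    intro i x hx j y hy
    simp [tensorDecompose_tmul hx hy, DirectSum.coeLinearMap_lof]
  have h2 : tensorDecompose X Y ∘ₗ DirectSum.coeLinearMap (tensorGr X Y) = LinearMap.id := by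
    apply DirectSum.linearMap_ext
    intro n
    ext1 ⟨t, ht⟩
    simp [DirectSum.coeLinearMap_lof, tensorDecompose_of_mem ht]
  exact ⟨Function.LeftInverse.injective (g := tensorDecompose X Y) (LinearMap.congr_fun h2),
    Function.RightInverse.surjective (g := tensorDecompose X Y) (LinearMap.congr_fun h1)⟩

/-- The tensor product of DG vector spaces. -/
abbrev tensor (X Y : DGVect k) : DGVect k where
  carrier := X ⊗[k] Y
  gr := tensorGr X Y
  internal := tensor_internal X Y
  d := tensorD X Y
  d_mem := tensorD_mem
  d_d := tensorD_tensorD X Y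

end DGVect

/-- Maps of DG vector spaces: linear of degree `0`, commuting with the differentials. -/
structure IsDGMap {k : Type u} [Field k] {X Y : DGVect k} (f : X →ₗ[k] Y) : Prop where
  map_mem : ∀ {n : ℤ} {x : X}, x ∈ X.gr n → f x ∈ Y.gr n
  map_d : ∀ x, f (X.d x) = Y.d (f x)

/-! ### DG algebras, DG modules, DG bimodules -/

/-- A DG algebra `A = A^0 ⊕ A^1 ⊕ ⋯` with differential of degree `1`. -/
structure DGAlgebra (k : Type u) [Field k] where
  carrier : Type u
  [ring : Ring carrier]
  [algebra : Algebra k carrier]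
  gr : ℤ → Submodule k carrier
  [graded : GradedAlgebra gr]
  gr_neg : ∀ n : ℤ, n < 0 → gr n = ⊥
  d : carrier →ₗ[k] carrier
  d_mem : ∀ {n : ℤ} {x : carrier}, x ∈ gr n → d x ∈ gr (n + 1)
  d_d : ∀ x : carrier, d (d x) = 0
  leibniz : ∀ {n : ℤ} {a : carrier}, a ∈ gr n → ∀ b : carrier,
    d (a * b) = d a * b + sgn k n • (a * d b)

instance (k : Type u) [Field k] : CoeSort (DGAlgebra k) (Type u) := ⟨DGAlgebra.carrier⟩

attribute [instance] DGAlgebra.ring DGAlgebra.algebra DGAlgebra.graded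

/-- The DG vector space underlying a DG algebra. -/
abbrev DGAlgebra.V {k : Type u} [Field k] (A : DGAlgebra k) : DGVect k where
  carrier := A.carrier
  gr := A.gr
  internal := DirectSum.Decomposition.isInternal A.gr
  d := A.d
  d_mem := A.d_mem
  d_d := A.d_d

/-- Finite type: each homogeneous part is finite-dimensional. -/
class DGAlgebra.FiniteType {k : Type u} [Field k] (A : DGAlgebra k) : Prop where
  finite : ∀ n, Module.Finite k (A.gr n)

/-- Left DG modules over `A`; the action is given as a representation `A → End_k(M)`. -/
structure DGLeftModule {k : Type u} [Field k] (A : DGAlgebra k) extends DGVect k where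
  lact : A →ₐ[k] Module.End k carrier
  lact_mem : ∀ {i j : ℤ} {a : A} {m : carrier}, a ∈ A.gr i → m ∈ gr j → lact a m ∈ gr (i + j)
  leibniz : ∀ {i : ℤ} {a : A}, a ∈ A.gr i → ∀ m : carrier,
    d (lact a m) = lact (A.d a) m + sgn k i • lact a (d m)

/-- Right DG modules over `A`; `ract (op a) n` is `n a`. -/
structure DGRightModule {k : Type u} [Field k] (A : DGAlgebra k) extends DGVect k where
  ract : (A.carrier)ᵐᵒᵖ →ₐ[k] Module.End k carrier
  ract_mem : ∀ {i j : ℤ} {a : A} {m : carrier}, a ∈ A.gr i → m ∈ gr j →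
    ract (MulOpposite.op a) m ∈ gr (j + i)
  leibniz : ∀ {j : ℤ} (a : A) {m : carrier}, m ∈ gr j →
    d (ract (MulOpposite.op a) m) =
      ract (MulOpposite.op a) (d m) + sgn k j • ract (MulOpposite.op (A.d a)) m

/-- DG bimodules over `A`. -/
structure DGBimodule {k : Type u} [Field k] (A : DGAlgebra k) extends DGVect k where
  lact : A →ₐ[k] Module.End k carrier
  ract : (A.carrier)ᵐᵒᵖ →ₐ[k] Module.End k carrier
  lact_ract : ∀ (a b : A) (m : carrier),
    lact a (ract (MulOpposite.op b) m) = ract (MulOpposite.op b) (lact a m)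
  lact_mem : ∀ {i j : ℤ} {a : A} {m : carrier}, a ∈ A.gr i → m ∈ gr j → lact a m ∈ gr (i + j)
  ract_mem : ∀ {i j : ℤ} {a : A} {m : carrier}, a ∈ A.gr i → m ∈ gr j →
    ract (MulOpposite.op a) m ∈ gr (j + i)
  leibniz_left : ∀ {i : ℤ} {a : A}, a ∈ A.gr i → ∀ m : carrier,
    d (lact a m) = lact (A.d a) m + sgn k i • lact a (d m)
  leibniz_right : ∀ {j : ℤ} (a : A) {m : carrier}, m ∈ gr j →
    d (ract (MulOpposite.op a) m) =
      ract (MulOpposite.op a) (d m) + sgn k j • ract (MulOpposite.op (A.d a)) m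

/-- Bounded above: `V^n = 0` for `n ≫ 0`. -/
def DGVect.BoundedAbove {k : Type u} [Field k] (X : DGVect k) : Prop :=
  ∃ b : ℤ, ∀ n, b < n → X.gr n = ⊥

section Hom
variable {k : Type u} [Field k] {A : DGAlgebra k}

/-- Homomorphisms of left DG modules. -/
structure DGLeftModule.IsHom {M M' : DGLeftModule A} (f : M.toDGVect →ₗ[k] M'.toDGVect) : Prop
    extends IsDGMap f where
  map_lact : ∀ (a : A) m, f (M.lact a m) = M'.lact a (f m)

/-- Homomorphisms of right DG modules. -/
structure DGRightModule.IsHom {M M' : DGRightModule A} (f : M.toDGVect →ₗ[k] M'.toDGVect) : Prop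
    extends IsDGMap f where
  map_ract : ∀ (a : A) m, f (M.ract (.op a) m) = M'.ract (.op a) (f m)

/-- Homomorphisms of DG bimodules. -/
structure DGBimodule.IsHom {M M' : DGBimodule A} (f : M.toDGVect →ₗ[k] M'.toDGVect) : Prop
    extends IsDGMap f where
  map_lact : ∀ (a : A) m, f (M.lact a m) = M'.lact a (f m)
  map_ract : ∀ (a : A) m, f (M.ract (.op a) m) = M'.ract (.op a) (f m)

/-- The DG bimodule `M ⊗ N`, with `a (m ⊗ n) b = (a m) ⊗ (n b)`. -/
abbrev DGLeftModule.tensor (M : DGLeftModule A) (N : DGRightModule A) : DGBimodule A where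
  toDGVect := M.toDGVect.tensor N.toDGVect
  lact := (Module.End.rTensorAlgHom k M.carrier N.carrier).comp M.lact
  ract := (Module.End.lTensorAlgHom k N.carrier M.carrier).comp N.ract
  lact_ract a b t := by
    have : (M.lact a).rTensor N.carrier ∘ₗ (N.ract (.op b)).lTensor M.carrier =
        (N.ract (.op b)).lTensor M.carrier ∘ₗ (M.lact a).rTensor N.carrier := by
      rw [LinearMap.rTensor_comp_lTensor, LinearMap.lTensor_comp_rTensor]
    exact LinearMap.congr_fun this t
  lact_mem {i j a t} ha ht :=
    DGVect.map_tensorGr (X := M.toDGVect) (Y := N.toDGVect) (f := M.lact a) (g := LinearMap.id)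
      (p := i) (q := 0) (fun p x hx => add_comm i p ▸ M.lact_mem ha hx)
      (fun p y hy => by simpa using hy) (by omega) ht
  ract_mem {i j a t} ha ht :=
    DGVect.map_tensorGr (X := M.toDGVect) (Y := N.toDGVect) (f := LinearMap.id)
      (g := N.ract (.op a)) (p := 0) (q := i) (fun p x hx => by simpa using hx)
      (fun p y hy => N.ract_mem ha hy) (by omega) ht
  leibniz_left {i a} ha t := by
    have : DGVect.tensorD M.toDGVect N.toDGVect ∘ₗ (M.lact a).rTensor N.carrier =
        (M.lact (A.d a)).rTensor N.carrier + sgn k i • (M.lact a).rTensor N.carrier ∘ₗ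
          DGVect.tensorD M.toDGVect N.toDGVect := by
      apply DGVect.tensor_hom_ext
      intro p x hx q y hy
      simp only [LinearMap.comp_apply, LinearMap.rTensor_tmul, LinearMap.add_apply,
        LinearMap.smul_apply, DGVect.tensorD_tmul hx, DGVect.tensorD_tmul (M.lact_mem ha hx),
        M.leibniz ha, sgn_add, TensorProduct.add_tmul, map_add, map_smul, smul_add,
        ← TensorProduct.smul_tmul', smul_smul]
      abel
    exact LinearMap.congr_fun this t
  leibniz_right {j} a {t} ht := by
    refine DGVect.tensorGr_le (X := M.toDGVect) (Y := N.toDGVect) (P := LinearMap.eqLocus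
      (DGVect.tensorD M.toDGVect N.toDGVect ∘ₗ (N.ract (.op a)).lTensor M.carrier)
      ((N.ract (.op a)).lTensor M.carrier ∘ₗ DGVect.tensorD M.toDGVect N.toDGVect +
        sgn k j • (N.ract (.op (A.d a))).lTensor M.carrier)) ?_ ht
    rintro p q rfl x hx y hy
    simp only [LinearMap.mem_eqLocus, LinearMap.comp_apply, LinearMap.add_apply,
      LinearMap.smul_apply, LinearMap.lTensor_tmul, DGVect.tensorD_tmul hx, N.leibniz a hy,
      map_add, map_smul, TensorProduct.tmul_add, TensorProduct.tmul_smul, smul_add, smul_smul,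
      sgn_add]
    abel

end Hom

/-! ### DG coalgebras, DG comodules -/

/-- A DG coalgebra `C = C_0 ⊕ C_1 ⊕ ⋯` with differential of degree `-1`; in the cochain notation
used here, `C_n = gr (-n)`. -/
structure DGCoalgebra (k : Type u) [Field k] extends DGVect k where
  [coalgebra : Coalgebra k carrier]
  gr_pos : ∀ n : ℤ, 0 < n → gr n = ⊥
  comul_mem : ∀ {n : ℤ} {x : carrier}, x ∈ gr n →
    Coalgebra.comul (R := k) x ∈ DGVect.tensorGr toDGVect toDGVect n
  counit_gr : ∀ {n : ℤ} {x : carrier}, x ∈ gr n → n ≠ 0 → Coalgebra.counit (R := k) x = 0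
  comul_d : ∀ x : carrier, Coalgebra.comul (R := k) (d x) =
    DGVect.tensorD toDGVect toDGVect (Coalgebra.comul (R := k) x)
  counit_d : ∀ x : carrier, Coalgebra.counit (R := k) (d x) = 0

attribute [instance] DGCoalgebra.coalgebra

/-- Right DG comodules over `C`. -/
structure DGRightComodule {k : Type u} [Field k] (C : DGCoalgebra k) extends DGVect k where
  coact : carrier →ₗ[k] carrier ⊗[k] C.carrier
  coassoc : ∀ m, TensorProduct.assoc k carrier C.carrier C.carrier
      (coact.rTensor C.carrier (coact m)) = Coalgebra.comul.lTensor carrier (coact m)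
  counit_coact : ∀ m, Coalgebra.counit.lTensor carrier (coact m) = m ⊗ₜ[k] (1 : k)
  coact_mem : ∀ {n : ℤ} {m : carrier}, m ∈ gr n →
    coact m ∈ DGVect.tensorGr toDGVect C.toDGVect n
  coact_d : ∀ m, coact (d m) = DGVect.tensorD toDGVect C.toDGVect (coact m)

/-- Left DG comodules over `C`. -/
structure DGLeftComodule {k : Type u} [Field k] (C : DGCoalgebra k) extends DGVect k where
  coact : carrier →ₗ[k] C.carrier ⊗[k] carrier
  coassoc : ∀ m, TensorProduct.assoc k C.carrier C.carrier carrier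
      (Coalgebra.comul.rTensor carrier (coact m)) = coact.lTensor C.carrier (coact m)
  counit_coact : ∀ m, Coalgebra.counit.rTensor carrier (coact m) = (1 : k) ⊗ₜ[k] m
  coact_mem : ∀ {n : ℤ} {m : carrier}, m ∈ gr n →
    coact m ∈ DGVect.tensorGr C.toDGVect toDGVect n
  coact_d : ∀ m, coact (d m) = DGVect.tensorD C.toDGVect toDGVect (coact m)

section CoHom
variable {k : Type u} [Field k] {C : DGCoalgebra k}

/-- Homomorphisms of right DG comodules. -/
structure DGRightComodule.IsHom {M M' : DGRightComodule C} (f : M.toDGVect →ₗ[k] M'.toDGVect) :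
    Prop extends IsDGMap f where
  map_coact : ∀ m, M'.coact (f m) = f.rTensor C.carrier (M.coact m)

/-- Homomorphisms of left DG comodules. -/
structure DGLeftComodule.IsHom {M M' : DGLeftComodule C} (f : M.toDGVect →ₗ[k] M'.toDGVect) :
    Prop extends IsDGMap f where
  map_coact : ∀ m, M'.coact (f m) = f.lTensor C.carrier (M.coact m)

end CoHom

/-! ### The dual DG coalgebra of a DG algebra of finite type -/

namespace DGAlgebra
variable {k : Type u} [Field k] (A : DGAlgebra k)

/-- Linear forms on `A` of degree `n`, that is, vanishing outside `A^{-n}`. -/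
def dualGr (n : ℤ) : Submodule k (Module.Dual k A) where
  carrier := {f | ∀ i, i ≠ -n → ∀ a ∈ A.gr i, f a = 0}
  add_mem' hf hg i hi a ha := by simp [hf i hi a ha, hg i hi a ha]
  zero_mem' i hi a ha := rfl
  smul_mem' c f hf i hi a ha := by simp [hf i hi a ha]

/-- The graded dual `DA = ⨁ Hom(A^n, k)`, as a space of linear forms on `A`. -/
def dualSub : Submodule k (Module.Dual k A) := ⨆ n, A.dualGr n

theorem dual_indep : iSupIndep A.dualGr := by
  rw [iSupIndep_def]
  intro n
  rw [Submodule.disjoint_def]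
  intro f hf hf'
  have key : (⨆ j, ⨆ (_ : j ≠ n), A.dualGr j) ≤
      ({ carrier := {g | ∀ a ∈ A.gr (-n), g a = 0}
         add_mem' := fun hf hg a ha => by simp [hf a ha, hg a ha]
         zero_mem' := fun a _ => rfl
         smul_mem' := fun c f hf a ha => by simp [hf a ha] } : Submodule k (Module.Dual k A)) := by
    refine iSup₂_le fun j hj g hg a ha => hg (-n) (by omega) a ha
  refine A.V.hom_ext fun i a ha => ?_
  by_cases hi : i = -n
  · subst hi; exact key hf' a ha
  · exact hf i hi a ha

/-- The graded dual `DA` as a type. -/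
def Dual : Type u := ↥A.dualSub

instance : AddCommGroup A.Dual := inferInstanceAs (AddCommGroup ↥A.dualSub)
instance : Module k A.Dual := inferInstanceAs (Module k ↥A.dualSub)

/-- The inclusion of the graded dual in the space of all linear forms. -/
def dualIncl : A.Dual →ₗ[k] Module.Dual k A := A.dualSub.subtype

theorem dualIncl_injective : Function.Injective A.dualIncl := Subtype.val_injective

theorem dualIncl_mem (f : A.Dual) : A.dualIncl f ∈ A.dualSub := f.2

/-- The degree `n` part of the graded dual. -/
def dualDeg (n : ℤ) : Submodule k A.Dual := (A.dualGr n).comap A.dualIncl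

theorem mem_dualDeg {n : ℤ} {f : A.Dual} :
    f ∈ A.dualDeg n ↔ ∀ i, i ≠ -n → ∀ a ∈ A.gr i, A.dualIncl f a = 0 := Iff.rfl

theorem dual_internal : DirectSum.IsInternal A.dualDeg := by
  refine DirectSum.isInternal_submodule_of_iSupIndep_of_iSup_eq_top ?_ ?_
  · rw [iSupIndep_def]
    intro n
    have h := (iSupIndep_def.mp A.dual_indep) n
    rw [Submodule.disjoint_def] at h ⊢
    intro f hf hf'
    apply A.dualIncl_injective
    refine (h (A.dualIncl f) hf ?_).trans (map_zero _).symm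
    have : (⨆ j, ⨆ (_ : j ≠ n), A.dualDeg j) ≤
        (⨆ j, ⨆ (_ : j ≠ n), A.dualGr j).comap A.dualIncl :=
      iSup₂_le fun j hj g hg => Submodule.mem_iSup_of_mem j (Submodule.mem_iSup_of_mem hj hg)
    exact this hf'
  · rw [eq_top_iff]
    rintro f -
    have : A.dualSub ≤ (⨆ n, A.dualDeg n).map A.dualIncl :=
      iSup_le fun n g hg => ⟨⟨g, Submodule.mem_iSup_of_mem n hg⟩,
        Submodule.mem_iSup_of_mem n hg, rfl⟩
    obtain ⟨g, hg, hgf⟩ := this (A.dualIncl_mem f)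
    exact A.dualIncl_injective hgf ▸ hg

theorem dualSub_induction {P : Module.Dual k A → Prop} {f : Module.Dual k A} (hf : f ∈ A.dualSub)
    (h : ∀ n, ∀ g ∈ A.dualGr n, P g) (hadd : ∀ f g, P f → P g → P (f + g)) : P f :=
  Submodule.iSup_induction A.dualGr (motive := P) hf h (h 0 0 (zero_mem _)) hadd

/-- `f ↦ (a ↦ (-1) ^ |a| f (d a))`, which is `-(-1) ^ |f| f ∘ d` on homogeneous `f`. -/
def dualDAux : Module.Dual k A →ₗ[k] Module.Dual k A :=
  (LinearMap.lcomp k k (A.d ∘ₗ A.V.twist 1))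

theorem dualDAux_apply (f : Module.Dual k A) {i : ℤ} {a : A} (ha : a ∈ A.gr i) :
    A.dualDAux f a = sgn k i * f (A.d a) := by
  change f (A.d (A.V.twist 1 a)) = _
  rw [A.V.twist_apply 1 ha]
  simp

theorem dualDAux_mem {n : ℤ} {f : Module.Dual k A} (hf : f ∈ A.dualGr n) :
    A.dualDAux f ∈ A.dualGr (n + 1) := by
  intro i hi a ha
  rw [dualDAux_apply A f ha, hf (i + 1) (by omega) _ (A.d_mem ha), mul_zero]

theorem dualDAux_mem_sub (f : Module.Dual k A) (hf : f ∈ A.dualSub) : A.dualDAux f ∈ A.dualSub :=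
  A.dualSub_induction (P := fun f => A.dualDAux f ∈ A.dualSub) hf
    (fun n _ hg => Submodule.mem_iSup_of_mem (n + 1) (A.dualDAux_mem hg))
    (fun f g hf hg => by simp only [map_add]; exact add_mem hf hg)

/-- The differential of the graded dual. -/
def dualD : A.Dual →ₗ[k] A.Dual := A.dualDAux.restrict A.dualDAux_mem_sub

theorem dualD_apply (f : A.Dual) {i : ℤ} {a : A} (ha : a ∈ A.gr i) :
    A.dualIncl (A.dualD f) a = sgn k i * A.dualIncl f (A.d a) := dualDAux_apply A _ ha

theorem dual_ext {f g : A.Dual} (h : ∀ i, ∀ a ∈ A.gr i, A.dualIncl f a = A.dualIncl g a) :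
    f = g := A.dualIncl_injective (A.V.hom_ext h)

/-- The DG vector space `DA`. -/
abbrev dualV : DGVect k where
  carrier := A.Dual
  gr := A.dualDeg
  internal := A.dual_internal
  d := A.dualD
  d_mem hx := A.dualDAux_mem hx
  d_d x := A.dual_ext fun i a ha => by
    rw [dualD_apply A _ ha, dualD_apply A _ (A.d_mem ha), A.d_d]
    simp

theorem dual_twist_apply (f : A.Dual) {i : ℤ} {a : A} (ha : a ∈ A.gr i) :
    A.dualIncl (A.dualV.twist 1 f) a = sgn k i * A.dualIncl f a := by
  refine A.dualV.induction
    (P := fun f => A.dualIncl (A.dualV.twist 1 f) a = sgn k i * A.dualIncl f a) ?_ ?_ f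
  · intro n f hf
    rw [A.dualV.twist_apply 1 hf, map_smul, LinearMap.smul_apply, smul_eq_mul]
    by_cases hi : i = -n
    · subst hi; rw [sgn_congr (k := k) (a := 1 * n) (b := -n) (by simp)]
    · rw [A.mem_dualDeg.mp hf i hi a ha, mul_zero, mul_zero]
  · intro f g hf hg
    simp only [map_add, LinearMap.add_apply, hf, hg, mul_add]

/-- The slice map `v ⊗ f ↦ f(a) v`. -/
def slice (V : Type u) [AddCommGroup V] [Module k V] (a : A) : V ⊗[k] A.Dual →ₗ[k] V :=
  TensorProduct.rid k V ∘ₗ ((LinearMap.applyₗ a) ∘ₗ A.dualIncl).lTensor V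

section Slice
variable {V W : Type u} [AddCommGroup V] [Module k V] [AddCommGroup W] [Module k W]

theorem slice_tmul (a : A) (v : V) (f : A.Dual) : A.slice V a (v ⊗ₜ f) = A.dualIncl f a • v := by
  simp [slice]

theorem slice_add (a b : A) (t : V ⊗[k] A.Dual) :
    A.slice V (a + b) t = A.slice V a t + A.slice V b t := by
  induction t using TensorProduct.induction_on with
  | zero => simp
  | tmul v f => simp only [slice_tmul, map_add, add_smul]
  | add x y hx hy => simp only [map_add, hx, hy]; abel

theorem slice_smul (c : k) (a : A) (t : V ⊗[k] A.Dual) :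
    A.slice V (c • a) t = c • A.slice V a t := by
  induction t using TensorProduct.induction_on with
  | zero => simp
  | tmul v f => simp only [slice_tmul, map_smul, smul_eq_mul, mul_smul]
  | add x y hx hy => simp only [map_add, hx, hy, smul_add]

theorem slice_rTensor (g : V →ₗ[k] W) (a : A) (t : V ⊗[k] A.Dual) :
    A.slice W a (g.rTensor A.Dual t) = g (A.slice V a t) := by
  induction t using TensorProduct.induction_on with
  | zero => simp
  | tmul v f => simp only [slice_tmul, LinearMap.rTensor_tmul, map_smul]
  | add x y hx hy => simp only [map_add, hx, hy]

/-- All slices together. -/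
def slices (V : Type u) [AddCommGroup V] [Module k V] : V ⊗[k] A.Dual →ₗ[k] A →ₗ[k] V :=
  LinearMap.flip
    { toFun := fun a => A.slice V a
      map_add' := fun a b => LinearMap.ext fun t => A.slice_add a b t
      map_smul' := fun c a => LinearMap.ext fun t => A.slice_smul c a t }

theorem slices_apply (t : V ⊗[k] A.Dual) (a : A) : A.slices V t a = A.slice V a t := rfl

theorem slices_injective : Function.Injective (A.slices V) := by
  rw [injective_iff_map_eq_zero]
  intro t ht
  let b := Module.Free.chooseBasis k V
  have key : ∀ (t : V ⊗[k] A.Dual) (i) (a : A),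
      A.dualIncl (TensorProduct.equivFinsuppOfBasisLeft b t i) a = b.repr (A.slice V a t) i := by
    intro t i a
    induction t using TensorProduct.induction_on with
    | zero => simp
    | tmul v f =>
      simp [slice_tmul, mul_comm]
    | add x y hx hy => simp only [map_add, Finsupp.add_apply, LinearMap.add_apply, hx, hy]
  rw [← LinearEquiv.map_eq_zero_iff (TensorProduct.equivFinsuppOfBasisLeft b)]
  ext i : 1
  apply A.dualIncl_injective
  ext a
  rw [key, ← slices_apply, ht]
  simp

theorem slice_ext {t t' : V ⊗[k] A.Dual} (h : ∀ i, ∀ a ∈ A.gr i, A.slice V a t = A.slice V a t') :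
    t = t' := A.slices_injective (A.V.hom_ext h)

end Slice

/-- The component of degree `n`. -/
def proj (n : ℤ) : A →ₗ[k] A.gr n :=
  A.V.desc fun m => if h : m = n then h ▸ LinearMap.id else 0

theorem proj_same {n : ℤ} {a : A} (ha : a ∈ A.gr n) : A.proj n a = ⟨a, ha⟩ := by
  rw [proj, A.V.desc_apply _ ha]; simp

theorem proj_ne {n m : ℤ} (h : m ≠ n) {a : A} (ha : a ∈ A.gr m) : A.proj n a = 0 := by
  rw [proj, A.V.desc_apply _ ha]; simp [h]

/-- Every homogeneous linear map out of `A` that vanishes in large degrees comes from the tensor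
product with `DA`, because `A` has finite type. -/
theorem exists_slices [A.FiniteType] (X : DGVect k) {p : ℤ} (φ : A →ₗ[k] X)
    (hφ : ∀ n, ∀ a ∈ A.gr n, φ a ∈ X.gr (p + n)) {N : ℤ}
    (hN : ∀ n, N < n → ∀ a ∈ A.gr n, φ a = 0) :
    ∃ t ∈ DGVect.tensorGr X A.dualV p, A.slices X t = φ := by
  have hfin : ∀ n, Module.Finite k (A.gr n) := FiniteType.finite
  let b := fun n : ℤ => Module.finBasis k (A.gr n)
  have hmem : ∀ n i, (b n).coord i ∘ₗ A.proj n ∈ A.dualGr (-n) := by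
    intro n i m hm a ha
    rw [LinearMap.comp_apply, A.proj_ne (by simpa using hm) ha, map_zero]
  let c : ∀ (n : ℤ) (_ : Fin (Module.finrank k (A.gr n))), A.Dual := fun n i =>
    ⟨(b n).coord i ∘ₗ A.proj n, Submodule.mem_iSup_of_mem (-n) (hmem n i)⟩
  have hc : ∀ n i a, A.dualIncl (c n i) a = (b n).coord i (A.proj n a) := fun n i a => rfl
  refine ⟨∑ n ∈ Finset.Icc 0 N, ∑ i, φ (b n i) ⊗ₜ[k] c n i, ?_, ?_⟩
  · refine sum_mem fun n _ => sum_mem fun i _ => ?_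
    exact DGVect.tmul_mem_tensorGr (X := X) (Y := A.dualV) (i := p + n) (j := -n) (by omega)
      (hφ n _ (b n i).2) (hmem n i)
  · refine A.V.hom_ext fun m a ha => ?_
    rw [slices_apply]
    simp only [map_sum, slice_tmul, hc]
    by_cases hm : m ∈ Finset.Icc 0 N
    · rw [Finset.sum_eq_single_of_mem m hm]
      · rw [A.proj_same ha]
        have h := congrArg (φ ∘ₗ (A.gr m).subtype) ((b m).sum_repr ⟨a, ha⟩)
        simp only [LinearMap.comp_apply, map_sum, map_smul, Submodule.subtype_apply] at h
        simpa only [Module.Basis.coord_apply] using h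
      · intro n _ hn
        rw [A.proj_ne (Ne.symm hn) ha]
        simp
    · rw [Finset.sum_eq_zero]
      · rw [Finset.mem_Icc, not_and_or, not_le, not_le] at hm
        rcases hm with hm | hm
        · have ha' : a ∈ A.gr m := ha
          rw [A.gr_neg m hm, Submodule.mem_bot] at ha'
          rw [ha', map_zero]
        · rw [hN m hm a ha]
      · intro n hn
        rw [A.proj_ne (n := n) (m := m) (by rintro rfl; exact hm hn) ha]
        simp

/-- A family `o : X → Hom(A, W)` all of whose values come from `W ⊗ DA` lifts to `X → W ⊗ DA`. -/
def coactOf {X W : Type u} [AddCommGroup X] [Module k X] [AddCommGroup W] [Module k W]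
    (o : X →ₗ[k] A →ₗ[k] W) (h : ∀ x, o x ∈ LinearMap.range (A.slices W)) :
    X →ₗ[k] W ⊗[k] A.Dual :=
  (LinearEquiv.ofInjective (A.slices W) A.slices_injective).symm.toLinearMap ∘ₗ
    o.codRestrict _ h

theorem slice_coactOf {X W : Type u} [AddCommGroup X] [Module k X] [AddCommGroup W] [Module k W]
    (o : X →ₗ[k] A →ₗ[k] W) (h : ∀ x, o x ∈ LinearMap.range (A.slices W)) (x : X) (a : A) :
    A.slice W a (A.coactOf o h x) = o x a := by
  have : A.slices W (A.coactOf o h x) = o x := by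
    have := LinearEquiv.apply_symm_apply
      (LinearEquiv.ofInjective (A.slices W) A.slices_injective) (o.codRestrict _ h x)
    exact congrArg Subtype.val this
  rw [← slices_apply, this]

theorem coactOf_mem [A.FiniteType] {X : Type u} [AddCommGroup X] [Module k X] {W : DGVect k}
    (o : X →ₗ[k] A →ₗ[k] W) (h : ∀ x, o x ∈ LinearMap.range (A.slices W)) {x : X} {p N : ℤ}
    (hx : ∀ n, ∀ a ∈ A.gr n, o x a ∈ W.gr (p + n)) (hN : ∀ n, N < n → ∀ a ∈ A.gr n, o x a = 0) :
    A.coactOf o h x ∈ DGVect.tensorGr W A.dualV p := by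
  obtain ⟨t, ht, hto⟩ := A.exists_slices W (o x) hx hN
  have : A.coactOf o h x = t := by
    apply A.slices_injective
    rw [hto]; ext a
    rw [slices_apply, slice_coactOf]
  rwa [this]

theorem slice_tensorD (W : DGVect k) {n : ℤ} {a : A} (ha : a ∈ A.gr n) (t : W ⊗[k] A.Dual) :
    A.slice W a (DGVect.tensorD W A.dualV t) =
      W.d (A.slice W a t) + sgn k n • W.twist 1 (A.slice W (A.d a) t) := by
  induction t using TensorProduct.induction_on with
  | zero => simp
  | tmul w f =>
    simp only [DGVect.tensorD, LinearMap.add_apply, LinearMap.rTensor_tmul,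
      TensorProduct.map_tmul, map_add, slice_tmul, map_smul, A.dualD_apply f ha, smul_smul]
  | add x y hx hy => simp only [map_add, hx, hy, smul_add]; abel

end DGAlgebra

namespace DGAlgebra
variable {k : Type u} [Field k] (A : DGAlgebra k)

/-- The bilinear map `(b, f) ↦ (a ↦ (-1) ^ (|a| |b|) f (a b))`. -/
def rmulAux : A →ₗ[k] Module.Dual k A →ₗ[k] Module.Dual k A :=
  A.V.desc fun q => (LinearMap.llcomp k A A k).flip ∘ₗ LinearMap.lcomp k A (A.V.twist q) ∘ₗ
    (LinearMap.mul k A).flip ∘ₗ (A.gr q).subtype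

theorem rmulAux_apply {i q : ℤ} {a b : A} (ha : a ∈ A.gr i) (hb : b ∈ A.gr q)
    (f : Module.Dual k A) : A.rmulAux b f a = sgn k (q * i) * f (a * b) := by
  rw [rmulAux, A.V.desc_apply _ hb]
  change f (A.V.twist q a * b) = _
  rw [A.V.twist_apply q ha, smul_mul_assoc, map_smul, smul_eq_mul]

theorem rmulAux_mem {n q : ℤ} {b : A} (hb : b ∈ A.gr q) {f : Module.Dual k A}
    (hf : f ∈ A.dualGr n) : A.rmulAux b f ∈ A.dualGr (n + q) := by
  intro i hi a ha
  rw [A.rmulAux_apply ha hb, hf (i + q) (by omega) _ (SetLike.mul_mem_graded ha hb), mul_zero]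

theorem rmulAux_mem_sub (b : A) {f : Module.Dual k A} (hf : f ∈ A.dualSub) :
    A.rmulAux b f ∈ A.dualSub := by
  refine A.V.induction (P := fun b => A.rmulAux b f ∈ A.dualSub) ?_ ?_ b
  · intro q b hb
    refine A.dualSub_induction (P := fun f => A.rmulAux b f ∈ A.dualSub) hf ?_ ?_
    · exact fun n g hg => Submodule.mem_iSup_of_mem (n + q) (A.rmulAux_mem hb hg)
    · intro f g hf hg; simp only [map_add]; exact add_mem hf hg
  · intro b c hb hc; simp only [map_add, LinearMap.add_apply]; exact add_mem hb hc

/-- The map `DA → Hom(A, DA)` that defines the comultiplication of `DA`. -/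
def rmul : A.Dual →ₗ[k] A →ₗ[k] A.Dual :=
  LinearMap.mk₂ k (fun f b => (⟨A.rmulAux b (A.dualIncl f), A.rmulAux_mem_sub b f.2⟩ : A.Dual))
    (fun f g b => A.dualIncl_injective (by simp only [map_add]; rfl))
    (fun c f b => A.dualIncl_injective (by simp only [map_smul]; rfl))
    (fun f a b => A.dualIncl_injective (by simp only [map_add]; rfl))
    (fun c f b => A.dualIncl_injective (by simp only [map_smul]; rfl))

theorem rmul_apply {i q : ℤ} {a b : A} (ha : a ∈ A.gr i) (hb : b ∈ A.gr q) (f : A.Dual) :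
    A.dualIncl (A.rmul f b) a = sgn k (q * i) * A.dualIncl f (a * b) :=
  A.rmulAux_apply ha hb _

theorem rmul_mem {n q : ℤ} {b : A} (hb : b ∈ A.gr q) {f : A.Dual} (hf : f ∈ A.dualDeg n) :
    A.rmul f b ∈ A.dualDeg (n + q) := A.rmulAux_mem hb hf

theorem rmul_vanish {n q : ℤ} (h : -n < q) {b : A} (hb : b ∈ A.gr q) {f : A.Dual}
    (hf : f ∈ A.dualDeg n) : A.rmul f b = 0 := by
  refine A.dual_ext fun i a ha => ?_
  rw [A.rmul_apply ha hb, map_zero, LinearMap.zero_apply]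
  by_cases hi : i < 0
  · rw [A.gr_neg i hi, Submodule.mem_bot] at ha
    rw [ha, zero_mul, map_zero, mul_zero]
  · rw [A.mem_dualDeg.mp hf (i + q) (by omega) _ (SetLike.mul_mem_graded ha hb), mul_zero]

theorem rmul_range [A.FiniteType] (f : A.Dual) :
    A.rmul f ∈ LinearMap.range (A.slices A.Dual) := by
  refine A.dualV.induction (P := fun f => A.rmul f ∈ LinearMap.range (A.slices A.Dual)) ?_ ?_ f
  · intro n f hf
    obtain ⟨t, -, ht⟩ := A.exists_slices A.dualV (p := n) (N := -n) (A.rmul f)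
      (fun q b hb => A.rmul_mem hb hf) (fun q hq b hb => A.rmul_vanish hq hb hf)
    exact ⟨t, ht⟩
  · intro f g hf hg; simp only [map_add]; exact add_mem hf hg

/-- The comultiplication of `DA`. -/
def dualComul [A.FiniteType] : A.Dual →ₗ[k] A.Dual ⊗[k] A.Dual := A.coactOf A.rmul A.rmul_range

/-- The counit of `DA`: evaluation at `1`. -/
def dualCounit : A.Dual →ₗ[k] k := (LinearMap.applyₗ (1 : A)) ∘ₗ A.dualIncl

theorem dualCounit_apply (f : A.Dual) : A.dualCounit f = A.dualIncl f 1 := rfl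

theorem slice_comul [A.FiniteType] (f : A.Dual) (b : A) :
    A.slice A.Dual b (A.dualComul f) = A.rmul f b := A.slice_coactOf _ _ f b

/-- The comultiplication is dual to the multiplication: if `Δ f = ∑ f' ⊗ f''`, then
`f (a b) = ∑ (-1) ^ (|a| |b|) f' a * f'' b`. -/
theorem dualComul_spec [A.FiniteType] (f : A.Dual) {i q : ℤ} {a b : A} (ha : a ∈ A.gr i)
    (hb : b ∈ A.gr q) :
    A.dualIncl (A.slice A.Dual b (A.dualComul f)) a = sgn k (i * q) * A.dualIncl f (a * b) := by
  rw [slice_comul, A.rmul_apply ha hb, mul_comm q i]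

section DoubleSlice
variable {V : Type u} [AddCommGroup V] [Module k V]

theorem slice_slice_assoc (a b : A) (t : (V ⊗[k] A.Dual) ⊗[k] A.Dual) :
    A.slice V a (A.slice _ b t) =
      A.slice V a ((A.slice A.Dual b).lTensor V (TensorProduct.assoc k V A.Dual A.Dual t)) := by
  induction t using TensorProduct.induction_on with
  | zero => simp
  | add x y hx hy => simp only [map_add, hx, hy]
  | tmul x g =>
    induction x using TensorProduct.induction_on with
    | zero => simp
    | add x y hx hy => simp only [map_add, TensorProduct.add_tmul, hx, hy]
    | tmul v f => simp [slice_tmul, mul_smul]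

theorem assoc_slice_ext {t t' : V ⊗[k] (A.Dual ⊗[k] A.Dual)}
    (h : ∀ i, ∀ a ∈ A.gr i, ∀ j, ∀ b ∈ A.gr j,
      A.slice V a ((A.slice A.Dual b).lTensor V t) =
        A.slice V a ((A.slice A.Dual b).lTensor V t')) : t = t' := by
  obtain ⟨s, rfl⟩ := (TensorProduct.assoc k V A.Dual A.Dual).surjective t
  obtain ⟨s', rfl⟩ := (TensorProduct.assoc k V A.Dual A.Dual).surjective t'
  congr 1
  refine A.slice_ext fun j b hb => A.slice_ext fun i a ha => ?_
  rw [slice_slice_assoc, slice_slice_assoc]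
  exact h i a ha j b hb

theorem slice_slice_comul [A.FiniteType] {i j : ℤ} {a b : A} (ha : a ∈ A.gr i) (hb : b ∈ A.gr j)
    (t : V ⊗[k] A.Dual) :
    A.slice V a ((A.slice A.Dual b).lTensor V (A.dualComul.lTensor V t)) =
      sgn k (i * j) • A.slice V (a * b) t := by
  induction t using TensorProduct.induction_on with
  | zero => simp
  | add x y hx hy => simp only [map_add, smul_add, hx, hy]
  | tmul v f => simp [slice_tmul, A.dualComul_spec f ha hb, mul_smul]

end DoubleSlice

theorem dualComul_coassoc [A.FiniteType] (f : A.Dual) :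
    TensorProduct.assoc k A.Dual A.Dual A.Dual (A.dualComul.rTensor A.Dual (A.dualComul f)) =
      A.dualComul.lTensor A.Dual (A.dualComul f) := by
  refine A.assoc_slice_ext fun i b hb j c hc => ?_
  rw [A.slice_slice_comul hb hc, ← slice_slice_assoc, slice_rTensor, slice_comul, slice_comul,
    slice_comul]
  refine A.dual_ext fun n a ha => ?_
  rw [map_smul, LinearMap.smul_apply, smul_eq_mul, A.rmul_apply ha hb,
    A.rmul_apply (SetLike.mul_mem_graded ha hb) hc,
    A.rmul_apply ha (SetLike.mul_mem_graded hb hc), ← mul_assoc, ← mul_assoc, mul_assoc a,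
    ← sgn_add, ← sgn_add]
  congr 1
  exact sgn_congr (by ring_nf; simp [Int.even_add])

/-- The DG coalgebra `DA` dual to a DG algebra of finite type. -/
abbrev dual [A.FiniteType] : DGCoalgebra k where
  toDGVect := A.dualV
  coalgebra :=
    { comul := A.dualComul
      counit := A.dualCounit
      coassoc := LinearMap.ext A.dualComul_coassoc
      rTensor_counit_comp_comul := by
        ext f : 1
        refine A.slice_ext fun i a ha => ?_
        rw [LinearMap.comp_apply, slice_rTensor, slice_comul, dualCounit_apply,
          A.rmul_apply SetLike.GradedOne.one_mem ha]
        simp [slice_tmul, sgn_zero]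
      lTensor_counit_comp_comul := by
        ext f : 1
        apply (TensorProduct.rid k A.Dual).injective
        change A.slice A.Dual 1 (A.dualComul f) = _
        rw [slice_comul]
        refine A.dual_ext fun i a ha => ?_
        rw [A.rmul_apply ha SetLike.GradedOne.one_mem]
        simp [sgn_zero] }
  gr_pos n hn := by
    rw [eq_bot_iff]
    intro f hf
    refine A.dual_ext fun i a ha => ?_
    rw [map_zero, LinearMap.zero_apply]
    by_cases hi : i < 0
    · rw [A.gr_neg i hi, Submodule.mem_bot] at ha
      rw [ha, map_zero]
    · exact A.mem_dualDeg.mp hf i (by omega) a ha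
  comul_mem {n f} hf := A.coactOf_mem (W := A.dualV) (N := -n) A.rmul A.rmul_range
    (fun q b hb => A.rmul_mem hb hf) (fun q hq b hb => A.rmul_vanish hq hb hf)
  counit_gr {n f} hf hn := A.mem_dualDeg.mp hf 0 (by omega) 1 SetLike.GradedOne.one_mem
  comul_d f := by
    change A.dualComul (A.dualD f) = DGVect.tensorD A.dualV A.dualV (A.dualComul f)
    refine A.slice_ext fun j b hb => ?_
    rw [A.slice_tensorD A.dualV hb, slice_comul, slice_comul, slice_comul]
    refine A.dual_ext fun i a ha => ?_
    simp only [map_add, map_smul, LinearMap.add_apply, LinearMap.smul_apply, smul_eq_mul]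
    rw [A.rmul_apply ha hb, A.dualD_apply _ (SetLike.mul_mem_graded ha hb), A.dualD_apply _ ha,
      A.dual_twist_apply _ ha, A.rmul_apply ha (A.d_mem hb), A.rmul_apply (A.d_mem ha) hb,
      A.leibniz ha, map_add, map_smul, smul_eq_mul]
    simp only [mul_add, add_mul, sgn_add, mul_one, one_mul]
    ring
  counit_d f := by
    change A.dualIncl (A.dualD f) 1 = 0
    rw [A.dualD_apply f SetLike.GradedOne.one_mem]
    have h : A.d (1 * 1) = A.d 1 * 1 + sgn k 0 • (1 * A.d 1) :=
      A.leibniz SetLike.GradedOne.one_mem 1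
    have h1 : A.d 1 = 0 := by simpa [sgn_zero] using h
    rw [h1, map_zero, mul_zero]

end DGAlgebra

/-! ### DG modules as DG comodules -/

namespace DGLeftModule
variable {k : Type u} [Field k] {A : DGAlgebra k} (M : DGLeftModule A)

/-- The map `m ↦ (a ↦ (-1) ^ (|a| |m|) a m)`. -/
def orbit : M.carrier →ₗ[k] A →ₗ[k] M.carrier :=
  M.toDGVect.desc fun p => (M.lact.toLinearMap ∘ₗ A.V.twist p).flip ∘ₗ (M.gr p).subtype

theorem orbit_apply {p i : ℤ} {m : M.carrier} (hm : m ∈ M.gr p) {a : A} (ha : a ∈ A.gr i) :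
    M.orbit m a = sgn k (i * p) • M.lact a m := by
  rw [orbit, M.toDGVect.desc_apply _ hm]
  change M.lact (A.V.twist p a) m = _
  rw [A.V.twist_apply p ha, map_smul, LinearMap.smul_apply, mul_comm]

theorem orbit_mem {p : ℤ} {m : M.carrier} (hm : m ∈ M.gr p) :
    ∀ i, ∀ a ∈ A.gr i, M.orbit m a ∈ M.gr (p + i) := fun i a ha => by
  rw [M.orbit_apply hm ha, add_comm]
  exact Submodule.smul_mem _ _ (M.lact_mem ha hm)

theorem orbit_vanish {c : ℤ} (hc : ∀ n, c < n → M.gr n = ⊥) {p : ℤ} {m : M.carrier}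
    (hm : m ∈ M.gr p) : ∀ i, c - p < i → ∀ a ∈ A.gr i, M.orbit m a = 0 := fun i hi a ha => by
  have := M.orbit_mem hm i a ha
  rwa [hc _ (by omega), Submodule.mem_bot] at this

theorem orbit_range [A.FiniteType] (hM : M.BoundedAbove) (m : M.carrier) :
    M.orbit m ∈ LinearMap.range (A.slices M.carrier) := by
  obtain ⟨c, hc⟩ := hM
  refine M.toDGVect.induction
    (P := fun m => M.orbit m ∈ LinearMap.range (A.slices M.carrier)) ?_ ?_ m
  · intro p m hm
    obtain ⟨t, -, ht⟩ := A.exists_slices M.toDGVect (p := p) (N := c - p) (M.orbit m)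
      (M.orbit_mem hm) (M.orbit_vanish hc hm)
    exact ⟨t, ht⟩
  · intro f g hf hg; simp only [map_add]; exact add_mem hf hg

/-- The coaction `M → M ⊗ DA`: if `m ↦ ∑ m' ⊗ f`, then `∑ f(a) m' = (-1) ^ (|a| |m|) a m`. -/
def coact [A.FiniteType] (hM : M.BoundedAbove) : M.carrier →ₗ[k] M.carrier ⊗[k] A.Dual :=
  A.coactOf M.orbit (M.orbit_range hM)

theorem slice_coact [A.FiniteType] (hM : M.BoundedAbove) (m : M.carrier) (a : A) :
    A.slice M.carrier a (M.coact hM m) = M.orbit m a := A.slice_coactOf _ _ m a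

/-- The right DG `DA`-comodule given by a bounded-above left DG `A`-module. -/
abbrev toComodule [A.FiniteType] (hM : M.BoundedAbove) : DGRightComodule A.dual where
  toDGVect := M.toDGVect
  coact := M.coact hM
  coassoc m := by
    refine M.toDGVect.induction (P := fun m => TensorProduct.assoc k M.carrier A.Dual A.Dual
      ((M.coact hM).rTensor A.Dual (M.coact hM m)) =
        A.dualComul.lTensor M.carrier (M.coact hM m)) ?_ ?_ m
    · intro p m hm
      refine A.assoc_slice_ext fun i b hb j c hc => ?_
      rw [A.slice_slice_comul hb hc, ← A.slice_slice_assoc, A.slice_rTensor, slice_coact,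
        slice_coact, slice_coact, M.orbit_apply hm (SetLike.mul_mem_graded hb hc),
        M.orbit_apply (M.orbit_mem hm j c hc) hb, M.orbit_apply hm hc]
      simp only [map_smul, map_mul, Module.End.mul_apply, smul_smul, ← sgn_add]
      congr 1
      exact sgn_congr (by ring_nf; simp [Int.even_add])
    · intro x y hx hy; simp only [map_add, hx, hy]
  counit_coact m := by
    apply (TensorProduct.rid k M.carrier).injective
    change A.slice M.carrier 1 (M.coact hM m) = _
    rw [slice_coact]
    refine M.toDGVect.induction (P := fun m => M.orbit m 1 =
      TensorProduct.rid k M.carrier (m ⊗ₜ[k] (1 : k))) ?_ ?_ m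
    · intro p m hm
      rw [M.orbit_apply hm SetLike.GradedOne.one_mem]
      simp [sgn_zero]
    · intro x y hx hy; simp only [map_add, LinearMap.add_apply, TensorProduct.add_tmul, hx, hy]
  coact_mem {p m} hm := by
    have ⟨c, hc⟩ := hM
    exact A.coactOf_mem (W := M.toDGVect) M.orbit (M.orbit_range hM) (M.orbit_mem hm)
      (M.orbit_vanish hc hm)
  coact_d m := by
    change M.coact hM (M.d m) = DGVect.tensorD M.toDGVect A.dualV (M.coact hM m)
    refine M.toDGVect.induction (P := fun m => M.coact hM (M.d m) =
      DGVect.tensorD M.toDGVect A.dualV (M.coact hM m)) ?_ ?_ m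
    · intro p m hm
      refine A.slice_ext fun i a ha => ?_
      rw [A.slice_tensorD M.toDGVect ha, slice_coact, slice_coact, slice_coact,
        M.toDGVect.twist_apply 1 (M.orbit_mem hm _ _ (A.d_mem ha)),
        M.orbit_apply (M.d_mem hm) ha, M.orbit_apply hm ha, M.orbit_apply hm (A.d_mem ha),
        map_smul, M.leibniz ha, smul_add, smul_smul, smul_smul, smul_smul, ← sgn_add, ← sgn_add,
        ← sgn_add, add_right_comm, ← add_smul]
      have h1 : sgn k (i * p) + sgn k (i + 1 * (p + (i + 1)) + (i + 1) * p) = 0 := by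
        have : sgn k (i + 1 * (p + (i + 1)) + (i + 1) * p) = sgn k (i * p + 1) :=
          sgn_congr (by ring_nf; simp [Int.even_add])
        rw [this, sgn_add, sgn_one]; ring
      rw [h1, zero_smul, zero_add, mul_add, mul_one]
    · intro x y hx hy; simp only [map_add, hx, hy]

end DGLeftModule

namespace DGRightModule
variable {k : Type u} [Field k] {A : DGAlgebra k} (N : DGRightModule A)

/-- The map `n ↦ (a ↦ (-1) ^ (|a| |n| + |a|) n a)`. -/
def orbit : N.carrier →ₗ[k] A →ₗ[k] N.carrier :=
  N.toDGVect.desc fun p => (N.ract.toLinearMap ∘ₗ (MulOpposite.opLinearEquiv k).toLinearMap ∘ₗ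
    A.V.twist (p + 1)).flip ∘ₗ (N.gr p).subtype

theorem orbit_apply {p i : ℤ} {m : N.carrier} (hm : m ∈ N.gr p) {a : A} (ha : a ∈ A.gr i) :
    N.orbit m a = sgn k (i * p + i) • N.ract (.op a) m := by
  rw [orbit, N.toDGVect.desc_apply _ hm]
  change N.ract (.op (A.V.twist (p + 1) a)) m = _
  rw [A.V.twist_apply (p + 1) ha, MulOpposite.op_smul, map_smul, LinearMap.smul_apply]
  congr 2
  ring

theorem orbit_mem {p : ℤ} {m : N.carrier} (hm : m ∈ N.gr p) :
    ∀ i, ∀ a ∈ A.gr i, N.orbit m a ∈ N.gr (p + i) := fun i a ha => by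
  rw [N.orbit_apply hm ha]
  exact Submodule.smul_mem _ _ (N.ract_mem ha hm)

theorem orbit_vanish {c : ℤ} (hc : ∀ n, c < n → N.gr n = ⊥) {p : ℤ} {m : N.carrier}
    (hm : m ∈ N.gr p) : ∀ i, c - p < i → ∀ a ∈ A.gr i, N.orbit m a = 0 := fun i hi a ha => by
  have := N.orbit_mem hm i a ha
  rwa [hc _ (by omega), Submodule.mem_bot] at this

theorem orbit_range [A.FiniteType] (hN : N.BoundedAbove) (m : N.carrier) :
    N.orbit m ∈ LinearMap.range (A.slices N.carrier) := by
  obtain ⟨c, hc⟩ := hN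
  refine N.toDGVect.induction
    (P := fun m => N.orbit m ∈ LinearMap.range (A.slices N.carrier)) ?_ ?_ m
  · intro p m hm
    obtain ⟨t, -, ht⟩ := A.exists_slices N.toDGVect (p := p) (N := c - p) (N.orbit m)
      (N.orbit_mem hm) (N.orbit_vanish hc hm)
    exact ⟨t, ht⟩
  · intro f g hf hg; simp only [map_add]; exact add_mem hf hg

/-- The coaction `N → DA ⊗ N`: if `n ↦ ∑ f ⊗ n'`, then
`∑ f(a) n' = (-1) ^ (|a| |n| + |a|) n a`. -/
def coact [A.FiniteType] (hN : N.BoundedAbove) : N.carrier →ₗ[k] A.Dual ⊗[k] N.carrier :=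
  (TensorProduct.comm k N.carrier A.Dual).toLinearMap ∘ₗ A.coactOf N.orbit (N.orbit_range hN)

end DGRightModule

namespace DGAlgebra
variable {k : Type u} [Field k] (A : DGAlgebra k)

/-- The slice map `f ⊗ v ↦ f(a) v`. -/
def lslice (V : Type u) [AddCommGroup V] [Module k V] (a : A) : A.Dual ⊗[k] V →ₗ[k] V :=
  A.slice V a ∘ₗ (TensorProduct.comm k A.Dual V).toLinearMap

section LSlice
variable {V : Type u} [AddCommGroup V] [Module k V]

theorem lslice_tmul (a : A) (f : A.Dual) (v : V) :
    A.lslice V a (f ⊗ₜ v) = A.dualIncl f a • v := by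
  simp [lslice, slice_tmul]

theorem lslice_ext {t t' : A.Dual ⊗[k] V}
    (h : ∀ i, ∀ a ∈ A.gr i, A.lslice V a t = A.lslice V a t') : t = t' :=
  (TensorProduct.comm k A.Dual V).injective (A.slice_ext h)

theorem lslice_lTensor {W : Type u} [AddCommGroup W] [Module k W] (g : V →ₗ[k] W) (a : A)
    (t : A.Dual ⊗[k] V) : A.lslice W a (g.lTensor A.Dual t) = g (A.lslice V a t) := by
  induction t using TensorProduct.induction_on with
  | zero => simp
  | tmul v f => simp only [lslice_tmul, LinearMap.lTensor_tmul, map_smul]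
  | add x y hx hy => simp only [map_add, hx, hy]

theorem lslice_lslice_comul [A.FiniteType] {i j : ℤ} {a b : A} (ha : a ∈ A.gr i)
    (hb : b ∈ A.gr j) (t : A.Dual ⊗[k] V) :
    A.lslice V b (A.lslice _ a (TensorProduct.assoc k A.Dual A.Dual V
      (A.dualComul.rTensor V t))) = sgn k (i * j) • A.lslice V (a * b) t := by
  have key : ∀ (s : A.Dual ⊗[k] A.Dual) (v : V),
      A.lslice V b (A.lslice _ a (TensorProduct.assoc k A.Dual A.Dual V (s ⊗ₜ v))) =
        A.dualIncl (A.slice A.Dual b s) a • v := by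
    intro s v
    induction s using TensorProduct.induction_on with
    | zero => simp
    | tmul f g =>
      rw [TensorProduct.assoc_tmul, lslice_tmul, map_smul, lslice_tmul, slice_tmul, map_smul,
        LinearMap.smul_apply, smul_eq_mul, mul_comm, mul_smul]
    | add x y hx hy => simp only [map_add, TensorProduct.add_tmul, LinearMap.add_apply, add_smul,
        hx, hy]
  induction t using TensorProduct.induction_on with
  | zero => simp
  | add x y hx hy => simp only [map_add, smul_add, hx, hy]
  | tmul f v => rw [LinearMap.rTensor_tmul, key, A.dualComul_spec f ha hb, lslice_tmul, mul_smul]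

theorem lslice_tensorD (W : DGVect k) {n : ℤ} {a : A} (ha : a ∈ A.gr n) (t : A.Dual ⊗[k] W) :
    A.lslice W a (DGVect.tensorD A.dualV W t) =
      sgn k n • (A.lslice W (A.d a) t + W.d (A.lslice W a t)) := by
  induction t using TensorProduct.induction_on with
  | zero => simp
  | tmul f w =>
    simp only [DGVect.tensorD, LinearMap.add_apply, LinearMap.rTensor_tmul,
      TensorProduct.map_tmul, map_add, lslice_tmul, map_smul, A.dualD_apply f ha,
      A.dual_twist_apply f ha, smul_add, smul_smul]
  | add x y hx hy => simp only [map_add, hx, hy, smul_add]; abel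

end LSlice
end DGAlgebra

namespace DGRightModule
variable {k : Type u} [Field k] {A : DGAlgebra k} (N : DGRightModule A)

theorem lslice_coact [A.FiniteType] (hN : N.BoundedAbove) (m : N.carrier) (a : A) :
    A.lslice N.carrier a (N.coact hN m) = N.orbit m a := by
  simp only [DGAlgebra.lslice, coact, LinearMap.comp_apply, LinearEquiv.coe_coe,
    TensorProduct.comm_comm]
  exact A.slice_coactOf _ _ m a

theorem comm_mem_tensorGr {X Y : DGVect k} {n : ℤ} {t : X ⊗[k] Y}
    (ht : t ∈ DGVect.tensorGr X Y n) :
    TensorProduct.comm k X.carrier Y.carrier t ∈ DGVect.tensorGr Y X n := by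
  refine DGVect.tensorGr_le (P := (DGVect.tensorGr Y X n).comap
    (TensorProduct.comm k X.carrier Y.carrier).toLinearMap) ?_ ht
  intro i j hij x hx y hy
  exact DGVect.tmul_mem_tensorGr (by omega) hy hx

/-- The left DG `DA`-comodule given by a bounded-above right DG `A`-module. -/
abbrev toComodule [A.FiniteType] (hN : N.BoundedAbove) : DGLeftComodule A.dual where
  toDGVect := N.toDGVect
  coact := N.coact hN
  coassoc m := by
    refine N.toDGVect.induction (P := fun m => TensorProduct.assoc k A.Dual A.Dual N.carrier
      (A.dualComul.rTensor N.carrier (N.coact hN m)) =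
        (N.coact hN).lTensor A.Dual (N.coact hN m)) ?_ ?_ m
    · intro p m hm
      refine A.lslice_ext fun i a ha => A.lslice_ext fun j b hb => ?_
      rw [A.lslice_lslice_comul ha hb, A.lslice_lTensor, lslice_coact, lslice_coact,
        lslice_coact, N.orbit_apply hm (SetLike.mul_mem_graded ha hb),
        N.orbit_apply (N.orbit_mem hm i a ha) hb, N.orbit_apply hm ha]
      simp only [map_smul, MulOpposite.op_mul, map_mul, Module.End.mul_apply, smul_smul,
        ← sgn_add]
      congr 1
      exact sgn_congr (by ring_nf; simp [Int.even_add])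
    · intro x y hx hy; simp only [map_add, hx, hy]
  counit_coact m := by
    apply (TensorProduct.lid k N.carrier).injective
    have h : ∀ t : A.Dual ⊗[k] N.carrier, TensorProduct.lid k N.carrier
        (A.dualCounit.rTensor N.carrier t) = A.lslice N.carrier 1 t := by
      intro t
      induction t using TensorProduct.induction_on with
      | zero => simp
      | tmul f v => simp [A.lslice_tmul, A.dualCounit_apply]
      | add x y hx hy => simp only [map_add, hx, hy]
    refine (h _).trans ((N.lslice_coact hN m 1).trans ?_)
    refine N.toDGVect.induction (P := fun m => N.orbit m 1 =
      TensorProduct.lid k N.carrier ((1 : k) ⊗ₜ[k] m)) ?_ ?_ m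
    · intro p m hm
      rw [N.orbit_apply hm SetLike.GradedOne.one_mem]
      simp [sgn_zero]
    · intro x y hx hy; simp only [map_add, LinearMap.add_apply, TensorProduct.tmul_add, hx, hy]
  coact_mem {p m} hm := by
    have ⟨c, hc⟩ := hN
    exact comm_mem_tensorGr (X := N.toDGVect) (Y := A.dualV)
      (A.coactOf_mem (W := N.toDGVect) N.orbit (N.orbit_range hN) (N.orbit_mem hm)
        (N.orbit_vanish hc hm))
  coact_d m := by
    change N.coact hN (N.d m) = DGVect.tensorD A.dualV N.toDGVect (N.coact hN m)
    refine N.toDGVect.induction (P := fun m => N.coact hN (N.d m) =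
      DGVect.tensorD A.dualV N.toDGVect (N.coact hN m)) ?_ ?_ m
    · intro p m hm
      refine A.lslice_ext fun i a ha => ?_
      rw [A.lslice_tensorD N.toDGVect ha, lslice_coact, lslice_coact, lslice_coact,
        N.orbit_apply (N.d_mem hm) ha, N.orbit_apply hm ha, N.orbit_apply hm (A.d_mem ha),
        map_smul, N.leibniz a hm]
      simp only [smul_add, smul_smul, ← sgn_add]
      have h1 : sgn k (i + ((i + 1) * p + (i + 1))) = - sgn k (i + (i * p + i + p)) := by
        have : sgn k (i + ((i + 1) * p + (i + 1))) = sgn k (i + (i * p + i + p) + 1) :=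
          sgn_congr (by ring_nf; simp [Int.even_add, Int.even_mul, show Even (4 : ℤ) by decide])
        rw [this, sgn_add _ 1, sgn_one]; ring
      have h2 : sgn k (i + (i * p + i)) = sgn k (i * (p + 1) + i) :=
        sgn_congr (by ring_nf; simp [Int.even_add, Int.even_mul, show Even (4 : ℤ) by decide])
      rw [h1, h2, neg_smul]
      abel
    · intro x y hx hy; simp only [map_add, hx, hy]

end DGRightModule

/-! ### Injective resolutions of DG objects

"Injective" is meant relative to DG vector spaces: the extension property holds along those
homomorphisms that are split injective as maps of DG vector spaces, and resolutions are split exact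
as sequences of DG vector spaces. -/

/-- A category of DG vector spaces with additional structure. -/
structure DGCat (k : Type u) [Field k] where
  Obj : Type (u + 1)
  U : Obj → DGVect k
  IsHom : ∀ {X Y : Obj}, (U X →ₗ[k] U Y) → Prop

section Cats
variable {k : Type u} [Field k]

/-- Right DG comodules over `C`. -/
abbrev rightComodules (C : DGCoalgebra k) : DGCat k where
  Obj := DGRightComodule C
  U := DGRightComodule.toDGVect
  IsHom := DGRightComodule.IsHom

/-- Left DG comodules over `C`. -/
abbrev leftComodules (C : DGCoalgebra k) : DGCat k where
  Obj := DGLeftComodule C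
  U := DGLeftComodule.toDGVect
  IsHom := DGLeftComodule.IsHom

/-- DG bimodules over `A`. -/
abbrev bimodules (A : DGAlgebra k) : DGCat k where
  Obj := DGBimodule A
  U := DGBimodule.toDGVect
  IsHom := DGBimodule.IsHom

variable (T : DGCat k)

/-- Injective objects: every homomorphism `Y → X` extends along every homomorphism `i : Y → Z`
which has a retraction in DG vector spaces. -/
def DGCat.IsInjective (X : T.Obj) : Prop :=
  ∀ (Y Z : T.Obj) (i : T.U Y →ₗ[k] T.U Z) (r : T.U Z →ₗ[k] T.U Y) (g : T.U Y →ₗ[k] T.U X),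
    T.IsHom i → IsDGMap r → r ∘ₗ i = LinearMap.id → T.IsHom g →
      ∃ h : T.U Z →ₗ[k] T.U X, T.IsHom h ∧ h ∘ₗ i = g

/-- An injective resolution `0 → X → I^0 → I^1 → ⋯`, with a contracting homotopy in DG vector
spaces. -/
structure InjRes (X : T.Obj) where
  obj : ℕ → T.Obj
  injective : ∀ i, T.IsInjective (obj i)
  aug : T.U X →ₗ[k] T.U (obj 0)
  δ : ∀ i, T.U (obj i) →ₗ[k] T.U (obj (i + 1))
  aug_hom : T.IsHom aug
  δ_hom : ∀ i, T.IsHom (δ i)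
  δ_aug : δ 0 ∘ₗ aug = 0
  δ_δ : ∀ i, δ (i + 1) ∘ₗ δ i = 0
  split : ∃ (s₀ : T.U (obj 0) →ₗ[k] T.U X) (s : ∀ i, T.U (obj (i + 1)) →ₗ[k] T.U (obj i)),
    IsDGMap s₀ ∧ (∀ i, IsDGMap (s i)) ∧ s₀ ∘ₗ aug = LinearMap.id ∧
      aug ∘ₗ s₀ + s 0 ∘ₗ δ 0 = LinearMap.id ∧
      ∀ i, δ i ∘ₗ s i + s (i + 1) ∘ₗ δ (i + 1) = LinearMap.id

/-- Maps of injective resolutions over a given map `f`. -/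
structure InjRes.Lift {T : DGCat k} {X X' : T.Obj} (f : T.U X →ₗ[k] T.U X') (I : InjRes T X)
    (I' : InjRes T X') where
  map : ∀ i, T.U (I.obj i) →ₗ[k] T.U (I'.obj i)
  map_hom : ∀ i, T.IsHom (map i)
  map_aug : map 0 ∘ₗ I.aug = I'.aug ∘ₗ f
  map_δ : ∀ i, map (i + 1) ∘ₗ I.δ i = I'.δ i ∘ₗ map i

end Cats

/-! ### Cochain complexes cut out of a vector space -/

section Sub
open CategoryTheory
variable {k : Type u} [Field k]

/-- The cochain complex with `T n` in degree `n` and differential the restriction of `D n`. -/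
def subComplex {P : Type u} [AddCommGroup P] [Module k P] (T : ℤ → Submodule k P)
    (D : ℤ → P →ₗ[k] P) (hD : ∀ n, ∀ x ∈ T n, D n x ∈ T (n + 1))
    (hDD : ∀ n, ∀ x ∈ T n, D (n + 1) (D n x) = 0) : CochainComplex (ModuleCat.{u} k) ℤ :=
  CochainComplex.of (fun n => ModuleCat.of k (T n)) (fun n => ModuleCat.ofHom ((D n).restrict (hD n)))
    (fun n => by
      ext x
      exact hDD n x.1 x.2)

/-- The map of cochain complexes given by the restrictions of `F`. -/
def subComplexMap {P : Type u} [AddCommGroup P] [Module k P] {T : ℤ → Submodule k P}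
    {D : ℤ → P →ₗ[k] P} {hD : ∀ n, ∀ x ∈ T n, D n x ∈ T (n + 1)}
    {hDD : ∀ n, ∀ x ∈ T n, D (n + 1) (D n x) = 0}
    {P' : Type u} [AddCommGroup P'] [Module k P'] {T' : ℤ → Submodule k P'}
    {D' : ℤ → P' →ₗ[k] P'} {hD' : ∀ n, ∀ x ∈ T' n, D' n x ∈ T' (n + 1)}
    {hDD' : ∀ n, ∀ x ∈ T' n, D' (n + 1) (D' n x) = 0}
    (F : P →ₗ[k] P') (hF : ∀ n, ∀ x ∈ T n, F x ∈ T' n)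
    (hFD : ∀ n, ∀ x ∈ T n, D' n (F x) = F (D n x)) :
    subComplex T D hD hDD ⟶ subComplex T' D' hD' hDD' :=
  CochainComplex.ofHom (fun n => ModuleCat.ofHom (F.restrict (hF n))) (fun n => by
    simp only [subComplex, CochainComplex.of_d]
    ext x
    exact hFD n x.1 x.2)

end Sub

/-! ### The cotensor product and Cotor -/

section TensorLemmas
variable {k : Type u} [Field k]

theorem IsDGMap.map_twist {X Y : DGVect k} {f : X →ₗ[k] Y} (hf : IsDGMap f) (p : ℤ) (x : X) :
    f (X.twist p x) = Y.twist p (f x) := by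
  refine X.induction (P := fun x => f (X.twist p x) = Y.twist p (f x)) ?_ ?_ x
  · intro n x hx
    rw [X.twist_apply p hx, Y.twist_apply p (hf.map_mem hx), map_smul]
  · intro x y hx hy; simp only [map_add, hx, hy]

theorem isDGMap_id (X : DGVect k) : IsDGMap (X := X) (Y := X) LinearMap.id :=
  ⟨fun h => h, fun _ => rfl⟩

theorem isDGMap_map {X Y X' Y' : DGVect k} {f : X →ₗ[k] X'} {g : Y →ₗ[k] Y'} (hf : IsDGMap f)
    (hg : IsDGMap g) :
    IsDGMap (X := X.tensor Y) (Y := X'.tensor Y') (TensorProduct.map f g) where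
  map_mem {n t} ht := DGVect.map_tensorGr (X := X) (Y := Y) (p := 0) (q := 0)
    (fun i x hx => by simpa using hf.map_mem hx) (fun i x hx => by simpa using hg.map_mem hx)
    (by omega) ht
  map_d t := by
    change TensorProduct.map f g (DGVect.tensorD X Y t) =
      DGVect.tensorD X' Y' (TensorProduct.map f g t)
    induction t using TensorProduct.induction_on with
    | zero => simp
    | tmul x y =>
      simp only [DGVect.tensorD, LinearMap.add_apply, LinearMap.rTensor_tmul,
        TensorProduct.map_tmul, map_add, hf.map_d, hg.map_d, hf.map_twist]
    | add x y hx hy => simp only [map_add, hx, hy]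

theorem isDGMap_assoc (X Y Z : DGVect k) :
    IsDGMap (X := (X.tensor Y).tensor Z) (Y := X.tensor (Y.tensor Z))
      (TensorProduct.assoc k X.carrier Y.carrier Z.carrier).toLinearMap where
  map_mem {n t} ht := by
    refine DGVect.tensorGr_le (X := X.tensor Y) (Y := Z)
      (P := (DGVect.tensorGr X (Y.tensor Z) n).comap
        (TensorProduct.assoc k X.carrier Y.carrier Z.carrier).toLinearMap) ?_ ht
    intro i j hij s hs z hz
    refine DGVect.tensorGr_le (X := X) (Y := Y)
      (P := (DGVect.tensorGr X (Y.tensor Z) n).comap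
        ((TensorProduct.assoc k X.carrier Y.carrier Z.carrier).toLinearMap ∘ₗ
          (TensorProduct.mk k _ Z.carrier).flip z)) ?_ hs
    intro p q hpq x hx y hy
    exact DGVect.tmul_mem_tensorGr (X := X) (Y := Y.tensor Z) (i := p) (j := q + j) (by omega) hx
      (DGVect.tmul_mem_tensorGr rfl hy hz)
  map_d t := by
    have : (TensorProduct.assoc k X.carrier Y.carrier Z.carrier).toLinearMap ∘ₗ
        DGVect.tensorD (X.tensor Y) Z = DGVect.tensorD X (Y.tensor Z) ∘ₗ
          (TensorProduct.assoc k X.carrier Y.carrier Z.carrier).toLinearMap := by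
      refine DGVect.tensor_hom_ext (X := X.tensor Y) (Y := Z) fun n s hs m z _ => ?_
      refine DGVect.tensorGr_le (X := X) (Y := Y) (P := LinearMap.eqLocus
        (((TensorProduct.assoc k X.carrier Y.carrier Z.carrier).toLinearMap ∘ₗ
          DGVect.tensorD (X.tensor Y) Z) ∘ₗ (TensorProduct.mk k _ Z.carrier).flip z)
        ((DGVect.tensorD X (Y.tensor Z) ∘ₗ
          (TensorProduct.assoc k X.carrier Y.carrier Z.carrier).toLinearMap) ∘ₗ
            (TensorProduct.mk k _ Z.carrier).flip z)) ?_ hs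
      rintro i j rfl x hx y hy
      have hxy : x ⊗ₜ[k] y ∈ (X.tensor Y).gr (i + j) := DGVect.tmul_mem_tensorGr rfl hx hy
      have e : (X.tensor Y).d (x ⊗ₜ[k] y) = X.d x ⊗ₜ y + sgn k i • x ⊗ₜ[k] Y.d y :=
        DGVect.tensorD_tmul hx y
      have e' : (Y.tensor Z).d (y ⊗ₜ[k] z) = Y.d y ⊗ₜ z + sgn k j • y ⊗ₜ[k] Z.d z :=
        DGVect.tensorD_tmul hy z
      change TensorProduct.assoc k X.carrier Y.carrier Z.carrier
        (DGVect.tensorD (X.tensor Y) Z ((x ⊗ₜ[k] y) ⊗ₜ[k] z)) =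
          DGVect.tensorD X (Y.tensor Z) (x ⊗ₜ[k] (y ⊗ₜ[k] z))
      rw [DGVect.tensorD_tmul hxy, DGVect.tensorD_tmul (X := X) (Y := Y.tensor Z) hx, e, e']
      simp only [sgn_add, TensorProduct.add_tmul, TensorProduct.tmul_add,
        ← TensorProduct.smul_tmul', TensorProduct.tmul_smul, smul_add, smul_smul, map_add,
        map_smul, TensorProduct.assoc_tmul]
      abel
    exact LinearMap.congr_fun this t

end TensorLemmas

section Cotor
open CategoryTheory
variable {k : Type u} [Field k] {C : DGCoalgebra k}

/-- The map `Δ_X ⊗ 1 - 1 ⊗ Δ_Y : X ⊗ Y → X ⊗ C ⊗ Y`. -/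
def cotensorMap (X : DGRightComodule C) (Y : DGLeftComodule C) :
    X.carrier ⊗[k] Y.carrier →ₗ[k] X.carrier ⊗[k] (C.carrier ⊗[k] Y.carrier) :=
  (TensorProduct.assoc k X.carrier C.carrier Y.carrier).toLinearMap ∘ₗ
    X.coact.rTensor Y.carrier - Y.coact.lTensor X.carrier

/-- The cotensor product `X □_C Y`, as a subspace of `X ⊗ Y`. -/
def cotensor (X : DGRightComodule C) (Y : DGLeftComodule C) :
    Submodule k (X.carrier ⊗[k] Y.carrier) := LinearMap.ker (cotensorMap X Y)

theorem mem_cotensor {X : DGRightComodule C} {Y : DGLeftComodule C}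
    {t : X.carrier ⊗[k] Y.carrier} :
    t ∈ cotensor X Y ↔ TensorProduct.assoc k X.carrier C.carrier Y.carrier
      (X.coact.rTensor Y.carrier t) = Y.coact.lTensor X.carrier t := by
  rw [cotensor, LinearMap.mem_ker, cotensorMap, LinearMap.sub_apply, sub_eq_zero]
  rfl

theorem tensorD_mem_cotensor {X : DGRightComodule C} {Y : DGLeftComodule C}
    {t : X.carrier ⊗[k] Y.carrier} (ht : t ∈ cotensor X Y) :
    DGVect.tensorD X.toDGVect Y.toDGVect t ∈ cotensor X Y := by
  rw [mem_cotensor] at ht ⊢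
  have h1 : IsDGMap (X := X.toDGVect) (Y := X.toDGVect.tensor C.toDGVect) X.coact :=
    ⟨X.coact_mem, X.coact_d⟩
  have h2 : IsDGMap (X := Y.toDGVect) (Y := C.toDGVect.tensor Y.toDGVect) Y.coact :=
    ⟨Y.coact_mem, Y.coact_d⟩
  have e1 := (isDGMap_map h1 (isDGMap_id Y.toDGVect)).map_d t
  have e2 := (isDGMap_map (isDGMap_id X.toDGVect) h2).map_d t
  have e3 := (isDGMap_assoc X.toDGVect C.toDGVect Y.toDGVect).map_d
    (X.coact.rTensor Y.carrier t)
  refine (congrArg (TensorProduct.assoc k X.carrier C.carrier Y.carrier) e1).trans ?_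
  refine e3.trans (Eq.trans ?_ e2.symm)
  exact congrArg (DGVect.tensorD X.toDGVect (C.toDGVect.tensor Y.toDGVect)) ht

theorem map_mem_cotensor {X X' : DGRightComodule C} {Y Y' : DGLeftComodule C}
    {f : X.toDGVect →ₗ[k] X'.toDGVect} {g : Y.toDGVect →ₗ[k] Y'.toDGVect}
    (hf : DGRightComodule.IsHom f) (hg : DGLeftComodule.IsHom g)
    {t : X.carrier ⊗[k] Y.carrier} (ht : t ∈ cotensor X Y) :
    TensorProduct.map f g t ∈ cotensor X' Y' := by
  rw [mem_cotensor] at ht ⊢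
  have e1 : ∀ t, TensorProduct.assoc k X'.carrier C.carrier Y'.carrier
      (X'.coact.rTensor Y'.carrier (TensorProduct.map f g t)) =
        TensorProduct.map f (TensorProduct.map LinearMap.id g)
          (TensorProduct.assoc k X.carrier C.carrier Y.carrier (X.coact.rTensor Y.carrier t)) := by
    intro t
    induction t using TensorProduct.induction_on with
    | zero => simp
    | add x y hx hy => simp only [map_add, hx, hy]
    | tmul x y =>
      simp only [TensorProduct.map_tmul, LinearMap.rTensor_tmul, hf.map_coact]
      induction X.coact x using TensorProduct.induction_on with
      | zero => simp
      | add x y hx hy => simp only [map_add, TensorProduct.add_tmul, hx, hy]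
      | tmul x c => simp
  have e2 : ∀ t, Y'.coact.lTensor X'.carrier (TensorProduct.map f g t) =
      TensorProduct.map f (TensorProduct.map LinearMap.id g)
        (Y.coact.lTensor X.carrier t) := by
    intro t
    induction t using TensorProduct.induction_on with
    | zero => simp
    | add x y hx hy => simp only [map_add, hx, hy]
    | tmul x y =>
      simp only [TensorProduct.map_tmul, LinearMap.lTensor_tmul, hg.map_coact]
      rfl
  rw [e1, e2, ht]

variable {X : DGRightComodule C} {Y : DGLeftComodule C}

/-- The product of all the spaces `I^i ⊗ J^j`. -/
abbrev CotorAmbient (I : InjRes (rightComodules C) X) (J : InjRes (leftComodules C) Y) : Type u :=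
  ∀ i j : ℕ, (I.obj i).carrier ⊗[k] (J.obj j).carrier

/-- The part of degree `n` of the product total complex of `I □_C J`:
the product over `i, j` of the parts of degree `n - i - j` of `I^i □_C J^j`. -/
def cotorDeg (I : InjRes (rightComodules C) X) (J : InjRes (leftComodules C) Y) (n : ℤ) :
    Submodule k (CotorAmbient I J) where
  carrier := {x | ∀ i j : ℕ, x i j ∈ cotensor (I.obj i) (J.obj j) ⊓
    DGVect.tensorGr (I.obj i).toDGVect (J.obj j).toDGVect (n - i - j)}
  add_mem' hx hy i j := add_mem (hx i j) (hy i j)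
  zero_mem' _ _ := zero_mem _
  smul_mem' c _ hx i j := Submodule.smul_mem _ c (hx i j)

/-- The part of the total differential that comes from `I`. -/
def cotorDI (I : InjRes (rightComodules C) X) (J : InjRes (leftComodules C) Y) :
    ∀ i j : ℕ, CotorAmbient I J →ₗ[k] (I.obj i).carrier ⊗[k] (J.obj j).carrier
  | 0, _ => 0
  | i + 1, j => (I.δ i).rTensor (J.obj j).carrier ∘ₗ LinearMap.proj j ∘ₗ LinearMap.proj i

/-- The part of the total differential that comes from `J`, up to sign. -/
def cotorDJ (I : InjRes (rightComodules C) X) (J : InjRes (leftComodules C) Y) :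
    ∀ i j : ℕ, CotorAmbient I J →ₗ[k] (I.obj i).carrier ⊗[k] (J.obj j).carrier
  | _, 0 => 0
  | i, j + 1 => (J.δ j).lTensor (I.obj i).carrier ∘ₗ LinearMap.proj j ∘ₗ LinearMap.proj i

/-- The total differential: on `I^i ⊗ J^j` it is `δ_I + (-1)^i δ_J + (-1)^(i+j) d`. -/
def cotorD (I : InjRes (rightComodules C) X) (J : InjRes (leftComodules C) Y) :
    CotorAmbient I J →ₗ[k] CotorAmbient I J :=
  LinearMap.pi fun i => LinearMap.pi fun j =>
    cotorDI I J i j + sgn k i • cotorDJ I J i j +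
      sgn k (i + j) • DGVect.tensorD (I.obj i).toDGVect (J.obj j).toDGVect ∘ₗ
        LinearMap.proj j ∘ₗ LinearMap.proj i

theorem cotorD_apply (I : InjRes (rightComodules C) X) (J : InjRes (leftComodules C) Y)
    (x : CotorAmbient I J) (i j : ℕ) : cotorD I J x i j =
      cotorDI I J i j x + sgn k i • cotorDJ I J i j x +
        sgn k (i + j) • DGVect.tensorD (I.obj i).toDGVect (J.obj j).toDGVect (x i j) := rfl

theorem cotorD_mem (I : InjRes (rightComodules C) X) (J : InjRes (leftComodules C) Y) (n : ℤ)
    (x : CotorAmbient I J) (hx : x ∈ cotorDeg I J n) : cotorD I J x ∈ cotorDeg I J (n + 1) := by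
  intro i j
  rw [cotorD_apply]
  refine add_mem (add_mem ?_ (Submodule.smul_mem _ _ ?_)) (Submodule.smul_mem _ _ ?_)
  · cases i with
    | zero => exact zero_mem _
    | succ i =>
      have hid : DGLeftComodule.IsHom (M := J.obj j) (M' := J.obj j) LinearMap.id :=
        ⟨isDGMap_id _, fun m => by simp⟩
      refine ⟨map_mem_cotensor (I.δ_hom i) hid (hx i j).1, ?_⟩
      have := (isDGMap_map (I.δ_hom i).toIsDGMap (isDGMap_id (J.obj j).toDGVect)).map_mem
        (hx i j).2
      have e : n - (i : ℤ) - (j : ℤ) = n + 1 - ((i + 1 : ℕ) : ℤ) - (j : ℤ) := by push_cast; ring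
      rw [e] at this
      exact this
  · cases j with
    | zero => exact zero_mem _
    | succ j =>
      have hid : DGRightComodule.IsHom (M := I.obj i) (M' := I.obj i) LinearMap.id :=
        ⟨isDGMap_id _, fun m => by simp⟩
      refine ⟨map_mem_cotensor hid (J.δ_hom j) (hx i j).1, ?_⟩
      have := (isDGMap_map (isDGMap_id (I.obj i).toDGVect) (J.δ_hom j).toIsDGMap).map_mem
        (hx i j).2
      have e : n - (i : ℤ) - (j : ℤ) = n + 1 - (i : ℤ) - ((j + 1 : ℕ) : ℤ) := by push_cast; ring
      rw [e] at this
      exact this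
  · refine ⟨tensorD_mem_cotensor (hx i j).1, ?_⟩
    have := DGVect.tensorD_mem (hx i j).2
    have e : n - (i : ℤ) - (j : ℤ) + 1 = n + 1 - (i : ℤ) - (j : ℤ) := by ring
    rw [e] at this
    exact this

theorem cotorD_cotorD (I : InjRes (rightComodules C) X) (J : InjRes (leftComodules C) Y)
    (x : CotorAmbient I J) : cotorD I J (cotorD I J x) = 0 := by
  have hr : ∀ i j t, DGVect.tensorD (I.obj (i + 1)).toDGVect (J.obj j).toDGVect
      ((I.δ i).rTensor (J.obj j).carrier t) = (I.δ i).rTensor (J.obj j).carrier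
        (DGVect.tensorD (I.obj i).toDGVect (J.obj j).toDGVect t) := fun i j t =>
    ((isDGMap_map (I.δ_hom i).toIsDGMap (isDGMap_id (J.obj j).toDGVect)).map_d t).symm
  have hl : ∀ i j t, DGVect.tensorD (I.obj i).toDGVect (J.obj (j + 1)).toDGVect
      ((J.δ j).lTensor (I.obj i).carrier t) = (J.δ j).lTensor (I.obj i).carrier
        (DGVect.tensorD (I.obj i).toDGVect (J.obj j).toDGVect t) := fun i j t =>
    ((isDGMap_map (isDGMap_id (I.obj i).toDGVect) (J.δ_hom j).toIsDGMap).map_d t).symm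
  have hrr : ∀ i j (t : (I.obj i).carrier ⊗[k] (J.obj j).carrier),
      (I.δ (i + 1)).rTensor (J.obj j).carrier ((I.δ i).rTensor (J.obj j).carrier t) = 0 := by
    intro i j t
    have := LinearMap.rTensor_comp (J.obj j).carrier (I.δ (i + 1)) (I.δ i)
    rw [I.δ_δ i, LinearMap.rTensor_zero] at this
    exact (LinearMap.congr_fun this t).symm
  have hll : ∀ i j (t : (I.obj i).carrier ⊗[k] (J.obj j).carrier),
      (J.δ (j + 1)).lTensor (I.obj i).carrier ((J.δ j).lTensor (I.obj i).carrier t) = 0 := by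
    intro i j t
    have := LinearMap.lTensor_comp (I.obj i).carrier (J.δ (j + 1)) (J.δ j)
    rw [J.δ_δ j, LinearMap.lTensor_zero] at this
    exact (LinearMap.congr_fun this t).symm
  have hlr : ∀ i j (t : (I.obj i).carrier ⊗[k] (J.obj j).carrier),
      (I.δ i).rTensor (J.obj (j + 1)).carrier ((J.δ j).lTensor (I.obj i).carrier t) =
        (J.δ j).lTensor (I.obj (i + 1)).carrier ((I.δ i).rTensor (J.obj j).carrier t) := by
    intro i j t
    induction t using TensorProduct.induction_on with
    | zero => simp
    | tmul a b => rfl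
    | add a b ha hb => simp only [map_add, ha, hb]
  have hI0 : ∀ j y, cotorDI I J 0 j y = 0 := fun j y => rfl
  have hI1 : ∀ i j y, cotorDI I J (i + 1) j y =
      (I.δ i).rTensor (J.obj j).carrier (y i j) := fun i j y => rfl
  have hJ0 : ∀ i y, cotorDJ I J i 0 y = 0 := fun i y => by cases i <;> rfl
  have hJ1 : ∀ i j y, cotorDJ I J i (j + 1) y =
      (J.δ j).lTensor (I.obj i).carrier (y i j) := fun i j y => by cases i <;> rfl
  have hRI : ∀ i j, (I.δ i).rTensor (J.obj j).carrier (cotorDI I J i j x) = 0 := by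
    intro i j
    cases i with
    | zero => rw [hI0, map_zero]
    | succ i => rw [hI1, hrr]
  have hLJ : ∀ i j, (J.δ j).lTensor (I.obj i).carrier (cotorDJ I J i j x) = 0 := by
    intro i j
    cases j with
    | zero => rw [hJ0, map_zero]
    | succ j => rw [hJ1, hll]
  have hTT : ∀ i j, DGVect.tensorD (I.obj i).toDGVect (J.obj j).toDGVect
      (DGVect.tensorD (I.obj i).toDGVect (J.obj j).toDGVect (x i j)) = 0 :=
    fun i j => DGVect.tensorD_tensorD _ _ _
  funext i j
  change _ = (0 : (I.obj i).carrier ⊗[k] (J.obj j).carrier)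
  cases i with
  | zero =>
    cases j with
    | zero =>
      rw [cotorD_apply, cotorD_apply]
      simp only [hI0, hJ0, map_add, map_smul, map_zero, smul_zero, hTT, zero_add]
    | succ j =>
      rw [cotorD_apply, hJ1, cotorD_apply, cotorD_apply]
      simp only [hI0, hJ1, map_add, map_smul, map_zero, smul_zero, hTT, hLJ, hl, zero_add,
        add_zero, smul_smul, ← add_smul]
      convert zero_smul k _
      push_cast
      simp only [sgn_add, sgn_one, sgn_zero]
      ring
  | succ i =>
    cases j with
    | zero =>
      rw [cotorD_apply, hI1, cotorD_apply, cotorD_apply]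
      simp only [hJ0, hI1, map_add, map_smul, map_zero, smul_zero, hTT, hRI, hr, zero_add,
        add_zero, smul_smul, ← add_smul]
      convert zero_smul k _
      push_cast
      simp only [sgn_add, sgn_one, sgn_zero]
      ring
    | succ j =>
      rw [cotorD_apply, hI1, hJ1, cotorD_apply, cotorD_apply, cotorD_apply]
      simp only [hJ1, hI1, map_add, map_smul, smul_zero, hTT, hRI, hLJ, hr, hl, hlr, zero_add,
        add_zero, smul_smul, smul_add]
      push_cast
      simp only [sgn_add, sgn_one]
      module

/-- The product total complex of the triple complex `I □_C J`. -/
def cotorComplex (I : InjRes (rightComodules C) X) (J : InjRes (leftComodules C) Y) :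
    CochainComplex (ModuleCat.{u} k) ℤ :=
  subComplex (cotorDeg I J) (fun _ => cotorD I J) (cotorD_mem I J)
    (fun _ x _ => cotorD_cotorD I J x)

/-- `Cotor^C_n(X, Y)`, computed by the injective resolutions `I` and `J`: the homology in homological
degree `n`, that is, in cohomological degree `-n`. -/
def Cotor (I : InjRes (rightComodules C) X) (J : InjRes (leftComodules C) Y) (n : ℤ) :
    ModuleCat.{u} k := (cotorComplex I J).homology (-n)

end Cotor

section CotorMap
open CategoryTheory
variable {k : Type u} [Field k] {C : DGCoalgebra k}
  {X X' : DGRightComodule C} {Y Y' : DGLeftComodule C}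
  {f : X.toDGVect →ₗ[k] X'.toDGVect} {g : Y.toDGVect →ₗ[k] Y'.toDGVect}
  {I : InjRes (rightComodules C) X} {J : InjRes (leftComodules C) Y}
  {I' : InjRes (rightComodules C) X'} {J' : InjRes (leftComodules C) Y'}

/-- The map `x ↦ (φ ⊗ ψ) x`, componentwise. -/
def cotorAmbientMap (φ : InjRes.Lift (T := rightComodules C) f I I')
    (ψ : InjRes.Lift (T := leftComodules C) g J J') : CotorAmbient I J →ₗ[k] CotorAmbient I' J' :=
  LinearMap.pi fun i => LinearMap.pi fun j =>
    TensorProduct.map (φ.map i) (ψ.map j) ∘ₗ LinearMap.proj j ∘ₗ LinearMap.proj i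

theorem cotorAmbientMap_apply (φ : InjRes.Lift (T := rightComodules C) f I I')
    (ψ : InjRes.Lift (T := leftComodules C) g J J') (x : CotorAmbient I J) (i j : ℕ) :
    cotorAmbientMap φ ψ x i j = TensorProduct.map (φ.map i) (ψ.map j) (x i j) := rfl

theorem cotorAmbientMap_mem (φ : InjRes.Lift (T := rightComodules C) f I I')
    (ψ : InjRes.Lift (T := leftComodules C) g J J') (n : ℤ) (x : CotorAmbient I J)
    (hx : x ∈ cotorDeg I J n) : cotorAmbientMap φ ψ x ∈ cotorDeg I' J' n := fun i j =>
  ⟨map_mem_cotensor (φ.map_hom i) (ψ.map_hom j) (hx i j).1,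
    (isDGMap_map (φ.map_hom i).toIsDGMap (ψ.map_hom j).toIsDGMap).map_mem (hx i j).2⟩

theorem cotorAmbientMap_D (φ : InjRes.Lift (T := rightComodules C) f I I')
    (ψ : InjRes.Lift (T := leftComodules C) g J J') (x : CotorAmbient I J) :
    cotorD I' J' (cotorAmbientMap φ ψ x) = cotorAmbientMap φ ψ (cotorD I J x) := by
  have hd : ∀ i j t, DGVect.tensorD (I'.obj i).toDGVect (J'.obj j).toDGVect
      (TensorProduct.map (φ.map i) (ψ.map j) t) = TensorProduct.map (φ.map i) (ψ.map j)
        (DGVect.tensorD (I.obj i).toDGVect (J.obj j).toDGVect t) := fun i j t =>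
    ((isDGMap_map (φ.map_hom i).toIsDGMap (ψ.map_hom j).toIsDGMap).map_d t).symm
  have hI : ∀ i j, cotorDI I' J' i j (cotorAmbientMap φ ψ x) =
      TensorProduct.map (φ.map i) (ψ.map j) (cotorDI I J i j x) := by
    intro i j
    cases i with
    | zero => exact (map_zero _).symm
    | succ i =>
      change (I'.δ i).rTensor (J'.obj j).carrier (TensorProduct.map (φ.map i) (ψ.map j) (x i j)) =
        TensorProduct.map (φ.map (i + 1)) (ψ.map j) ((I.δ i).rTensor (J.obj j).carrier (x i j))
      induction x i j using TensorProduct.induction_on with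
      | zero => simp only [map_zero]
      | add a b ha hb => simp only [map_add, ha, hb]
      | tmul a b =>
        simp only [TensorProduct.map_tmul, LinearMap.rTensor_tmul]
        congr 1
        exact (LinearMap.congr_fun (φ.map_δ i) a).symm
  have hJ : ∀ i j, cotorDJ I' J' i j (cotorAmbientMap φ ψ x) =
      TensorProduct.map (φ.map i) (ψ.map j) (cotorDJ I J i j x) := by
    intro i j
    cases j with
    | zero => cases i <;> exact (map_zero _).symm
    | succ j =>
      have e : (J'.δ j).lTensor (I'.obj i).carrier
          (TensorProduct.map (φ.map i) (ψ.map j) (x i j)) =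
        TensorProduct.map (φ.map i) (ψ.map (j + 1))
          ((J.δ j).lTensor (I.obj i).carrier (x i j)) := by
        induction x i j using TensorProduct.induction_on with
        | zero => simp only [map_zero]
        | add a b ha hb => simp only [map_add, ha, hb]
        | tmul a b =>
          simp only [TensorProduct.map_tmul, LinearMap.lTensor_tmul]
          congr 1
          exact (LinearMap.congr_fun (ψ.map_δ j) b).symm
      cases i <;> exact e
  funext i j
  rw [cotorD_apply, cotorAmbientMap_apply, cotorAmbientMap_apply, cotorD_apply, hd, hI, hJ]
  simp only [map_add, map_smul]

/-- The map on Cotor induced by maps of resolutions. -/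
def Cotor.map (φ : InjRes.Lift (T := rightComodules C) f I I')
    (ψ : InjRes.Lift (T := leftComodules C) g J J') (n : ℤ) : Cotor I J n ⟶ Cotor I' J' n :=
  HomologicalComplex.homologyMap
    (subComplexMap (cotorAmbientMap φ ψ) (cotorAmbientMap_mem φ ψ)
      (fun _ x _ => cotorAmbientMap_D φ ψ x) : cotorComplex I J ⟶ cotorComplex I' J') (-n)

end CotorMap

/-! ### DG Hochschild cohomology -/

section Hochschild
open CategoryTheory
variable {k : Type u} [Field k] {A : DGAlgebra k}

/-- `Hom_{A^e}(A, B)` in degree `q`: the linear maps `f : A → B` of degree `q` with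
`f (a b) = (-1) ^ (q |a|) a f b` and `f (b a) = (f b) a`. -/
def bimoduleHom (B : DGBimodule A) (q : ℤ) : Submodule k (A.carrier →ₗ[k] B.carrier) where
  carrier := {f | (∀ i, ∀ a ∈ A.gr i, f a ∈ B.gr (i + q)) ∧
    (∀ i, ∀ a ∈ A.gr i, ∀ b, f (a * b) = sgn k (q * i) • B.lact a (f b)) ∧
    ∀ a b, f (b * a) = B.ract (.op a) (f b)}
  add_mem' {f g} hf hg := by
    refine ⟨fun i a ha => add_mem (hf.1 i a ha) (hg.1 i a ha), fun i a ha b => ?_, fun a b => ?_⟩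
    · simp only [LinearMap.add_apply, hf.2.1 i a ha b, hg.2.1 i a ha b, map_add, smul_add]
    · simp only [LinearMap.add_apply, hf.2.2 a b, hg.2.2 a b, map_add]
  zero_mem' := by
    refine ⟨fun i a ha => zero_mem _, fun i a ha b => ?_, fun a b => ?_⟩ <;> simp
  smul_mem' c f hf := by
    refine ⟨fun i a ha => Submodule.smul_mem _ _ (hf.1 i a ha), fun i a ha b => ?_, fun a b => ?_⟩
    · simp only [LinearMap.smul_apply, hf.2.1 i a ha b, map_smul, smul_comm c]
    · simp only [LinearMap.smul_apply, hf.2.2 a b, map_smul]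

/-- The differential `f ↦ d ∘ f - (-1) ^ q f ∘ d` on maps of degree `q`. -/
def homD (B : DGBimodule A) (q : ℤ) :
    (A.carrier →ₗ[k] B.carrier) →ₗ[k] (A.carrier →ₗ[k] B.carrier) :=
  LinearMap.compRight k B.d - sgn k q • LinearMap.lcomp k B.carrier A.d

theorem homD_apply (B : DGBimodule A) (q : ℤ) (f : A.carrier →ₗ[k] B.carrier) (a : A) :
    homD B q f a = B.d (f a) - sgn k q • f (A.d a) := rfl

theorem homD_mem {B : DGBimodule A} {q : ℤ} {f : A.carrier →ₗ[k] B.carrier}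
    (hf : f ∈ bimoduleHom B q) : homD B q f ∈ bimoduleHom B (q + 1) := by
  obtain ⟨h1, h2, h3⟩ := hf
  refine ⟨fun i a ha => ?_, fun i a ha b => ?_, fun a b => ?_⟩
  · rw [homD_apply]
    refine sub_mem ?_ (Submodule.smul_mem _ _ ?_)
    · have := B.d_mem (h1 i a ha)
      rwa [add_assoc] at this
    · have := h1 (i + 1) _ (A.d_mem ha)
      rwa [add_assoc, add_comm 1 q] at this
  · rw [homD_apply, homD_apply, A.leibniz ha, h2 i a ha, map_add, map_smul, map_smul,
      h2 i a ha, h2 (i + 1) _ (A.d_mem ha), B.leibniz_left ha, map_sub, map_smul]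
    have e1 : sgn k q * sgn k (q * (i + 1)) = sgn k (q * i) := by
      rw [← sgn_add]; exact sgn_congr (by ring_nf; simp [Int.even_add])
    have e2 : sgn k ((q + 1) * i) = sgn k (q * i) * sgn k i := by
      rw [← sgn_add]; congr 1; ring
    simp only [smul_add, smul_sub, smul_smul, e1, e2]
    module
  · refine A.V.induction (P := fun b => homD B q f (b * a) = B.ract (.op a) (homD B q f b))
      ?_ ?_ b
    · intro i b hb
      have hb' : b ∈ A.gr i := hb
      rw [homD_apply, homD_apply, A.leibniz hb', h3, map_add, map_smul, h3, h3,
        B.leibniz_right a (h1 i b hb), map_sub, map_smul, sgn_add, smul_add, smul_smul,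
        mul_comm (sgn k q)]
      abel
    · intro x y hx hy
      simp only [add_mul, map_add, hx, hy]

theorem homD_homD (B : DGBimodule A) (q : ℤ) (f : A.carrier →ₗ[k] B.carrier) :
    homD B (q + 1) (homD B q f) = 0 := by
  ext a
  simp only [homD_apply, map_sub, map_smul, B.d_d, A.d_d, sgn_add, sgn_one, map_zero, smul_zero,
    LinearMap.zero_apply]
  module

theorem homD_comp {B B' : DGBimodule A} {h : B.toDGVect →ₗ[k] B'.toDGVect} (hh : IsDGMap h)
    (q : ℤ) (f : A.carrier →ₗ[k] B.carrier) : homD B' q (h ∘ₗ f) = h ∘ₗ homD B q f := by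
  ext a
  simp only [homD_apply, LinearMap.comp_apply, map_sub, map_smul, hh.map_d]

theorem comp_mem_bimoduleHom {B B' : DGBimodule A} {h : B.toDGVect →ₗ[k] B'.toDGVect}
    (hh : DGBimodule.IsHom h) {q : ℤ} {f : A.carrier →ₗ[k] B.carrier}
    (hf : f ∈ bimoduleHom B q) : h ∘ₗ f ∈ bimoduleHom B' q := by
  refine ⟨fun i a ha => hh.map_mem (hf.1 i a ha), fun i a ha b => ?_, fun a b => ?_⟩
  · rw [LinearMap.comp_apply, hf.2.1 i a ha, map_smul, hh.map_lact, LinearMap.comp_apply]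
  · rw [LinearMap.comp_apply, hf.2.2, hh.map_ract, LinearMap.comp_apply]

variable {B : DGBimodule A}

/-- The product of all the spaces `Hom_k(A, E^p)`. -/
abbrev HochAmbient (E : InjRes (bimodules A) B) : Type u :=
  ∀ p : ℕ, A.carrier →ₗ[k] (E.obj p).carrier

/-- The part of degree `n` of the product total complex of `Hom_{A^e}(A, E)`. -/
def hochDeg (E : InjRes (bimodules A) B) (n : ℤ) : Submodule k (HochAmbient E) where
  carrier := {x | ∀ p : ℕ, x p ∈ bimoduleHom (E.obj p) (n - p)}
  add_mem' hx hy p := add_mem (hx p) (hy p)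
  zero_mem' _ := zero_mem _
  smul_mem' c _ hx p := Submodule.smul_mem _ c (hx p)

/-- The part of the total differential that comes from `E`. -/
def hochDE (E : InjRes (bimodules A) B) :
    ∀ p : ℕ, HochAmbient E →ₗ[k] (A.carrier →ₗ[k] (E.obj p).carrier)
  | 0 => 0
  | p + 1 => LinearMap.compRight k (E.δ p) ∘ₗ LinearMap.proj p

/-- The total differential in degree `n`: on `Hom(A, E^p)^(n-p)` it is `δ_E + (-1)^p d`. -/
def hochD (E : InjRes (bimodules A) B) (n : ℤ) : HochAmbient E →ₗ[k] HochAmbient E :=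
  LinearMap.pi fun p => hochDE E p + sgn k p • homD (E.obj p) (n - p) ∘ₗ LinearMap.proj p

theorem hochD_apply (E : InjRes (bimodules A) B) (n : ℤ) (x : HochAmbient E) (p : ℕ) :
    hochD E n x p = hochDE E p x + sgn k p • homD (E.obj p) (n - p) (x p) := rfl

theorem hochD_mem (E : InjRes (bimodules A) B) (n : ℤ) (x : HochAmbient E)
    (hx : x ∈ hochDeg E n) : hochD E n x ∈ hochDeg E (n + 1) := by
  intro p
  rw [hochD_apply]
  refine add_mem ?_ (Submodule.smul_mem _ _ ?_)
  · cases p with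
    | zero => exact zero_mem _
    | succ p =>
      have := comp_mem_bimoduleHom (E.δ_hom p) (hx p)
      have e : n - (p : ℤ) = n + 1 - ((p + 1 : ℕ) : ℤ) := by push_cast; ring
      rw [e] at this
      exact this
  · have := homD_mem (hx p)
    have e : n - (p : ℤ) + 1 = n + 1 - (p : ℤ) := by ring
    rw [e] at this
    exact this

theorem hochD_hochD (E : InjRes (bimodules A) B) (n : ℤ) (x : HochAmbient E) :
    hochD E (n + 1) (hochD E n x) = 0 := by
  have h1 : ∀ p y, hochDE E (p + 1) y = E.δ p ∘ₗ y p := fun p y => rfl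
  have hdd : ∀ p : ℕ, homD (E.obj p) (n + 1 - p) (homD (E.obj p) (n - p) (x p)) = 0 := by
    intro p
    have e : n + 1 - (p : ℤ) = n - (p : ℤ) + 1 := by ring
    rw [e, homD_homD]
  funext p
  change _ = (0 : A.carrier →ₗ[k] (E.obj p).carrier)
  cases p with
  | zero =>
    rw [hochD_apply, hochD_apply]
    change 0 + sgn k _ • homD (E.obj 0) _ (0 + sgn k _ • homD (E.obj 0) _ (x 0)) = 0
    rw [zero_add, zero_add, map_smul, hdd 0, smul_zero, smul_zero]
  | succ p =>
    have hz : E.δ p ∘ₗ hochDE E p x = 0 := by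
      cases p with
      | zero => exact LinearMap.comp_zero _
      | succ p => rw [h1, ← LinearMap.comp_assoc, E.δ_δ, LinearMap.zero_comp]
    rw [hochD_apply, h1, hochD_apply, hochD_apply, h1, LinearMap.comp_add, hz, map_add, map_smul,
      hdd, LinearMap.comp_smul, homD_comp (E.δ_hom p).toIsDGMap]
    have e : n + 1 - ((p + 1 : ℕ) : ℤ) = n - (p : ℤ) := by push_cast; ring
    rw [e]
    push_cast
    rw [sgn_add, sgn_one]
    module

/-- The product total complex of `Hom_{A^e}(A, E)`. -/
def hochComplex (E : InjRes (bimodules A) B) : CochainComplex (ModuleCat.{u} k) ℤ :=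
  subComplex (hochDeg E) (hochD E) (hochD_mem E) (fun n x _ => hochD_hochD E n x)

/-- The DG Hochschild cohomology `H_DG^n(A, B)`, computed by the injective resolution `E` of the
DG bimodule `B`. -/
def HDG (E : InjRes (bimodules A) B) (n : ℤ) : ModuleCat.{u} k := (hochComplex E).homology n

variable {B' : DGBimodule A} {f : B.toDGVect →ₗ[k] B'.toDGVect} {E : InjRes (bimodules A) B}
  {E' : InjRes (bimodules A) B'}

/-- Composition with a map of resolutions, componentwise. -/
def hochAmbientMap (θ : InjRes.Lift (T := bimodules A) f E E') :
    HochAmbient E →ₗ[k] HochAmbient E' :=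
  LinearMap.pi fun p => LinearMap.compRight k (θ.map p) ∘ₗ LinearMap.proj p

theorem hochAmbientMap_apply (θ : InjRes.Lift (T := bimodules A) f E E') (x : HochAmbient E)
    (p : ℕ) : hochAmbientMap θ x p = θ.map p ∘ₗ x p := rfl

theorem hochAmbientMap_mem (θ : InjRes.Lift (T := bimodules A) f E E') (n : ℤ)
    (x : HochAmbient E) (hx : x ∈ hochDeg E n) : hochAmbientMap θ x ∈ hochDeg E' n :=
  fun p => comp_mem_bimoduleHom (θ.map_hom p) (hx p)

theorem hochAmbientMap_D (θ : InjRes.Lift (T := bimodules A) f E E') (n : ℤ)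
    (x : HochAmbient E) : hochD E' n (hochAmbientMap θ x) = hochAmbientMap θ (hochD E n x) := by
  funext p
  rw [hochD_apply, hochAmbientMap_apply, hochAmbientMap_apply, hochD_apply,
    homD_comp (θ.map_hom p).toIsDGMap, LinearMap.comp_add, LinearMap.comp_smul]
  congr 1
  cases p with
  | zero => exact (LinearMap.comp_zero _).symm
  | succ p =>
    change E'.δ p ∘ₗ (θ.map p ∘ₗ x p) = θ.map (p + 1) ∘ₗ (E.δ p ∘ₗ x p)
    rw [← LinearMap.comp_assoc, ← LinearMap.comp_assoc]
    congr 1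
    exact (θ.map_δ p).symm

/-- The map on DG Hochschild cohomology induced by a map of resolutions. -/
def HDG.map (θ : InjRes.Lift (T := bimodules A) f E E') (n : ℤ) : HDG E n ⟶ HDG E' n :=
  HomologicalComplex.homologyMap
    (subComplexMap (hochAmbientMap θ) (hochAmbientMap_mem θ)
      (fun n x _ => hochAmbientMap_D θ n x) : hochComplex E ⟶ hochComplex E') n

end Hochschild

end DGCotor

end

noncomputable section

namespace DGCotor

/-! ### Split resolutions, lifts and homotopies -/

section Abstract
variable {k : Type u} [Field k]

/-! Write C = DA. A right C-comodule X and a left C-comodule Y are in particular a left and a right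
DG A-module, so X ⊗ Y is a DG A-bimodule. Evaluating the middle factor of X ⊗ C ⊗ Y at elements of A
turns the equation that cuts out X □ Y into a condition on the two actions: an element t of degree n
lies in X □ Y exactly when t a = (-1)^(n|a|) a t for all homogeneous a (`mem_cotensor_iff`). On the
other side, f ↦ f(1) identifies Hom^n_{A^e}(A, B) with the elements of degree n of B that satisfy
the same equation (`orbit_mem_bimoduleHom`, `isCentral_of_mem_bimoduleHom`). Hence I □ J and
Hom_{A^e}(A, Tot(I ⊗ J)) have the same product total complex; the inner total complex takes finite
sums only, since finitely many pairs (i, j) have i + j = p.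

It remains to use Tot(I ⊗ J) as a resolution of the bimodule M ⊗ N. It is a split resolution for all
I and J (`totRes`). Its terms are shown to be injective when I and J are the standard resolutions by
cofree comodules V ⊗ C and C ⊗ W, with V and W bounded above (`isInjective_totObj_stdRes`). Indeed
(V ⊗ C) ⊗ (C ⊗ W) then plays the role of the coinduced bimodule Hom(A ⊗ A, V ⊗ W): for a DG map v
from a DG bimodule Z to V ⊗ W and a homogeneous z in Z, the function (a, b) ↦ v(a z b) vanishes as
soon as |a| or |b| is large, so by finite type it comes from an element of the tensor product
(`cogenerating_counitTensor`). A relative extension problem is thereby reduced to DG vector spaces,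
where it is solved by the given retraction (`Cogenerating.isInjective`).

Arbitrary resolutions are handled by relative homological algebra. Any lift Tot(I ⊗ J) → E of the
identity induces a map from Cotor to Hochschild cohomology. Lifts exist and are unique up to
homotopy (`SplitRes.exists_lift`, `SplitRes.exists_htpy`), so this map does not depend on the lift
(`comparison_eq`). Naturality follows, because both composites are induced by lifts of the same map
f ⊗ g. That the map is an isomorphism is transported from the standard resolutions along maps of
resolutions (`isIso_comparison`). -/

theorem IsDGMap.comp {X Y Z : DGVect k} {g : Y →ₗ[k] Z} {f : X →ₗ[k] Y} (hg : IsDGMap g)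
    (hf : IsDGMap f) : IsDGMap (X := X) (Y := Z) (g ∘ₗ f) :=
  ⟨fun h => hg.map_mem (hf.map_mem h), fun x => by
    rw [LinearMap.comp_apply, hf.map_d, hg.map_d, LinearMap.comp_apply]⟩

theorem IsDGMap.sub {X Y : DGVect k} {g f : X →ₗ[k] Y} (hg : IsDGMap g)
    (hf : IsDGMap f) : IsDGMap (X := X) (Y := Y) (g - f) :=
  ⟨fun h => sub_mem (hg.map_mem h) (hf.map_mem h), fun x => by
    simp only [LinearMap.sub_apply, hf.map_d, hg.map_d, map_sub]⟩

/-- The homomorphisms form a category enriched in additive groups, and are DG maps. -/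
structure DGCat.IsPreadditive (T : DGCat k) : Prop where
  isDGMap : ∀ {X Y : T.Obj} {f : T.U X →ₗ[k] T.U Y}, T.IsHom f → IsDGMap f
  id : ∀ X : T.Obj, T.IsHom (X := X) (Y := X) LinearMap.id
  comp : ∀ {X Y Z : T.Obj} {g : T.U Y →ₗ[k] T.U Z} {f : T.U X →ₗ[k] T.U Y},
    T.IsHom g → T.IsHom f → T.IsHom (g ∘ₗ f)
  sub : ∀ {X Y : T.Obj} {g f : T.U X →ₗ[k] T.U Y}, T.IsHom g → T.IsHom f → T.IsHom (g - f)

/-- A homomorphism `g : X → Q` to an injective object extends along a split homomorphism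
`δ : X → Y`, not necessarily injective, if it vanishes on the kernel of `δ`. -/
def DGCat.HasExtensions (T : DGCat k) : Prop :=
  ∀ (X Y Q : T.Obj) (δ : T.U X →ₗ[k] T.U Y) (s : T.U Y →ₗ[k] T.U X) (g : T.U X →ₗ[k] T.U Q),
    T.IsInjective Q → T.IsHom δ → IsDGMap s → δ ∘ₗ s ∘ₗ δ = δ → T.IsHom g → g ∘ₗ s ∘ₗ δ = g →
      ∃ h : T.U Y →ₗ[k] T.U Q, T.IsHom h ∧ h ∘ₗ δ = g

/-- A resolution `0 → X → I^0 → I^1 → ⋯` with a contracting homotopy in DG vector spaces. -/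
structure SplitRes (T : DGCat k) (X : T.Obj) where
  obj : ℕ → T.Obj
  aug : T.U X →ₗ[k] T.U (obj 0)
  δ : ∀ i, T.U (obj i) →ₗ[k] T.U (obj (i + 1))
  aug_hom : T.IsHom aug
  δ_hom : ∀ i, T.IsHom (δ i)
  δ_aug : δ 0 ∘ₗ aug = 0
  δ_δ : ∀ i, δ (i + 1) ∘ₗ δ i = 0
  split : ∃ (s₀ : T.U (obj 0) →ₗ[k] T.U X) (s : ∀ i, T.U (obj (i + 1)) →ₗ[k] T.U (obj i)),
    IsDGMap s₀ ∧ (∀ i, IsDGMap (s i)) ∧ s₀ ∘ₗ aug = LinearMap.id ∧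
      aug ∘ₗ s₀ + s 0 ∘ₗ δ 0 = LinearMap.id ∧
      ∀ i, δ i ∘ₗ s i + s (i + 1) ∘ₗ δ (i + 1) = LinearMap.id

/-- Forget that the objects of a resolution are injective. -/
abbrev InjRes.toSplitRes {T : DGCat k} {X : T.Obj} (I : InjRes T X) : SplitRes T X where
  obj := I.obj
  aug := I.aug
  δ := I.δ
  aug_hom := I.aug_hom
  δ_hom := I.δ_hom
  δ_aug := I.δ_aug
  δ_δ := I.δ_δ
  split := I.split

/-- A split resolution with injective objects. -/
abbrev SplitRes.toInjRes {T : DGCat k} {X : T.Obj} (R : SplitRes T X)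
    (h : ∀ i, T.IsInjective (R.obj i)) : InjRes T X where
  obj := R.obj
  injective := h
  aug := R.aug
  δ := R.δ
  aug_hom := R.aug_hom
  δ_hom := R.δ_hom
  δ_aug := R.δ_aug
  δ_δ := R.δ_δ
  split := R.split

/-- Maps of split resolutions over a given map `f`. -/
structure SplitRes.Lift {T : DGCat k} {X X' : T.Obj} (f : T.U X →ₗ[k] T.U X') (R : SplitRes T X)
    (S : SplitRes T X') where
  map : ∀ i, T.U (R.obj i) →ₗ[k] T.U (S.obj i)
  map_hom : ∀ i, T.IsHom (map i)
  map_aug : map 0 ∘ₗ R.aug = S.aug ∘ₗ f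
  map_δ : ∀ i, map (i + 1) ∘ₗ R.δ i = S.δ i ∘ₗ map i

/-- A lift to injective resolutions as a lift to the underlying split resolutions. -/
abbrev InjRes.Lift.toSplitRes {T : DGCat k} {X X' : T.Obj} {f : T.U X →ₗ[k] T.U X'}
    {I : InjRes T X} {I' : InjRes T X'} (φ : InjRes.Lift f I I') :
    SplitRes.Lift f I.toSplitRes I'.toSplitRes where
  map := φ.map
  map_hom := φ.map_hom
  map_aug := φ.map_aug
  map_δ := φ.map_δ

variable {T : DGCat k} {X X' : T.Obj} {f : T.U X →ₗ[k] T.U X'}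

/-- Homotopies between lifts. -/
structure SplitRes.Htpy {R : SplitRes T X} {S : SplitRes T X'} (φ ψ : SplitRes.Lift f R S) where
  map : ∀ i, T.U (R.obj (i + 1)) →ₗ[k] T.U (S.obj i)
  map_hom : ∀ i, T.IsHom (map i)
  zero : φ.map 0 - ψ.map 0 = map 0 ∘ₗ R.δ 0
  succ : ∀ i, φ.map (i + 1) - ψ.map (i + 1) = S.δ i ∘ₗ map i + map (i + 1) ∘ₗ R.δ (i + 1)

/-- Sequences are constructed step by step. -/
theorem exists_seq {α : ℕ → Type u} {P : ∀ n, α n → Prop} {Q : ∀ n, α n → α (n + 1) → Prop}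
    {P₀ : α 0 → Prop} (h0 : ∃ a, P 0 a ∧ P₀ a) (h : ∀ n a, P n a → ∃ b, P (n + 1) b ∧ Q n a b) :
    ∃ a : ∀ n, α n, (∀ n, P n (a n)) ∧ P₀ (a 0) ∧ ∀ n, Q n (a n) (a (n + 1)) := by
  choose b hb using h
  obtain ⟨a₀, h1, h2⟩ := h0
  let a : ∀ n, {x : α n // P n x} := fun n =>
    Nat.rec ⟨a₀, h1⟩ (fun n x => ⟨b n x.1 x.2, (hb n x.1 x.2).1⟩) n
  exact ⟨fun n => (a n).1, fun n => (a n).2, h2, fun n => (hb n _ (a n).2).2⟩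

/-- The comparison theorem of homological algebra, extending degree by degree along the split maps
of `R`. The objects of `R` are not required to be injective: later `R` is the total complex of I ⊗ J
for arbitrary I and J. -/
theorem SplitRes.exists_lift (hT : T.IsPreadditive) (hE : T.HasExtensions) (hf : T.IsHom f)
    (R : SplitRes T X) (S : SplitRes T X') (hS : ∀ i, T.IsInjective (S.obj i)) :
    Nonempty (SplitRes.Lift f R S) := by
  obtain ⟨s₀, s, hs₀, hs, h1, h2, h3⟩ := R.split
  have h2' : ∀ x, R.aug (s₀ x) + s 0 (R.δ 0 x) = x := fun x => LinearMap.congr_fun h2 x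
  have h3' : ∀ i x, R.δ i (s i x) + s (i + 1) (R.δ (i + 1) x) = x :=
    fun i x => LinearMap.congr_fun (h3 i) x
  have hRR : ∀ i x, R.δ (i + 1) (R.δ i x) = 0 := fun i x => LinearMap.congr_fun (R.δ_δ i) x
  have hSS : ∀ i x, S.δ (i + 1) (S.δ i x) = 0 := fun i x => LinearMap.congr_fun (S.δ_δ i) x
  have hSa : ∀ x, S.δ 0 (S.aug x) = 0 := fun x => LinearMap.congr_fun S.δ_aug x
  -- Applying the differential to the homotopy identity shows that `s i` splits `R.δ i`, although
  -- `R.δ i` is not injective.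
  have hR : ∀ i, R.δ i ∘ₗ s i ∘ₗ R.δ i = R.δ i := by
    intro i
    ext x
    simp only [LinearMap.comp_apply]
    cases i with
    | zero =>
      have := congrArg (R.δ 0) (h2' x)
      rw [map_add, show R.δ 0 (R.aug (s₀ x)) = 0 from LinearMap.congr_fun R.δ_aug _] at this
      simpa using this
    | succ i =>
      have := congrArg (R.δ (i + 1)) (h3' i x)
      rw [map_add, hRR] at this
      simpa using this
  obtain ⟨m, hm, hm0, hmδ⟩ := exists_seq
    (α := fun i => T.U (R.obj i) →ₗ[k] T.U (S.obj i))
    -- The second half of the invariant is the hypothesis under which `S.δ i ∘ₗ m` extends along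
    -- `R.δ i`; it holds because this map kills the image of the preceding map of `R`.
    (P := fun i m => T.IsHom m ∧ S.δ i ∘ₗ m ∘ₗ s i ∘ₗ R.δ i = S.δ i ∘ₗ m)
    (Q := fun i m m' => m' ∘ₗ R.δ i = S.δ i ∘ₗ m)
    (P₀ := fun m => m ∘ₗ R.aug = S.aug ∘ₗ f)
    (by
      obtain ⟨m, hm, hma⟩ := hE X (R.obj 0) (S.obj 0) R.aug s₀ (S.aug ∘ₗ f) (hS 0) R.aug_hom hs₀
        (by rw [h1, LinearMap.comp_id]) (hT.comp S.aug_hom hf) (by rw [h1, LinearMap.comp_id])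
      refine ⟨m, ⟨hm, ?_⟩, hma⟩
      have hma' : ∀ x, m (R.aug x) = S.aug (f x) := fun x => LinearMap.congr_fun hma x
      ext x
      have := congrArg (fun x => S.δ 0 (m x)) (h2' x)
      simp only [map_add, hma', hSa, zero_add] at this
      exact this)
    (by
      rintro i m ⟨hm, hmi⟩
      obtain ⟨m', hm', hmm⟩ := hE (R.obj i) (R.obj (i + 1)) (S.obj (i + 1)) (R.δ i) (s i)
        (S.δ i ∘ₗ m) (hS _) (R.δ_hom i) (hs i) (hR i) (hT.comp (S.δ_hom i) hm) hmi
      refine ⟨m', ⟨hm', ?_⟩, hmm⟩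
      have hmm' : ∀ x, m' (R.δ i x) = S.δ i (m x) := fun x => LinearMap.congr_fun hmm x
      ext x
      have := congrArg (fun x => S.δ (i + 1) (m' x)) (h3' i x)
      simp only [map_add, hmm', hSS, zero_add] at this
      exact this)
  exact ⟨⟨m, fun i => (hm i).1, hm0, hmδ⟩⟩

/-- The difference of two lifts kills the augmentation, so it extends along `R.δ 0`, and what the
homotopy has not yet accounted for extends in each further degree. The homotopy carries no signs;
the signs of the internal differential are handled where it is applied. -/
theorem SplitRes.exists_htpy (hT : T.IsPreadditive) (hE : T.HasExtensions)
    {R : SplitRes T X} {S : SplitRes T X'} (hS : ∀ i, T.IsInjective (S.obj i))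
    (φ ψ : SplitRes.Lift f R S) : Nonempty (SplitRes.Htpy φ ψ) := by
  obtain ⟨s₀, s, hs₀, hs, h1, h2, h3⟩ := R.split
  have h2' : ∀ x, R.aug (s₀ x) + s 0 (R.δ 0 x) = x := fun x => LinearMap.congr_fun h2 x
  have h3' : ∀ i x, R.δ i (s i x) + s (i + 1) (R.δ (i + 1) x) = x :=
    fun i x => LinearMap.congr_fun (h3 i) x
  have hRR : ∀ i x, R.δ (i + 1) (R.δ i x) = 0 := fun i x => LinearMap.congr_fun (R.δ_δ i) x
  have hSS : ∀ i x, S.δ (i + 1) (S.δ i x) = 0 := fun i x => LinearMap.congr_fun (S.δ_δ i) x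
  have hR : ∀ i, R.δ i ∘ₗ s i ∘ₗ R.δ i = R.δ i := by
    intro i
    ext x
    simp only [LinearMap.comp_apply]
    cases i with
    | zero =>
      have := congrArg (R.δ 0) (h2' x)
      rw [map_add, show R.δ 0 (R.aug (s₀ x)) = 0 from LinearMap.congr_fun R.δ_aug _] at this
      simpa using this
    | succ i =>
      have := congrArg (R.δ (i + 1)) (h3' i x)
      rw [map_add, hRR] at this
      simpa using this
  let v := fun i => φ.map i - ψ.map i
  have hv : ∀ i, T.IsHom (v i) := fun i => hT.sub (φ.map_hom i) (ψ.map_hom i)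
  have hva : ∀ x, v 0 (R.aug x) = 0 := fun x =>
    sub_eq_zero.mpr (LinearMap.congr_fun (φ.map_aug.trans ψ.map_aug.symm) x)
  have hvδ : ∀ i x, v (i + 1) (R.δ i x) = S.δ i (v i x) := by
    intro i x
    have e1 := LinearMap.congr_fun (φ.map_δ i) x
    have e2 := LinearMap.congr_fun (ψ.map_δ i) x
    simp only [LinearMap.comp_apply] at e1 e2
    simp only [v, LinearMap.sub_apply, map_sub, e1, e2]
  obtain ⟨h, hh, hh0, hhs⟩ := exists_seq
    (α := fun i => T.U (R.obj (i + 1)) →ₗ[k] T.U (S.obj i))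
    -- This condition says that `v (i + 1) - S.δ i ∘ₗ h` vanishes on the image of `R.δ i`, and hence
    -- extends along `R.δ (i + 1)`.
    (P := fun i h => T.IsHom h ∧ S.δ i ∘ₗ (v i - h ∘ₗ R.δ i) = 0)
    (Q := fun i h h' => h' ∘ₗ R.δ (i + 1) = v (i + 1) - S.δ i ∘ₗ h)
    (P₀ := fun h => h ∘ₗ R.δ 0 = v 0)
    (by
      obtain ⟨h, hh, hha⟩ := hE (R.obj 0) (R.obj 1) (S.obj 0) (R.δ 0) (s 0) (v 0) (hS 0)
        (R.δ_hom 0) (hs 0) (hR 0) (hv 0) (by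
          ext x
          have := congrArg (v 0) (h2' x)
          rwa [map_add, hva, zero_add] at this)
      exact ⟨h, ⟨hh, by rw [hha, sub_self, LinearMap.comp_zero]⟩, hha⟩)
    (by
      rintro i h ⟨hh, hhi⟩
      have hhi' : ∀ x, S.δ i (v i x) = S.δ i (h (R.δ i x)) := fun x => by
        have := LinearMap.congr_fun hhi x
        simp only [LinearMap.comp_apply, LinearMap.sub_apply, map_sub] at this
        exact sub_eq_zero.mp this
      obtain ⟨h', hh', e⟩ := hE (R.obj (i + 1)) (R.obj (i + 2)) (S.obj (i + 1)) (R.δ (i + 1))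
        (s (i + 1)) (v (i + 1) - S.δ i ∘ₗ h) (hS _) (R.δ_hom _) (hs _) (hR _)
        (hT.sub (hv _) (hT.comp (S.δ_hom i) hh)) (by
          ext x
          have := congrArg (v (i + 1) - S.δ i ∘ₗ h) (h3' i x)
          rw [map_add] at this
          have e0 : (v (i + 1) - S.δ i ∘ₗ h) (R.δ i (s i x)) = 0 := by
            rw [LinearMap.sub_apply, hvδ, hhi', LinearMap.comp_apply, sub_self]
          rwa [e0, zero_add] at this)
      refine ⟨h', ⟨hh', ?_⟩, e⟩
      rw [e]
      ext x
      simp [hSS])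
  refine ⟨⟨h, fun i => (hh i).1, hh0.symm, fun i => ?_⟩⟩
  rw [hhs i, add_sub_cancel]

/-! ### Cofree objects -/

/-- Cofree objects: a right adjoint of the forgetful functor to DG vector spaces. -/
structure DGCat.Cofree (T : DGCat k) where
  F : DGVect k → T.Obj
  map : ∀ {V W : DGVect k}, (V →ₗ[k] W) → (T.U (F V) →ₗ[k] T.U (F W))
  η : ∀ X : T.Obj, T.U X →ₗ[k] T.U (F (T.U X))
  ε : ∀ V : DGVect k, T.U (F V) →ₗ[k] V
  map_hom : ∀ {V W : DGVect k} {f : V →ₗ[k] W}, IsDGMap f → T.IsHom (map f)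
  map_comp : ∀ {V W Z : DGVect k} (g : W →ₗ[k] Z) (f : V →ₗ[k] W), map (V := V) (W := Z) (g ∘ₗ f) =
    map g ∘ₗ map f
  map_zero : ∀ {V W : DGVect k}, map (V := V) (W := W) 0 = 0
  η_hom : ∀ X, T.IsHom (η X)
  η_nat : ∀ {X Y : T.Obj} {f : T.U X →ₗ[k] T.U Y}, T.IsHom f → η Y ∘ₗ f = map f ∘ₗ η X
  ε_dg : ∀ V, IsDGMap (ε V)
  ε_nat : ∀ {V W : DGVect k} (f : V →ₗ[k] W), ε W ∘ₗ map f = f ∘ₗ ε V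
  ε_η : ∀ X, ε (T.U X) ∘ₗ η X = LinearMap.id
  map_ε_η : ∀ V, map (V := T.U (F V)) (W := V) (ε V) ∘ₗ η (F V) = LinearMap.id

namespace DGCat.Cofree

/-- A homomorphism extends along `δ` if the underlying map of DG vector spaces does. -/
theorem map_η_comp (G : T.Cofree) {Y Q : T.Obj} {δ : T.U X →ₗ[k] T.U Y}
    (hδ : T.IsHom δ) {g : T.U X →ₗ[k] T.U Q} (hg : T.IsHom g) {u : T.U Y →ₗ[k] T.U Q}
    (hu : u ∘ₗ δ = g) : (G.map u ∘ₗ G.η Y) ∘ₗ δ = G.η Q ∘ₗ g := by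
  rw [LinearMap.comp_assoc, G.η_nat hδ, ← LinearMap.comp_assoc, ← G.map_comp, hu, G.η_nat hg]

/-- By adjunction a homomorphism to a cofree object is a DG map to its cogenerators. Such a map
extends along `i` by composition with the retraction `r`. -/
theorem isInjective (hT : T.IsPreadditive) (G : T.Cofree) (V : DGVect k) :
    T.IsInjective (G.F V) := by
  intro Y Z i r g hi hr hri hg
  have hgr : IsDGMap (G.ε V ∘ₗ g ∘ₗ r) := (G.ε_dg V).comp ((hT.isDGMap hg).comp hr)
  refine ⟨G.map (G.ε V ∘ₗ g ∘ₗ r) ∘ₗ G.η Z, hT.comp (G.map_hom hgr) (G.η_hom Z), ?_⟩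
  rw [LinearMap.comp_assoc, G.η_nat hi, ← LinearMap.comp_assoc, ← G.map_comp,
    LinearMap.comp_assoc, LinearMap.comp_assoc, hri, LinearMap.comp_id, G.map_comp,
    LinearMap.comp_assoc, ← G.η_nat hg, ← LinearMap.comp_assoc, G.map_ε_η, LinearMap.id_comp]

/-- An injective object is a retract of a cofree one, and for a cofree target it suffices to extend
the underlying DG map, for which `g ∘ₗ s` is available. No image of `δ` has to be formed inside the
category. -/
theorem hasExtensions (hT : T.IsPreadditive) (G : T.Cofree) : T.HasExtensions := by
  intro X Y Q δ s g hQ hδ hs _ hg hgs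
  -- The unit `G.η Q` has the DG retraction `G.ε`, so injectivity of `Q` yields a retraction `p`
  -- which is a homomorphism.
  obtain ⟨p, hp, hpη⟩ := hQ Q (G.F (T.U Q)) (G.η Q) (G.ε _) LinearMap.id (G.η_hom Q) (G.ε_dg _)
    (G.ε_η Q) (hT.id Q)
  refine ⟨p ∘ₗ G.map (g ∘ₗ s) ∘ₗ G.η Y,
    hT.comp hp (hT.comp (G.map_hom ((hT.isDGMap hg).comp hs)) (G.η_hom Y)), ?_⟩
  rw [LinearMap.comp_assoc, G.map_η_comp hδ hg (by rw [LinearMap.comp_assoc, hgs]),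
    ← LinearMap.comp_assoc, hpη, LinearMap.id_comp]

/-- An object `X` with a map `X → F X`. -/
structure Stage (G : T.Cofree) where
  X : T.Obj
  d : T.U X →ₗ[k] T.U (G.F (T.U X))

/-- The next stage of the standard resolution. -/
abbrev Stage.next {G : T.Cofree} (a : G.Stage) : G.Stage where
  X := G.F (T.U a.X)
  d := G.η (G.F (T.U a.X)) - G.map a.d

theorem Stage.next_hom (hT : T.IsPreadditive) {G : T.Cofree} {a : G.Stage} (ha : T.IsHom a.d) :
    T.IsHom a.next.d := hT.sub (G.η_hom _) (G.map_hom (hT.isDGMap ha))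

/-- With d' = η - F d, naturality of η gives (η - F d') d' = F d' (η - d') = F d' F d = F (d' d) =
0. -/
theorem Stage.next_comp (hT : T.IsPreadditive) {G : T.Cofree} {a : G.Stage} (ha : T.IsHom a.d)
    (h : a.next.d ∘ₗ a.d = 0) : a.next.next.d ∘ₗ a.next.d = 0 := by
  have e : a.next.next.d = G.η a.next.next.X - G.map a.next.d := rfl
  have e' : G.η a.next.X - a.next.d = G.map a.d := sub_sub_cancel _ _
  rw [e, LinearMap.sub_comp, G.η_nat (Stage.next_hom hT ha), ← LinearMap.comp_sub, e',
    ← G.map_comp, h, G.map_zero]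

/-- The counits contract the standard resolution: ε (η - F d) = 1 - d ε, by the triangle identity
and naturality of ε. -/
theorem Stage.ε_next {G : T.Cofree} (a : G.Stage) :
    a.d ∘ₗ G.ε (T.U a.X) + G.ε (T.U a.next.X) ∘ₗ a.next.d = LinearMap.id := by
  have e : a.next.d = G.η a.next.X - G.map a.d := rfl
  rw [e, LinearMap.comp_sub, G.ε_η, G.ε_nat, add_sub_cancel]

/-- The stages of the standard resolution. -/
def stage (G : T.Cofree) (X : T.Obj) : ℕ → G.Stage
  | 0 => ⟨X, G.η X⟩
  | n + 1 => (stage G X n).next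

theorem stage_hom (hT : T.IsPreadditive) (G : T.Cofree) (X : T.Obj) (n : ℕ) :
    T.IsHom (G.stage X n).d := by
  induction n with
  | zero => exact G.η_hom X
  | succ n ih => exact Stage.next_hom hT ih

theorem stage_comp (hT : T.IsPreadditive) (G : T.Cofree) (X : T.Obj) (n : ℕ) :
    (G.stage X n).next.d ∘ₗ (G.stage X n).d = 0 := by
  induction n with
  | zero =>
    -- Naturality of η with respect to η itself; for comodules this is coassociativity of the
    -- coaction.
    change (G.η (G.F (T.U X)) - G.map (G.η X)) ∘ₗ G.η X = 0
    rw [LinearMap.sub_comp, G.η_nat (G.η_hom X), sub_self]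
  | succ n ih => exact Stage.next_comp hT (G.stage_hom hT X n) ih

/-- The standard resolution `X → F X → F F X → ⋯`. -/
def stdRes (hT : T.IsPreadditive) (G : T.Cofree) (X : T.Obj) : InjRes T X where
  obj n := G.F (T.U (G.stage X n).X)
  injective _ := G.isInjective hT _
  aug := G.η X
  δ n := (G.stage X n).next.d
  aug_hom := G.η_hom X
  δ_hom n := G.stage_hom hT X (n + 1)
  δ_aug := G.stage_comp hT X 0
  δ_δ n := G.stage_comp hT X (n + 1)
  split := ⟨G.ε (T.U X), fun n => G.ε (T.U (G.stage X n).next.X), G.ε_dg _, fun _ => G.ε_dg _,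
    G.ε_η X, (G.stage X 0).ε_next, fun n => (G.stage X (n + 1)).ε_next⟩

end DGCat.Cofree

end Abstract

/-! ### Homology of complexes cut out of a vector space -/

section SubHomology
open CategoryTheory
variable {k : Type u} [Field k]
  {P : Type u} [AddCommGroup P] [Module k P] {T : ℤ → Submodule k P}
  {D : ℤ → P →ₗ[k] P} {hD : ∀ n, ∀ x ∈ T n, D n x ∈ T (n + 1)}
  {hDD : ∀ n, ∀ x ∈ T n, D (n + 1) (D n x) = 0}
  {P' : Type u} [AddCommGroup P'] [Module k P'] {T' : ℤ → Submodule k P'}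
  {D' : ℤ → P' →ₗ[k] P'} {hD' : ∀ n, ∀ x ∈ T' n, D' n x ∈ T' (n + 1)}
  {hDD' : ∀ n, ∀ x ∈ T' n, D' (n + 1) (D' n x) = 0}

/-- A chain homotopy given by one linear map of the ambient spaces that lowers the degree by one.
Sources are indexed by n + 1, so that no subtraction of degrees is needed. -/
theorem subComplexMap_homology_eq {F G : P →ₗ[k] P'} {hF : ∀ n, ∀ x ∈ T n, F x ∈ T' n}
    {hFD : ∀ n, ∀ x ∈ T n, D' n (F x) = F (D n x)} {hG : ∀ n, ∀ x ∈ T n, G x ∈ T' n}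
    {hGD : ∀ n, ∀ x ∈ T n, D' n (G x) = G (D n x)} (K : P →ₗ[k] P')
    (hK : ∀ n, ∀ x ∈ T (n + 1), K x ∈ T' n)
    (h : ∀ n, ∀ x ∈ T (n + 1), F x - G x = D' n (K x) + K (D (n + 1) x)) (n : ℤ) :
    HomologicalComplex.homologyMap
      (subComplexMap F hF hFD : subComplex T D hD hDD ⟶ subComplex T' D' hD' hDD') n =
    HomologicalComplex.homologyMap (subComplexMap G hG hGD) n := by
  let Kn : ∀ i j : ℤ, j + 1 = i →
      ((subComplex T D hD hDD).X i ⟶ (subComplex T' D' hD' hDD').X j) :=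
    fun i j e => ModuleCat.ofHom (K.restrict (p := T i) (q := T' j) (by subst e; exact hK j))
  let H : Homotopy (subComplexMap F hF hFD : subComplex T D hD hDD ⟶ subComplex T' D' hD' hDD')
      (subComplexMap G hG hGD) :=
    { hom := fun i j => if e : j + 1 = i then Kn i j e else 0
      zero := fun i j hij => dif_neg hij
      comm := fun i => by
        -- Every integer is a successor; after this substitution the degree equations in `Kn` hold
        -- by `rfl`.
        obtain ⟨j, rfl⟩ : ∃ j, i = j + 1 := ⟨i - 1, by ring⟩
        rw [dNext_eq _ (show (ComplexShape.up ℤ).Rel (j + 1) (j + 1 + 1) from rfl),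
          prevD_eq _ (show (ComplexShape.up ℤ).Rel j (j + 1) from rfl), dif_pos rfl, dif_pos rfl]
        simp only [subComplex, CochainComplex.of_d]
        ext x
        have := h j x.1 x.2
        rw [sub_eq_iff_eq_add] at this
        change F x.1 = (K (D (j + 1) x.1) + D' j (K x.1)) + G x.1
        rw [this, add_comm (D' j _)] }
  exact H.homologyMap_eq n

/-- Bijectivity is required on the subspaces `T n` only. The comparison map will satisfy this
without being bijective on the ambient products. -/
theorem isIso_subComplexMap {F : P →ₗ[k] P'} {hF : ∀ n, ∀ x ∈ T n, F x ∈ T' n}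
    {hFD : ∀ n, ∀ x ∈ T n, D' n (F x) = F (D n x)}
    (hinj : ∀ n, ∀ x ∈ T n, F x = 0 → x = 0) (hsurj : ∀ n, ∀ y ∈ T' n, ∃ x ∈ T n, F x = y) :
    IsIso (subComplexMap F hF hFD : subComplex T D hD hDD ⟶ subComplex T' D' hD' hDD') := by
  have : ∀ n, IsIso ((subComplexMap F hF hFD :
      subComplex T D hD hDD ⟶ subComplex T' D' hD' hDD').f n) := by
    intro n
    refine (ConcreteCategory.isIso_iff_bijective _).mpr ⟨?_, ?_⟩
    · rw [injective_iff_map_eq_zero]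
      intro x hx
      exact Subtype.ext (hinj n x.1 x.2 (congrArg Subtype.val hx))
    · rintro ⟨y, hy⟩
      obtain ⟨x, hx, rfl⟩ := hsurj n y hy
      exact ⟨⟨x, hx⟩, rfl⟩
  exact HomologicalComplex.Hom.isIso_of_components _

theorem subComplexMap_comp {P'' : Type u} [AddCommGroup P''] [Module k P'']
    {T'' : ℤ → Submodule k P''}
    {D'' : ℤ → P'' →ₗ[k] P''} {hD'' : ∀ n, ∀ x ∈ T'' n, D'' n x ∈ T'' (n + 1)}
    {hDD'' : ∀ n, ∀ x ∈ T'' n, D'' (n + 1) (D'' n x) = 0}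
    {F : P →ₗ[k] P'} {hF : ∀ n, ∀ x ∈ T n, F x ∈ T' n}
    {hFD : ∀ n, ∀ x ∈ T n, D' n (F x) = F (D n x)}
    {G : P' →ₗ[k] P''} {hG : ∀ n, ∀ x ∈ T' n, G x ∈ T'' n}
    {hGD : ∀ n, ∀ x ∈ T' n, D'' n (G x) = G (D' n x)}
    {H : P →ₗ[k] P''} {hH : ∀ n, ∀ x ∈ T n, H x ∈ T'' n}
    {hHD : ∀ n, ∀ x ∈ T n, D'' n (H x) = H (D n x)} (h : ∀ n, ∀ x ∈ T n, G (F x) = H x) :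
    (subComplexMap F hF hFD : subComplex T D hD hDD ⟶ subComplex T' D' hD' hDD') ≫
      (subComplexMap G hG hGD : _ ⟶ subComplex T'' D'' hD'' hDD'') = subComplexMap H hH hHD := by
  ext n x
  exact Subtype.ext (h n x.1 x.2)

theorem subComplexMap_id {F : P →ₗ[k] P} {hF : ∀ n, ∀ x ∈ T n, F x ∈ T n}
    {hFD : ∀ n, ∀ x ∈ T n, D n (F x) = F (D n x)} (h : ∀ n, ∀ x ∈ T n, F x = x) :
    (subComplexMap F hF hFD : subComplex T D hD hDD ⟶ subComplex T D hD hDD) = 𝟙 _ := by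
  ext n x
  exact Subtype.ext (h n x.1 x.2)

end SubHomology

/-! ### Cofree DG comodules -/

section CofreeComodules
variable {k : Type u} [Field k]

theorem IsDGMap.symm {X Y : DGVect k} {e : X.carrier ≃ₗ[k] Y.carrier}
    (he : IsDGMap (X := X) (Y := Y) e.toLinearMap)
    (h : ∀ n, ∀ y ∈ Y.gr n, e.symm y ∈ X.gr n) :
    IsDGMap (X := Y) (Y := X) e.symm.toLinearMap :=
  ⟨fun hy => h _ _ hy, fun y => by
    apply e.injective
    have := he.map_d (e.symm y)
    simp only [LinearEquiv.coe_coe, LinearEquiv.apply_symm_apply] at this ⊢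
    exact this.symm⟩

theorem isDGMap_assoc_symm (X Y Z : DGVect k) :
    IsDGMap (X := X.tensor (Y.tensor Z)) (Y := (X.tensor Y).tensor Z)
      (TensorProduct.assoc k X.carrier Y.carrier Z.carrier).symm.toLinearMap := by
  refine (isDGMap_assoc X Y Z).symm fun n t ht => ?_
  refine DGVect.tensorGr_le (X := X) (Y := Y.tensor Z)
    (P := (DGVect.tensorGr (X.tensor Y) Z n).comap
      (TensorProduct.assoc k X.carrier Y.carrier Z.carrier).symm.toLinearMap) ?_ ht
  intro i j hij x hx s hs
  refine DGVect.tensorGr_le (X := Y) (Y := Z)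
    (P := (DGVect.tensorGr (X.tensor Y) Z n).comap
      ((TensorProduct.assoc k X.carrier Y.carrier Z.carrier).symm.toLinearMap ∘ₗ
        (TensorProduct.mk k X.carrier _ x))) ?_ hs
  intro p q hpq y hy z hz
  exact DGVect.tmul_mem_tensorGr (X := X.tensor Y) (Y := Z) (i := i + p) (j := q) (by omega)
    (DGVect.tmul_mem_tensorGr rfl hx hy) hz

/-- In a degree above the sum of the two bounds, one factor of each homogeneous tensor exceeds its
own bound and so vanishes. -/
theorem DGVect.BoundedAbove.tensor {X Y : DGVect k} (hX : X.BoundedAbove) (hY : Y.BoundedAbove) :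
    (X.tensor Y).BoundedAbove := by
  obtain ⟨b, hb⟩ := hX
  obtain ⟨c, hc⟩ := hY
  refine ⟨b + c, fun n hn => ?_⟩
  rw [eq_bot_iff]
  refine DGVect.tensorGr_le ?_
  intro i j hij x hx y hy
  rcases lt_or_ge b i with h | h
  · rw [hb i h, Submodule.mem_bot] at hx
    simp [hx]
  · rw [hc j (by omega), Submodule.mem_bot] at hy
    simp [hy]

variable (C : DGCoalgebra k)

theorem DGCoalgebra.boundedAbove : C.BoundedAbove := ⟨0, C.gr_pos⟩

theorem DGCoalgebra.isDGMap_comul : IsDGMap (X := C.toDGVect) (Y := C.toDGVect.tensor C.toDGVect)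
    (Coalgebra.comul (R := k)) := ⟨C.comul_mem, C.comul_d⟩

theorem rightComodules_isPreadditive : (rightComodules C).IsPreadditive where
  isDGMap h := h.toIsDGMap
  id X := ⟨isDGMap_id _, fun m => by simp⟩
  comp {X Y Z g f} hg hf := ⟨hg.toIsDGMap.comp hf.toIsDGMap, fun m => by
    rw [LinearMap.comp_apply, hg.map_coact, hf.map_coact, LinearMap.rTensor_comp]
    rfl⟩
  sub {X Y g f} hg hf := ⟨hg.toIsDGMap.sub hf.toIsDGMap, fun m => by
    rw [LinearMap.sub_apply, map_sub, hg.map_coact, hf.map_coact, LinearMap.rTensor_sub]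
    rfl⟩

theorem leftComodules_isPreadditive : (leftComodules C).IsPreadditive where
  isDGMap h := h.toIsDGMap
  id X := ⟨isDGMap_id _, fun m => by simp⟩
  comp {X Y Z g f} hg hf := ⟨hg.toIsDGMap.comp hf.toIsDGMap, fun m => by
    rw [LinearMap.comp_apply, hg.map_coact, hf.map_coact, LinearMap.lTensor_comp]
    rfl⟩
  sub {X Y g f} hg hf := ⟨hg.toIsDGMap.sub hf.toIsDGMap, fun m => by
    rw [LinearMap.sub_apply, map_sub, hg.map_coact, hf.map_coact, LinearMap.lTensor_sub]
    rfl⟩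

/-- The cofree right comodule `V ⊗ C`. -/
abbrev cofreeRight (V : DGVect k) : DGRightComodule C where
  toDGVect := V.tensor C.toDGVect
  coact := (TensorProduct.assoc k V.carrier C.carrier C.carrier).symm.toLinearMap ∘ₗ
    Coalgebra.comul.lTensor V.carrier
  coassoc m := by
    induction m using TensorProduct.induction_on with
    | zero => simp
    | add x y hx hy => simp only [map_add, hx, hy]
    | tmul v c =>
      -- Both iterated coactions are computed for an arbitrary tensor `t` in place of the
      -- comultiplication of `c`. This makes induction on `t` possible, and coassociativity of `C`
      -- then enters once, at the end.
      have h1 : ∀ t : C.carrier ⊗[k] C.carrier,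
          TensorProduct.assoc k (V.carrier ⊗[k] C.carrier) C.carrier C.carrier
            (((TensorProduct.assoc k V.carrier C.carrier C.carrier).symm.toLinearMap ∘ₗ
              Coalgebra.comul.lTensor V.carrier).rTensor C.carrier
              ((TensorProduct.assoc k V.carrier C.carrier C.carrier).symm (v ⊗ₜ t))) =
          (TensorProduct.assoc k V.carrier C.carrier (C.carrier ⊗[k] C.carrier)).symm
            (v ⊗ₜ (TensorProduct.assoc k C.carrier C.carrier C.carrier
              (Coalgebra.comul.rTensor C.carrier t))) := by
        intro t
        induction t using TensorProduct.induction_on with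
        | zero => simp
        | add x y hx hy => simp only [map_add, TensorProduct.tmul_add, hx, hy]
        | tmul c₁ c₂ =>
          simp only [TensorProduct.assoc_symm_tmul, LinearMap.rTensor_tmul, LinearMap.comp_apply,
            LinearMap.lTensor_tmul, LinearEquiv.coe_coe]
          induction Coalgebra.comul (R := k) c₁ using TensorProduct.induction_on with
          | zero => simp
          | add x y hx hy => simp only [map_add, TensorProduct.tmul_add, TensorProduct.add_tmul,
              hx, hy]
          | tmul a b => simp
      have h2 : ∀ t : C.carrier ⊗[k] C.carrier,
          Coalgebra.comul.lTensor (V.carrier ⊗[k] C.carrier)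
            ((TensorProduct.assoc k V.carrier C.carrier C.carrier).symm (v ⊗ₜ t)) =
          (TensorProduct.assoc k V.carrier C.carrier (C.carrier ⊗[k] C.carrier)).symm
            (v ⊗ₜ (Coalgebra.comul.lTensor C.carrier t)) := by
        intro t
        induction t using TensorProduct.induction_on with
        | zero => simp
        | add x y hx hy => simp only [map_add, TensorProduct.tmul_add, hx, hy]
        | tmul c₁ c₂ => simp
      exact (h1 _).trans ((congrArg _ (by rw [Coalgebra.coassoc_apply])).trans (h2 _).symm)
  counit_coact m := by
    induction m using TensorProduct.induction_on with
    | zero => simp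
    | add x y hx hy => simp only [map_add, TensorProduct.add_tmul, hx, hy]
    | tmul v c =>
      have h : ∀ t : C.carrier ⊗[k] C.carrier,
          Coalgebra.counit.lTensor (V.carrier ⊗[k] C.carrier)
            ((TensorProduct.assoc k V.carrier C.carrier C.carrier).symm (v ⊗ₜ t)) =
          (TensorProduct.assoc k V.carrier C.carrier k).symm
            (v ⊗ₜ (Coalgebra.counit.lTensor C.carrier t)) := by
        intro t
        induction t using TensorProduct.induction_on with
        | zero => simp
        | add x y hx hy => simp only [map_add, TensorProduct.tmul_add, hx, hy]
        | tmul c₁ c₂ => simp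
      refine (h _).trans ?_
      rw [Coalgebra.lTensor_counit_comul]
      rfl
  coact_mem := ((isDGMap_assoc_symm _ _ _).comp
    (isDGMap_map (isDGMap_id V) C.isDGMap_comul)).map_mem
  coact_d := ((isDGMap_assoc_symm _ _ _).comp
    (isDGMap_map (isDGMap_id V) C.isDGMap_comul)).map_d

theorem cofreeRight_coact_tmul (V : DGVect k) (v : V) (c : C.carrier) :
    (cofreeRight C V).coact (v ⊗ₜ c) =
      (TensorProduct.assoc k V.carrier C.carrier C.carrier).symm
        (v ⊗ₜ Coalgebra.comul (R := k) c) := rfl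

/-- The projection `V ⊗ C → V`. -/
def counitRight (V : DGVect k) : V ⊗[k] C.carrier →ₗ[k] V :=
  TensorProduct.rid k V.carrier ∘ₗ Coalgebra.counit.lTensor V.carrier

theorem counitRight_tmul (V : DGVect k) (v : V) (c : C.carrier) :
    counitRight C V (v ⊗ₜ c) = Coalgebra.counit (R := k) c • v := by
  simp [counitRight]

theorem isDGMap_counitRight (V : DGVect k) :
    IsDGMap (X := V.tensor C.toDGVect) (Y := V) (counitRight C V) where
  map_mem {n t} ht := by
    refine DGVect.tensorGr_le (X := V) (Y := C.toDGVect)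
      (P := (V.gr n).comap (counitRight C V)) ?_ ht
    intro i j hij v hv c hc
    rw [Submodule.mem_comap, counitRight_tmul]
    -- The counit vanishes outside degree 0, so only terms in which `v` carries the full degree
    -- survive.
    by_cases hj : j = 0
    · obtain rfl : i = n := by omega
      exact Submodule.smul_mem _ _ hv
    · rw [C.counit_gr hc hj, zero_smul]
      exact zero_mem _
  map_d t := by
    have : counitRight C V ∘ₗ DGVect.tensorD V C.toDGVect = V.d ∘ₗ counitRight C V := by
      apply DGVect.tensor_hom_ext
      intro i v hv j c hc
      simp only [LinearMap.comp_apply, DGVect.tensorD_tmul hv, map_add, map_smul,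
        counitRight_tmul, C.counit_d, zero_smul, smul_zero, add_zero]
    exact LinearMap.congr_fun this t

/-- Cofree right comodules. -/
def rightCofree : (rightComodules C).Cofree where
  F := cofreeRight C
  map f := f.rTensor C.carrier
  η X := X.coact
  ε := counitRight C
  map_hom {V W f} hf := by
    refine ⟨isDGMap_map hf (isDGMap_id C.toDGVect), fun m => ?_⟩
    induction m using TensorProduct.induction_on with
    | zero => simp only [map_zero]
    | add x y hx hy => simp only [map_add, hx, hy]
    | tmul v c =>
      rw [LinearMap.rTensor_tmul, cofreeRight_coact_tmul, cofreeRight_coact_tmul]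
      induction Coalgebra.comul (R := k) c using TensorProduct.induction_on with
      | zero => simp
      | add x y hx hy => simp only [map_add, TensorProduct.tmul_add, hx, hy]
      | tmul a b => simp
  map_comp g f := LinearMap.rTensor_comp _ _ _
  map_zero := LinearMap.rTensor_zero _
  η_hom X := by
    refine ⟨⟨X.coact_mem, X.coact_d⟩, fun m => ?_⟩
    -- That the coaction is a homomorphism to the cofree comodule on the underlying space is
    -- coassociativity.
    change (TensorProduct.assoc k X.carrier C.carrier C.carrier).symm _ = _
    rw [LinearEquiv.symm_apply_eq]
    exact (X.coassoc m).symm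
  η_nat hf := LinearMap.ext hf.map_coact
  ε_dg := isDGMap_counitRight C
  ε_nat f := by
    apply TensorProduct.ext'
    intro v c
    simp only [LinearMap.comp_apply, LinearMap.rTensor_tmul, counitRight_tmul, map_smul]
  ε_η X := by
    ext m
    change TensorProduct.rid k X.carrier (Coalgebra.counit.lTensor X.carrier (X.coact m)) = m
    rw [X.counit_coact]
    simp
  map_ε_η V := by
    apply TensorProduct.ext'
    intro v c
    have h : ∀ t : C.carrier ⊗[k] C.carrier,
        (counitRight C V).rTensor C.carrier
          ((TensorProduct.assoc k V.carrier C.carrier C.carrier).symm (v ⊗ₜ t)) =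
          v ⊗ₜ (TensorProduct.lid k C.carrier (Coalgebra.counit.rTensor C.carrier t)) := by
      intro t
      induction t using TensorProduct.induction_on with
      | zero => simp
      | add x y hx hy => simp only [map_add, TensorProduct.tmul_add, hx, hy]
      | tmul a b => simp [counitRight_tmul, TensorProduct.smul_tmul]
    refine (h _).trans ?_
    rw [Coalgebra.rTensor_counit_comul]
    simp

/-- The cofree left comodule `C ⊗ V`. -/
abbrev cofreeLeft (V : DGVect k) : DGLeftComodule C where
  toDGVect := C.toDGVect.tensor V
  coact := (TensorProduct.assoc k C.carrier C.carrier V.carrier).toLinearMap ∘ₗ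
    Coalgebra.comul.rTensor V.carrier
  coassoc m := by
    induction m using TensorProduct.induction_on with
    | zero => simp
    | add x y hx hy => simp only [map_add, hx, hy]
    | tmul c v =>
      -- As for right comodules, an arbitrary `t` replaces the comultiplication of `c`.
      have h1 : ∀ t : C.carrier ⊗[k] C.carrier,
          ((TensorProduct.assoc k C.carrier C.carrier V.carrier).toLinearMap ∘ₗ
              Coalgebra.comul.rTensor V.carrier).lTensor C.carrier
              (TensorProduct.assoc k C.carrier C.carrier V.carrier (t ⊗ₜ v)) =
          (TensorProduct.assoc k C.carrier C.carrier V.carrier).toLinearMap.lTensor C.carrier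
            (TensorProduct.assoc k C.carrier (C.carrier ⊗[k] C.carrier) V.carrier
              (Coalgebra.comul.lTensor C.carrier t ⊗ₜ v)) := by
        intro t
        induction t using TensorProduct.induction_on with
        | zero => simp
        | add x y hx hy => simp only [map_add, TensorProduct.add_tmul, hx, hy]
        | tmul c₁ c₂ => simp
      have h2 : ∀ t : C.carrier ⊗[k] C.carrier,
          TensorProduct.assoc k C.carrier C.carrier (C.carrier ⊗[k] V.carrier)
            (Coalgebra.comul.rTensor (C.carrier ⊗[k] V.carrier)
              (TensorProduct.assoc k C.carrier C.carrier V.carrier (t ⊗ₜ v))) =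
          (TensorProduct.assoc k C.carrier C.carrier V.carrier).toLinearMap.lTensor C.carrier
            (TensorProduct.assoc k C.carrier (C.carrier ⊗[k] C.carrier) V.carrier
              (TensorProduct.assoc k C.carrier C.carrier C.carrier
                (Coalgebra.comul.rTensor C.carrier t) ⊗ₜ v)) := by
        intro t
        induction t using TensorProduct.induction_on with
        | zero => simp
        | add x y hx hy => simp only [map_add, TensorProduct.add_tmul, hx, hy]
        | tmul c₁ c₂ =>
          simp only [TensorProduct.assoc_tmul, LinearMap.rTensor_tmul]
          induction Coalgebra.comul (R := k) c₁ using TensorProduct.induction_on with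
          | zero => simp
          | add x y hx hy => simp only [map_add, TensorProduct.add_tmul, hx, hy]
          | tmul a b => simp
      refine (h2 _).trans (Eq.trans ?_ (h1 _).symm)
      rw [Coalgebra.coassoc_apply]
  counit_coact m := by
    induction m using TensorProduct.induction_on with
    | zero => simp
    | add x y hx hy => simp only [map_add, TensorProduct.tmul_add, hx, hy]
    | tmul c v =>
      have h : ∀ t : C.carrier ⊗[k] C.carrier,
          Coalgebra.counit.rTensor (C.carrier ⊗[k] V.carrier)
            (TensorProduct.assoc k C.carrier C.carrier V.carrier (t ⊗ₜ v)) =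
          TensorProduct.assoc k k C.carrier V.carrier
            ((Coalgebra.counit.rTensor C.carrier t) ⊗ₜ v) := by
        intro t
        induction t using TensorProduct.induction_on with
        | zero => simp
        | add x y hx hy => simp only [map_add, TensorProduct.add_tmul, hx, hy]
        | tmul c₁ c₂ => simp
      refine (h _).trans ?_
      rw [Coalgebra.rTensor_counit_comul]
      rfl
  coact_mem := ((isDGMap_assoc _ _ _).comp
    (isDGMap_map C.isDGMap_comul (isDGMap_id V))).map_mem
  coact_d := ((isDGMap_assoc _ _ _).comp
    (isDGMap_map C.isDGMap_comul (isDGMap_id V))).map_d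

theorem cofreeLeft_coact_tmul (V : DGVect k) (v : V) (c : C.carrier) :
    (cofreeLeft C V).coact (c ⊗ₜ v) =
      TensorProduct.assoc k C.carrier C.carrier V.carrier
        (Coalgebra.comul (R := k) c ⊗ₜ v) := rfl

/-- The projection `C ⊗ V → V`. -/
def counitLeft (V : DGVect k) : C.carrier ⊗[k] V.carrier →ₗ[k] V :=
  TensorProduct.lid k V.carrier ∘ₗ Coalgebra.counit.rTensor V.carrier

theorem counitLeft_tmul (V : DGVect k) (v : V) (c : C.carrier) :
    counitLeft C V (c ⊗ₜ v) = Coalgebra.counit (R := k) c • v := by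
  simp [counitLeft]

theorem isDGMap_counitLeft (V : DGVect k) :
    IsDGMap (X := C.toDGVect.tensor V) (Y := V) (counitLeft C V) where
  map_mem {n t} ht := by
    refine DGVect.tensorGr_le (X := C.toDGVect) (Y := V)
      (P := (V.gr n).comap (counitLeft C V)) ?_ ht
    intro i j hij c hc v hv
    rw [Submodule.mem_comap, counitLeft_tmul]
    by_cases hi : i = 0
    · obtain rfl : j = n := by omega
      exact Submodule.smul_mem _ _ hv
    · rw [C.counit_gr hc hi, zero_smul]
      exact zero_mem _
  map_d t := by
    have : counitLeft C V ∘ₗ DGVect.tensorD C.toDGVect V = V.d ∘ₗ counitLeft C V := by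
      apply DGVect.tensor_hom_ext
      intro i c hc j v hv
      simp only [LinearMap.comp_apply, DGVect.tensorD_tmul hc, map_add, map_smul,
        counitLeft_tmul, C.counit_d, zero_smul, zero_add, smul_smul]
      -- The Koszul sign (-1)^|c| is harmless: where the counit of `c` is nonzero, `c` has degree 0.
      by_cases hi : i = 0
      · rw [hi, sgn_zero, one_mul]
      · rw [C.counit_gr hc hi, mul_zero]
    exact LinearMap.congr_fun this t

/-- Cofree left comodules. -/
def leftCofree : (leftComodules C).Cofree where
  F := cofreeLeft C
  map f := f.lTensor C.carrier
  η X := X.coact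
  ε := counitLeft C
  map_hom {V W f} hf := by
    refine ⟨isDGMap_map (isDGMap_id C.toDGVect) hf, fun m => ?_⟩
    induction m using TensorProduct.induction_on with
    | zero => simp only [map_zero]
    | add x y hx hy => simp only [map_add, hx, hy]
    | tmul c v =>
      rw [LinearMap.lTensor_tmul, cofreeLeft_coact_tmul, cofreeLeft_coact_tmul]
      induction Coalgebra.comul (R := k) c using TensorProduct.induction_on with
      | zero => simp
      | add x y hx hy => simp only [map_add, TensorProduct.add_tmul, hx, hy]
      | tmul a b => simp
  map_comp g f := LinearMap.lTensor_comp _ _ _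
  map_zero := LinearMap.lTensor_zero _
  η_hom X := ⟨⟨X.coact_mem, X.coact_d⟩, fun m => X.coassoc m⟩
  η_nat hf := LinearMap.ext hf.map_coact
  ε_dg := isDGMap_counitLeft C
  ε_nat f := by
    apply TensorProduct.ext'
    intro c v
    simp only [LinearMap.comp_apply, LinearMap.lTensor_tmul, counitLeft_tmul, map_smul]
  ε_η X := by
    ext m
    change TensorProduct.lid k X.carrier (Coalgebra.counit.rTensor X.carrier (X.coact m)) = m
    rw [X.counit_coact]
    simp
  map_ε_η V := by
    apply TensorProduct.ext'
    intro c v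
    have h : ∀ t : C.carrier ⊗[k] C.carrier,
        (counitLeft C V).lTensor C.carrier
          (TensorProduct.assoc k C.carrier C.carrier V.carrier (t ⊗ₜ v)) =
          (TensorProduct.rid k C.carrier (Coalgebra.counit.lTensor C.carrier t)) ⊗ₜ v := by
      intro t
      induction t using TensorProduct.induction_on with
      | zero => simp
      | add x y hx hy => simp only [map_add, TensorProduct.add_tmul, hx, hy]
      | tmul a b => simp [counitLeft_tmul, TensorProduct.smul_tmul]
    refine (h _).trans ?_
    rw [Coalgebra.lTensor_counit_comul]
    simp

end CofreeComodules

/-! ### DG comodules over the dual as DG modules -/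

section Joint
variable {k : Type u} [Field k]

/-- A basis of V identifies V ⊗ R with the finitely supported families in R, on which 1 ⊗ β acts
coordinatewise. It allows equations in X ⊗ C ⊗ Y to be tested by evaluating one factor. -/
theorem lTensor_jointly_injective {V R : Type u} [AddCommGroup V] [Module k V] [AddCommGroup R]
    [Module k R] {W : Type u} [AddCommGroup W] [Module k W] {ι : Type*} (β : ι → R →ₗ[k] W)
    (h : ∀ r, (∀ i, β i r = 0) → r = 0) {t : V ⊗[k] R} (ht : ∀ i, (β i).lTensor V t = 0) :
    t = 0 := by
  let b := Module.Free.chooseBasis k V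
  have key : ∀ (t : V ⊗[k] R) (i) (j),
      β i (TensorProduct.equivFinsuppOfBasisLeft b t j) =
        TensorProduct.equivFinsuppOfBasisLeft b ((β i).lTensor V t) j := by
    intro t i j
    induction t using TensorProduct.induction_on with
    | zero => simp
    | tmul v f => simp
    | add x y hx hy => simp only [map_add, Finsupp.add_apply, hx, hy]
  rw [← LinearEquiv.map_eq_zero_iff (TensorProduct.equivFinsuppOfBasisLeft b)]
  ext j : 1
  refine h _ fun i => ?_
  rw [key, ht]
  simp

theorem rTensor_jointly_injective {V R : Type u} [AddCommGroup V] [Module k V] [AddCommGroup R]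
    [Module k R] {W : Type u} [AddCommGroup W] [Module k W] {ι : Type*} (β : ι → R →ₗ[k] W)
    (h : ∀ r, (∀ i, β i r = 0) → r = 0) {t : R ⊗[k] V} (ht : ∀ i, (β i).rTensor V t = 0) :
    t = 0 := by
  apply (TensorProduct.comm k R V).injective
  rw [map_zero]
  refine lTensor_jointly_injective β h fun i => ?_
  rw [← LinearMap.comm_comp_rTensor_comp_comm_eq]
  simp [ht i]

theorem DGVect.twist_twist (X : DGVect k) (p : ℤ) (x : X) : X.twist p (X.twist p x) = x := by
  refine X.induction (P := fun x => X.twist p (X.twist p x) = x) ?_ ?_ x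
  · intro n x hx
    rw [X.twist_apply p hx, map_smul, X.twist_apply p hx, smul_smul, sgn_mul_self, one_smul]
  · intro x y hx hy; simp only [map_add, hx, hy]

/-- A form of degree q is nonzero only on A^{-q}, so evaluation at an element of degree i removes a
factor of degree -i. -/
theorem DGAlgebra.slice_mem (A : DGAlgebra k) {W : DGVect k} {n i : ℤ} {a : A} (ha : a ∈ A.gr i)
    {t : W ⊗[k] A.Dual} (ht : t ∈ DGVect.tensorGr W A.dualV n) :
    A.slice W a t ∈ W.gr (n + i) := by
  refine DGVect.tensorGr_le (X := W) (Y := A.dualV) (P := (W.gr (n + i)).comap (A.slice W a)) ?_ ht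
  intro p q hpq w hw f hf
  rw [Submodule.mem_comap, A.slice_tmul]
  by_cases h : i = -q
  · obtain rfl : p = n + i := by omega
    exact Submodule.smul_mem _ _ hw
  · rw [A.mem_dualDeg.mp hf i h a ha, zero_smul]
    exact zero_mem _

theorem DGAlgebra.lslice_mem (A : DGAlgebra k) {W : DGVect k} {n i : ℤ} {a : A} (ha : a ∈ A.gr i)
    {t : A.Dual ⊗[k] W} (ht : t ∈ DGVect.tensorGr A.dualV W n) :
    A.lslice W a t ∈ W.gr (n + i) :=
  A.slice_mem ha (DGRightModule.comm_mem_tensorGr (X := A.dualV) (Y := W) ht)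

end Joint

/-! ### Right comodules over DA as left A-modules; no boundedness is needed in this direction. -/

namespace DGRightComodule
variable {k : Type u} [Field k] {A : DGAlgebra k} [A.FiniteType] (X : DGRightComodule A.dual)

/-- The map `m ↦ ∑ f(a) m'`, where `m ↦ ∑ m' ⊗ f` is the coaction. -/
def contract : A →ₗ[k] Module.End k X.carrier := ((A.slices X.carrier) ∘ₗ X.coact).flip

theorem contract_apply (a : A) (m : X.carrier) :
    X.contract a m = A.slice X.carrier a (X.coact m) := rfl

theorem contract_mem {i n : ℤ} {a : A} (ha : a ∈ A.gr i) {m : X.carrier} (hm : m ∈ X.gr n) :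
    X.contract a m ∈ X.gr (n + i) := A.slice_mem ha (X.coact_mem hm)

theorem contract_one (m : X.carrier) : X.contract 1 m = m := by
  have := congrArg (TensorProduct.rid k X.carrier) (X.counit_coact m)
  rw [TensorProduct.rid_tmul, one_smul] at this
  exact this

/-- Coassociativity, evaluated at a ⊗ b. The sign is the one in the duality between comultiplication
and product, and it keeps contraction itself from being an action. -/
theorem contract_contract {i j : ℤ} {a b : A} (ha : a ∈ A.gr i) (hb : b ∈ A.gr j)
    (m : X.carrier) : X.contract a (X.contract b m) = sgn k (i * j) • X.contract (a * b) m := by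
  simp only [contract_apply]
  rw [← A.slice_slice_comul ha hb, ← A.slice_rTensor X.coact, A.slice_slice_assoc]
  exact congrArg (fun t => A.slice X.carrier a ((A.slice A.Dual b).lTensor X.carrier t))
    (X.coassoc m)

theorem contract_d {i : ℤ} {a : A} (ha : a ∈ A.gr i) (m : X.carrier) :
    X.contract a (X.d m) = X.d (X.contract a m) + sgn k i • X.twist 1 (X.contract (A.d a) m) := by
  simp only [contract_apply]
  rw [← A.slice_tensorD X.toDGVect ha]
  exact congrArg (A.slice X.carrier a) (X.coact_d m)

/-- Contraction with `a` shifts degrees by i, which changes the twist by (-1)^(i·i) = (-1)^i. -/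
theorem contract_twist {i : ℤ} {a : A} (ha : a ∈ A.gr i) (m : X.carrier) :
    X.contract a (X.twist i m) = sgn k i • X.twist i (X.contract a m) := by
  refine X.induction
    (P := fun m => X.contract a (X.twist i m) = sgn k i • X.twist i (X.contract a m)) ?_ ?_ m
  · intro n m hm
    rw [X.twist_apply i hm, X.twist_apply i (X.contract_mem ha hm), map_smul, smul_smul, ← sgn_add]
    congr 1
    exact sgn_congr (by ring_nf; simp [Int.even_add, parity_simps])
  · intro x y hx hy; simp only [map_add, smul_add, hx, hy]

/-- The action `a m = ∑ (-1) ^ (|a| |m|) f(a) m'`, where `m ↦ ∑ m' ⊗ f` is the coaction. -/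
def action : A →ₗ[k] Module.End k X.carrier :=
  A.V.desc fun i => LinearMap.lcomp k X.carrier (X.twist i) ∘ₗ X.contract ∘ₗ (A.gr i).subtype

theorem action_apply {i : ℤ} {a : A} (ha : a ∈ A.gr i) (m : X.carrier) :
    X.action a m = X.contract a (X.twist i m) := by
  rw [action, A.V.desc_apply _ ha]; rfl

theorem action_apply_of_mem {i p : ℤ} {a : A} (ha : a ∈ A.gr i) {m : X.carrier}
    (hm : m ∈ X.gr p) : X.action a m = sgn k (i * p) • X.contract a m := by
  rw [X.action_apply ha, X.twist_apply i hm, map_smul]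

theorem action_mem {i j : ℤ} {a : A} (ha : a ∈ A.gr i) {m : X.carrier} (hm : m ∈ X.gr j) :
    X.action a m ∈ X.gr (i + j) := by
  rw [X.action_apply_of_mem ha hm, add_comm]
  exact Submodule.smul_mem _ _ (X.contract_mem ha hm)

/-- A right DG comodule over the dual of `A` as a left DG module over `A`. -/
abbrev toModule : DGLeftModule A where
  toDGVect := X.toDGVect
  lact := AlgHom.ofLinearMap X.action
    (by
      refine X.hom_ext fun p m hm => ?_
      rw [X.action_apply_of_mem SetLike.GradedOne.one_mem hm, zero_mul, sgn_zero, one_smul,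
        contract_one]
      rfl)
    (fun a b => by
      refine A.V.induction (P := fun a => X.action (a * b) = X.action a * X.action b) ?_ ?_ a
      · intro i a ha
        refine A.V.induction (P := fun b => X.action (a * b) = X.action a * X.action b) ?_ ?_ b
        · intro j b hb
          refine X.hom_ext fun p m hm => ?_
          rw [Module.End.mul_apply, X.action_apply_of_mem (SetLike.mul_mem_graded ha hb) hm,
            X.action_apply_of_mem ha (X.action_mem hb hm), X.action_apply_of_mem hb hm, map_smul,
            X.contract_contract ha hb, smul_smul, smul_smul, ← sgn_add, ← sgn_add]
          -- The sign of `contract_contract` cancels against the one that arises because `b m` has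
          -- degree j + p and not p.
          congr 1
          exact sgn_congr (by ring_nf; simp [Int.even_add])
        · intro x y hx hy; simp only [mul_add, map_add, hx, hy]
      · intro x y hx hy; simp only [add_mul, map_add, hx, hy])
  lact_mem ha hm := X.action_mem ha hm
  leibniz {i a} ha m := by
    change X.d (X.action a m) = X.action (A.d a) m + sgn k i • X.action a (X.d m)
    refine X.induction (P := fun m => X.d (X.action a m) =
      X.action (A.d a) m + sgn k i • X.action a (X.d m)) ?_ ?_ m
    · intro p m hm
      rw [X.action_apply_of_mem ha hm, X.action_apply_of_mem (A.d_mem ha) hm,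
        X.action_apply_of_mem ha (X.d_mem hm), X.contract_d ha,
        X.twist_apply 1 (X.contract_mem (A.d_mem ha) hm), map_smul]
      have e1 : sgn k i * sgn k (i * (p + 1)) = sgn k (i * p) := by
        rw [← sgn_add]; exact sgn_congr (by ring_nf; simp [Int.even_add])
      -- Hence the term with `A.d a` that comes from `contract_d` cancels the action of `A.d a`.
      have e2 : sgn k (i * p) * (sgn k i * sgn k (1 * (p + (i + 1)))) = - sgn k ((i + 1) * p) := by
        rw [← sgn_add, ← sgn_add, sgn_congr (b := (i + 1) * p + 1)
          (by ring_nf; simp [Int.even_add]), sgn_add _ 1, sgn_one]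
        ring
      rw [smul_smul, e1, smul_add, smul_smul, smul_smul, mul_assoc, e2]
      module
    · intro x y hx hy; simp only [map_add, smul_add, hx, hy]; abel

variable {X} {X' : DGRightComodule A.dual}

theorem IsHom.map_contract {f : X.toDGVect →ₗ[k] X'.toDGVect} (hf : IsHom f) (a : A)
    (m : X.carrier) : f (X.contract a m) = X'.contract a (f m) := by
  rw [contract_apply, contract_apply, hf.map_coact]
  exact (A.slice_rTensor f a _).symm

/-- A comodule homomorphism commutes with evaluation of the DA factor, and a map of degree 0
commutes with the twist; the action is built from these two. -/
theorem IsHom.map_action {f : X.toDGVect →ₗ[k] X'.toDGVect} (hf : IsHom f) (a : A)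
    (m : X.carrier) : f (X.action a m) = X'.action a (f m) := by
  refine A.V.induction (P := fun a => f (X.action a m) = X'.action a (f m)) ?_ ?_ a
  · intro i a ha
    rw [action_apply _ ha, action_apply _ ha, hf.map_contract, hf.map_twist]
  · intro x y hx hy; simp only [map_add, LinearMap.add_apply, hx, hy]

end DGRightComodule

/-- The sign (-1)^(|a||m|) is inserted once in the coaction and once in the action, so it squares
away. This makes the augmentations of comodule resolutions linear for the original actions on M and
N. -/
theorem DGLeftModule.toComodule_action {k : Type u} [Field k] {A : DGAlgebra k} [A.FiniteType]
    (M : DGLeftModule A) (hM : M.BoundedAbove) (a : A) (m : M.carrier) :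
    (M.toComodule hM).action a m = M.lact a m := by
  refine A.V.induction (P := fun a => (M.toComodule hM).action a m = M.lact a m) ?_ ?_ a
  · intro i a ha
    refine M.induction (P := fun m => (M.toComodule hM).action a m = M.lact a m) ?_ ?_ m
    · intro p m hm
      rw [DGRightComodule.action_apply_of_mem _ ha hm, DGRightComodule.contract_apply]
      change _ • A.slice M.carrier a (M.coact hM m) = _
      rw [M.slice_coact, M.orbit_apply hm ha, smul_smul, sgn_mul_self, one_smul]
    · intro x y hx hy; simp only [map_add, hx, hy]
  · intro x y hx hy; simp only [map_add, LinearMap.add_apply, hx, hy]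

/-! ### Left comodules over DA as right A-modules. -/

namespace DGLeftComodule
variable {k : Type u} [Field k] {A : DGAlgebra k} [A.FiniteType] (X : DGLeftComodule A.dual)

/-- The map `m ↦ ∑ f(a) m'`, where `m ↦ ∑ f ⊗ m'` is the coaction. -/
def contract : A →ₗ[k] Module.End k X.carrier :=
  ((A.slices X.carrier) ∘ₗ (TensorProduct.comm k A.Dual X.carrier).toLinearMap ∘ₗ X.coact).flip

theorem contract_apply (a : A) (m : X.carrier) :
    X.contract a m = A.lslice X.carrier a (X.coact m) := rfl

theorem contract_mem {i n : ℤ} {a : A} (ha : a ∈ A.gr i) {m : X.carrier} (hm : m ∈ X.gr n) :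
    X.contract a m ∈ X.gr (n + i) := A.lslice_mem ha (X.coact_mem hm)

theorem contract_one (m : X.carrier) : X.contract 1 m = m := by
  have h : ∀ t : A.Dual ⊗[k] X.carrier, TensorProduct.lid k X.carrier
      (A.dualCounit.rTensor X.carrier t) = A.lslice X.carrier 1 t := by
    intro t
    induction t using TensorProduct.induction_on with
    | zero => simp
    | tmul f v => simp [A.lslice_tmul, A.dualCounit_apply]
    | add x y hx hy => simp only [map_add, hx, hy]
  have := congrArg (TensorProduct.lid k X.carrier) (X.counit_coact m)
  rw [TensorProduct.lid_tmul, one_smul] at this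
  exact (h _).symm.trans this

/-- The order is reversed in comparison with right comodules: DA now stands on the left, so
contracting with `a` first evaluates the first factor of the comultiplication at `a`. This is why a
right action results. -/
theorem contract_contract {i j : ℤ} {a b : A} (ha : a ∈ A.gr i) (hb : b ∈ A.gr j)
    (m : X.carrier) : X.contract b (X.contract a m) = sgn k (i * j) • X.contract (a * b) m := by
  simp only [contract_apply]
  rw [← A.lslice_lslice_comul ha hb, ← A.lslice_lTensor X.coact]
  exact congrArg (fun t => A.lslice X.carrier b (A.lslice _ a t)) (X.coassoc m).symm

theorem contract_d {i : ℤ} {a : A} (ha : a ∈ A.gr i) (m : X.carrier) :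
    X.contract a (X.d m) = sgn k i • (X.contract (A.d a) m + X.d (X.contract a m)) := by
  simp only [contract_apply]
  rw [← A.lslice_tensorD X.toDGVect ha]
  exact congrArg (A.lslice X.carrier a) (X.coact_d m)

theorem contract_twist {i : ℤ} {a : A} (ha : a ∈ A.gr i) (m : X.carrier) :
    X.contract a (X.twist i m) = sgn k i • X.twist i (X.contract a m) := by
  refine X.induction
    (P := fun m => X.contract a (X.twist i m) = sgn k i • X.twist i (X.contract a m)) ?_ ?_ m
  · intro n m hm
    rw [X.twist_apply i hm, X.twist_apply i (X.contract_mem ha hm), map_smul, smul_smul, ← sgn_add]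
    congr 1
    exact sgn_congr (by ring_nf; simp [Int.even_add, parity_simps])
  · intro x y hx hy; simp only [map_add, smul_add, hx, hy]

/-- The action `m a = ∑ (-1) ^ (|a| |m| + |a|) f(a) m'`, where `m ↦ ∑ f ⊗ m'` is the coaction. -/
def action : A →ₗ[k] Module.End k X.carrier :=
  A.V.desc fun i => sgn k i • LinearMap.lcomp k X.carrier (X.twist i) ∘ₗ X.contract ∘ₗ
    (A.gr i).subtype

theorem action_apply {i : ℤ} {a : A} (ha : a ∈ A.gr i) (m : X.carrier) :
    X.action a m = sgn k i • X.contract a (X.twist i m) := by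
  rw [action, A.V.desc_apply _ ha]; rfl

theorem action_apply_of_mem {i p : ℤ} {a : A} (ha : a ∈ A.gr i) {m : X.carrier}
    (hm : m ∈ X.gr p) : X.action a m = sgn k (i * p + i) • X.contract a m := by
  rw [X.action_apply ha, X.twist_apply i hm, map_smul, smul_smul, ← sgn_add, add_comm]

theorem action_mem {i j : ℤ} {a : A} (ha : a ∈ A.gr i) {m : X.carrier} (hm : m ∈ X.gr j) :
    X.action a m ∈ X.gr (j + i) := by
  rw [X.action_apply_of_mem ha hm]
  exact Submodule.smul_mem _ _ (X.contract_mem ha hm)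

theorem action_one : X.action 1 = 1 := by
  refine X.hom_ext fun p m hm => ?_
  rw [X.action_apply_of_mem SetLike.GradedOne.one_mem hm, zero_mul, zero_add, sgn_zero, one_smul,
    contract_one]
  rfl

theorem action_mul (a b : A) : X.action (a * b) = X.action b * X.action a := by
  refine A.V.induction (P := fun a => X.action (a * b) = X.action b * X.action a) ?_ ?_ a
  · intro i a ha
    refine A.V.induction (P := fun b => X.action (a * b) = X.action b * X.action a) ?_ ?_ b
    · intro j b hb
      refine X.hom_ext fun p m hm => ?_
      rw [Module.End.mul_apply, X.action_apply_of_mem (SetLike.mul_mem_graded ha hb) hm,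
        X.action_apply_of_mem hb (X.action_mem ha hm), X.action_apply_of_mem ha hm, map_smul,
        X.contract_contract ha hb, smul_smul, smul_smul, ← sgn_add, ← sgn_add]
      congr 1
      exact sgn_congr (by ring_nf; simp [Int.even_add])
    · intro x y hx hy; simp only [mul_add, add_mul, map_add, hx, hy]
  · intro x y hx hy; simp only [mul_add, add_mul, map_add, hx, hy]

/-- A left DG comodule over the dual of `A` as a right DG module over `A`. -/
abbrev toModule : DGRightModule A where
  toDGVect := X.toDGVect
  ract := AlgHom.ofLinearMap (X.action ∘ₗ (MulOpposite.opLinearEquiv k).symm.toLinearMap)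
    X.action_one (fun a b => X.action_mul b.unop a.unop)
  ract_mem ha hm := X.action_mem ha hm
  leibniz {p} a {m} hm := by
    change X.d (X.action a m) = X.action a (X.d m) + sgn k p • X.action (A.d a) m
    refine A.V.induction (P := fun a => X.d (X.action a m) =
      X.action a (X.d m) + sgn k p • X.action (A.d a) m) ?_ ?_ a
    · intro i a ha
      have ha' : a ∈ A.gr i := ha
      rw [X.action_apply_of_mem ha hm, X.action_apply_of_mem (A.d_mem ha') hm,
        X.action_apply_of_mem ha (X.d_mem hm), X.contract_d ha, map_smul]
      have e1 : sgn k (i * (p + 1) + i) * sgn k i = sgn k (i * p + i) := by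
        rw [← sgn_add]
        exact sgn_congr ⟨i * p + i + i, by ring⟩
      have e2 : sgn k p * sgn k ((i + 1) * p + (i + 1)) = - sgn k (i * p + i) := by
        rw [← sgn_add, sgn_congr (b := i * p + i + 1)
          (by ring_nf; simp [Int.even_add]), sgn_add _ 1, sgn_one]
        ring
      rw [smul_smul, smul_smul, e1, e2]
      module
    · intro x y hx hy; simp only [map_add, smul_add, LinearMap.add_apply, hx, hy]; abel

variable {X} {X' : DGLeftComodule A.dual}

theorem IsHom.map_contract {f : X.toDGVect →ₗ[k] X'.toDGVect} (hf : IsHom f) (a : A)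
    (m : X.carrier) : f (X.contract a m) = X'.contract a (f m) := by
  rw [contract_apply, contract_apply, hf.map_coact]
  exact (A.lslice_lTensor f a _).symm

theorem IsHom.map_action {f : X.toDGVect →ₗ[k] X'.toDGVect} (hf : IsHom f) (a : A)
    (m : X.carrier) : f (X.action a m) = X'.action a (f m) := by
  refine A.V.induction (P := fun a => f (X.action a m) = X'.action a (f m)) ?_ ?_ a
  · intro i a ha
    rw [action_apply _ ha, action_apply _ ha, map_smul, hf.map_contract, hf.map_twist]
  · intro x y hx hy; simp only [map_add, LinearMap.add_apply, hx, hy]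

end DGLeftComodule

theorem DGRightModule.toComodule_action {k : Type u} [Field k] {A : DGAlgebra k} [A.FiniteType]
    (N : DGRightModule A) (hN : N.BoundedAbove) (a : A) (m : N.carrier) :
    (N.toComodule hN).action a m = N.ract (.op a) m := by
  refine A.V.induction (P := fun a => (N.toComodule hN).action a m = N.ract (.op a) m) ?_ ?_ a
  · intro i a ha
    refine N.induction (P := fun m => (N.toComodule hN).action a m = N.ract (.op a) m) ?_ ?_ m
    · intro p m hm
      rw [DGLeftComodule.action_apply_of_mem _ ha hm, DGLeftComodule.contract_apply]
      change _ • A.lslice N.carrier a (N.coact hN m) = _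
      rw [N.lslice_coact, N.orbit_apply hm ha, smul_smul, sgn_mul_self, one_smul]
    · intro x y hx hy; simp only [map_add, hx, hy]
  · intro x y hx hy; simp only [map_add, MulOpposite.op_add, LinearMap.add_apply, hx, hy]

/-! ### The cotensor product as a space of central elements -/

section Central
variable {k : Type u} [Field k] {A : DGAlgebra k} [A.FiniteType] {X : DGRightComodule A.dual}
  {Y : DGLeftComodule A.dual}

/-- The defining equation lives in X ⊗ DA ⊗ Y and is tested by evaluating the middle factor at
homogeneous elements of A. The two coactions then become contractions in the left and in the right
factor. -/
theorem mem_cotensor_iff_contract {t : X.carrier ⊗[k] Y.carrier} :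
    t ∈ cotensor X Y ↔ ∀ i, ∀ a ∈ A.gr i,
      (X.contract a).rTensor Y.carrier t = (Y.contract a).lTensor X.carrier t := by
  have h1 : ∀ (a : A) (t : X.carrier ⊗[k] Y.carrier), (A.lslice Y.carrier a).lTensor X.carrier
      (TensorProduct.assoc k X.carrier A.Dual Y.carrier (X.coact.rTensor Y.carrier t)) =
        (X.contract a).rTensor Y.carrier t := by
    intro a t
    induction t using TensorProduct.induction_on with
    | zero => simp
    | add x y hx hy => simp only [map_add, hx, hy]
    | tmul x y =>
      rw [LinearMap.rTensor_tmul, LinearMap.rTensor_tmul, X.contract_apply]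
      induction X.coact x using TensorProduct.induction_on with
      | zero => simp
      | add x y hx hy => simp only [map_add, TensorProduct.add_tmul, hx, hy]
      | tmul x f => simp [A.lslice_tmul, A.slice_tmul, TensorProduct.smul_tmul']
  have h2 : ∀ (a : A) (t : X.carrier ⊗[k] Y.carrier), (A.lslice Y.carrier a).lTensor X.carrier
      (Y.coact.lTensor X.carrier t) = (Y.contract a).lTensor X.carrier t := fun a t =>
    (LinearMap.lTensor_comp_apply X.carrier (A.lslice Y.carrier a) Y.coact t).symm
  rw [mem_cotensor]
  constructor
  · intro h i a _
    rw [← h1, ← h2]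
    exact congrArg _ h
  · intro h
    rw [← sub_eq_zero]
    -- Evaluations at homogeneous elements separate DA ⊗ Y, and they still do so after tensoring
    -- with X.
    refine lTensor_jointly_injective
      (fun a : {a : A // ∃ i, a ∈ A.gr i} => A.lslice Y.carrier a.1) ?_ ?_
    · intro r hr
      exact A.lslice_ext fun i a ha => (hr ⟨a, i, ha⟩).trans (map_zero _).symm
    · rintro ⟨a, i, ha⟩
      rw [map_sub, sub_eq_zero]
      exact (h1 a t).trans ((h i a ha).trans (h2 a t).symm)

/-- Both actions are contractions followed by the same twist on X, up to the sign (-1)^(n|a|); the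
twist is invertible, so equality of the contractions is graded centrality. The extra sign (-1)^|a|
in the convention for right modules is what makes the sign come out as (-1)^(n|a|). -/
theorem mem_cotensor_iff {n : ℤ} {t : X.carrier ⊗[k] Y.carrier}
    (ht : t ∈ DGVect.tensorGr X.toDGVect Y.toDGVect n) :
    t ∈ cotensor X Y ↔ ∀ i, ∀ a ∈ A.gr i,
      (Y.action a).lTensor X.carrier t = sgn k (n * i) • (X.action a).rTensor Y.carrier t := by
  rw [mem_cotensor_iff_contract]
  refine forall_congr' fun i => forall₂_congr fun a ha => ?_
  have h1 : (X.action a).rTensor Y.carrier t =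
      sgn k i • (X.twist i).rTensor Y.carrier ((X.contract a).rTensor Y.carrier t) := by
    have e : X.action a = sgn k i • X.twist i ∘ₗ X.contract a :=
      LinearMap.ext fun m => (X.action_apply ha m).trans (X.contract_twist ha m)
    rw [e, LinearMap.rTensor_smul, LinearMap.rTensor_comp]
    rfl
  -- On x ⊗ y the sign of the action involves |y| = n - |x|; the part that depends on |x| is
  -- absorbed by a twist of the left factor.
  have h2 : (Y.action a).lTensor X.carrier t = (sgn k (n * i) * sgn k i) •
      (X.twist i).rTensor Y.carrier ((Y.contract a).lTensor X.carrier t) := by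
    refine DGVect.tensorGr_le (X := X.toDGVect) (Y := Y.toDGVect) (P := LinearMap.eqLocus
      ((Y.action a).lTensor X.carrier) ((sgn k (n * i) * sgn k i) •
      (X.twist i).rTensor Y.carrier ∘ₗ (Y.contract a).lTensor X.carrier)) ?_ ht
    rintro p q rfl x hx y hy
    simp only [LinearMap.mem_eqLocus, LinearMap.smul_apply, LinearMap.comp_apply,
      LinearMap.lTensor_tmul, LinearMap.rTensor_tmul, Y.action_apply_of_mem ha hy,
      X.twist_apply i hx, ← TensorProduct.smul_tmul', TensorProduct.tmul_smul, smul_smul, ← sgn_add]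
    congr 1
    exact sgn_congr (by ring_nf; simp [Int.even_add, parity_simps])
  -- The twist is an involution, so it can be cancelled in the converse direction.
  have h3 : ∀ t, (X.twist i).rTensor Y.carrier ((X.twist i).rTensor Y.carrier t) = t := by
    intro t
    rw [← LinearMap.rTensor_comp_apply, show X.twist i ∘ₗ X.twist i = LinearMap.id from
      LinearMap.ext (X.twist_twist i), LinearMap.rTensor_id, LinearMap.id_apply]
  rw [h1, h2, smul_smul]
  constructor
  · intro h; rw [h]
  · intro h
    have e := congrArg (fun t => (X.twist i).rTensor Y.carrier
      ((sgn k (n * i) * sgn k i) • t)) h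
    have e' : sgn k (n * i) * sgn k i * (sgn k (n * i) * sgn k i) = 1 := by
      rw [mul_mul_mul_comm, sgn_mul_self, sgn_mul_self, one_mul]
    simp only [smul_smul, e', one_smul, h3] at e
    exact e.symm

end Central

/-! ### Homogeneous components, images and finite products -/

namespace DGVect
variable {k : Type u} [Field k]

/-- The homogeneous component of degree `n`. -/
def component (X : DGVect k) (n : ℤ) : X →ₗ[k] X :=
  X.desc fun m => if m = n then (X.gr m).subtype else 0

theorem component_same (X : DGVect k) {n : ℤ} {x : X} (hx : x ∈ X.gr n) :
    X.component n x = x := by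
  simp [component, desc_apply _ _ hx]

theorem component_ne (X : DGVect k) {m n : ℤ} (h : m ≠ n) {x : X} (hx : x ∈ X.gr m) :
    X.component n x = 0 := by
  simp [component, desc_apply _ _ hx, h]

theorem component_mem (X : DGVect k) (n : ℤ) (x : X) : X.component n x ∈ X.gr n := by
  refine X.induction (P := fun x => X.component n x ∈ X.gr n) ?_ ?_ x
  · intro m x hx
    by_cases h : m = n
    · subst h; rwa [X.component_same hx]
    · rw [X.component_ne h hx]; exact zero_mem _
  · intro x y hx hy; rw [map_add]; exact add_mem hx hy

/-- A linear map of degree s carries decompositions into homogeneous parts to such decompositions.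
This gives a grading on images, and homogeneity of a map known only through pairings. -/
theorem map_component {X Y : DGVect k} {f : X →ₗ[k] Y} {s : ℤ}
    (hf : ∀ n, ∀ x ∈ X.gr n, f x ∈ Y.gr (n + s)) (n : ℤ) (x : X) :
    f (X.component n x) = Y.component (n + s) (f x) := by
  refine X.induction (P := fun x => f (X.component n x) = Y.component (n + s) (f x)) ?_ ?_ x
  · intro m x hx
    by_cases h : m = n
    · subst h; rw [X.component_same hx, Y.component_same (hf _ _ hx)]
    · rw [X.component_ne h hx, Y.component_ne (by omega) (hf _ _ hx), map_zero]
  · intro x y hx hy; simp only [map_add, hx, hy]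

/-- A family of submodules is a grading if there are component maps and the submodules span. -/
theorem isInternal_of_component {V : Type u} [AddCommGroup V] [Module k V]
    (gr : ℤ → Submodule k V) (c : ℤ → V →ₗ[k] V) (hc : ∀ n, ∀ x ∈ gr n, c n x = x)
    (hc' : ∀ m n, m ≠ n → ∀ x ∈ gr m, c n x = 0) (h : ⨆ n, gr n = ⊤) :
    DirectSum.IsInternal gr := by
  refine DirectSum.isInternal_submodule_of_iSupIndep_of_iSup_eq_top ?_ h
  rw [iSupIndep_def]
  intro n
  rw [Submodule.disjoint_def]
  intro x hx hx'
  have : (⨆ (m) (_ : m ≠ n), gr m) ≤ LinearMap.ker (c n) :=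
    iSup₂_le fun m hm y hy => hc' m n hm y hy
  rw [← hc n x hx]
  exact this hx'

/-- The image of a map of DG vector spaces. -/
abbrev range {X Y : DGVect k} (f : X →ₗ[k] Y) (hf : IsDGMap f) : DGVect k where
  carrier := ↥(LinearMap.range f)
  gr n := (Y.gr n).comap (LinearMap.range f).subtype
  internal := by
    -- The image contains the homogeneous components of its elements, so the grading of `Y`
    -- restricts to it.
    have hmem : ∀ n, ∀ y ∈ LinearMap.range f, Y.component n y ∈ LinearMap.range f := by
      rintro n _ ⟨x, rfl⟩
      refine ⟨X.component n x, ?_⟩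
      rw [map_component (s := 0) (fun n x hx => by simpa using hf.map_mem hx), add_zero]
    refine isInternal_of_component _ (fun n => (Y.component n).restrict (hmem n)) ?_ ?_ ?_
    · intro n x hx
      exact Subtype.ext (Y.component_same hx)
    · intro m n hmn x hx
      exact Subtype.ext (Y.component_ne hmn hx)
    · rw [eq_top_iff]
      rintro ⟨_, x, rfl⟩ -
      refine X.induction (P := fun x => f.rangeRestrict x ∈
        ⨆ n, (Y.gr n).comap (LinearMap.range f).subtype) ?_ ?_ x
      · intro n x hx
        exact Submodule.mem_iSup_of_mem n (hf.map_mem hx)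
      · intro x y hx hy; rw [map_add]; exact add_mem hx hy
  d := Y.d.restrict (p := LinearMap.range f) (q := LinearMap.range f) (by
    rintro _ ⟨x, rfl⟩
    exact ⟨X.d x, hf.map_d x⟩)
  d_mem hx := Y.d_mem hx
  d_d x := Subtype.ext (Y.d_d x)

/-- The product of a finite family of DG vector spaces. -/
abbrev pi {ι : Type} [Finite ι] (X : ι → DGVect k) : DGVect k where
  carrier := ∀ i, X i
  gr n := Submodule.pi Set.univ fun i => (X i).gr n
  internal := by
    classical
    have := Fintype.ofFinite ι
    refine isInternal_of_component _
      (fun n => LinearMap.pi fun i => (X i).component n ∘ₗ LinearMap.proj i) ?_ ?_ ?_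
    · intro n x hx
      funext i
      exact (X i).component_same (hx i trivial)
    · intro m n hmn x hx
      funext i
      exact (X i).component_ne hmn (hx i trivial)
    · rw [eq_top_iff]
      rintro x -
      -- Finiteness of the index set enters here: an element of the product is the finite sum of its
      -- coordinates, and each coordinate is a sum of homogeneous elements.
      rw [← LinearMap.sum_single_apply (fun i => (X i).carrier) x]
      refine sum_mem fun i _ => ?_
      refine (X i).induction (P := fun y => LinearMap.single k (fun i => (X i).carrier) i y ∈
        ⨆ n, Submodule.pi Set.univ fun i => (X i).gr n) ?_ ?_ (x i)
      · intro n y hy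
        refine Submodule.mem_iSup_of_mem n ?_
        intro j _
        by_cases h : j = i
        · subst h; simpa using hy
        · simp [Pi.single_eq_of_ne h]
      · intro y z hy hz; rw [map_add]; exact add_mem hy hz
  d := LinearMap.pi fun i => (X i).d ∘ₗ LinearMap.proj i
  d_mem hx i _ := (X i).d_mem (hx i trivial)
  d_d x := funext fun i => (X i).d_d (x i)

end DGVect

/-! ### Extensions to injective DG bimodules, and finite products of them. -/

section Bimodules
variable {k : Type u} [Field k] {A : DGAlgebra k}

theorem bimodules_isPreadditive (A : DGAlgebra k) : (bimodules A).IsPreadditive where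
  isDGMap h := h.toIsDGMap
  id X := ⟨isDGMap_id _, fun _ _ => rfl, fun _ _ => rfl⟩
  comp {X Y Z g f} hg hf := ⟨hg.toIsDGMap.comp hf.toIsDGMap,
    fun a m => by simp only [LinearMap.comp_apply, hf.map_lact, hg.map_lact],
    fun a m => by simp only [LinearMap.comp_apply, hf.map_ract, hg.map_ract]⟩
  sub {X Y g f} hg hf := ⟨hg.toIsDGMap.sub hf.toIsDGMap,
    fun a m => by simp only [LinearMap.sub_apply, hf.map_lact, hg.map_lact, map_sub],
    fun a m => by simp only [LinearMap.sub_apply, hf.map_ract, hg.map_ract, map_sub]⟩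

/-- The restriction of a representation to an invariant submodule. -/
def restrictRep {R V : Type u} [Ring R] [Algebra k R] [AddCommGroup V] [Module k V]
    (ρ : R →ₐ[k] Module.End k V) (S : Submodule k V) (h : ∀ a, ∀ x ∈ S, ρ a x ∈ S) :
    R →ₐ[k] Module.End k S :=
  AlgHom.ofLinearMap
    { toFun := fun a => (ρ a).restrict (h a)
      map_add' := fun a b => by ext x; simp
      map_smul' := fun c a => by ext x; simp }
    (by ext x; simp) (fun a b => by ext x; simp)

/-- The image of a homomorphism of DG bimodules. -/
abbrev DGBimodule.range {X Y : DGBimodule A} (f : X.toDGVect →ₗ[k] Y.toDGVect)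
    (hf : DGBimodule.IsHom f) : DGBimodule A where
  toDGVect := DGVect.range f hf.toIsDGMap
  lact := restrictRep Y.lact (LinearMap.range f) (by
    rintro a _ ⟨x, rfl⟩
    exact ⟨X.lact a x, hf.map_lact a x⟩)
  ract := restrictRep Y.ract (LinearMap.range f) (by
    rintro a _ ⟨x, rfl⟩
    exact ⟨X.ract a x, hf.map_ract a.unop x⟩)
  lact_ract a b m := Subtype.ext (Y.lact_ract a b m)
  lact_mem ha hm := Y.lact_mem ha hm
  ract_mem ha hm := Y.ract_mem ha hm
  leibniz_left ha m := Subtype.ext (Y.leibniz_left ha m)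
  leibniz_right a _ hm := Subtype.ext (Y.leibniz_right a hm)

/-- The map `δ` factors through its image, which is a sub-bimodule. There `g` descends, and the
inclusion of the image is split, so injectivity of `Q` applies to it. -/
theorem bimodules_hasExtensions (A : DGAlgebra k) : (bimodules A).HasExtensions := by
  intro X Y Q δ s g hQ hδ hs hδs hg hgs
  have hδ' : DGBimodule.IsHom δ := hδ
  have hg' : DGBimodule.IsHom g := hg
  let Z : DGBimodule A := DGBimodule.range δ hδ'
  let incl : Z.toDGVect →ₗ[k] Y.toDGVect := (LinearMap.range δ).subtype
  have hincl : DGBimodule.IsHom incl := ⟨⟨fun h => h, fun _ => rfl⟩, fun _ _ => rfl, fun _ _ => rfl⟩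
  -- The map `δ ∘ₗ s` is the identity on the image of `δ`, because `δ ∘ₗ s ∘ₗ δ = δ`.
  let r : Y.toDGVect →ₗ[k] Z.toDGVect := δ.rangeRestrict ∘ₗ s
  have hr : IsDGMap r := ⟨fun h => hδ'.map_mem (hs.map_mem h), fun x => Subtype.ext (by
    change δ (s (Y.d x)) = Y.d (δ (s x))
    rw [hs.map_d, hδ'.map_d])⟩
  have hri : r ∘ₗ incl = LinearMap.id := by
    ext ⟨_, x, rfl⟩
    exact LinearMap.congr_fun hδs x
  -- Although `s` is only a DG map, `g'` is a bimodule map: its composite with the surjection `δ`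
  -- onto `Z` is `g`.
  let g' : Z.toDGVect →ₗ[k] Q.toDGVect := g ∘ₗ s ∘ₗ incl
  have key : ∀ x, g' (δ.rangeRestrict x) = g x := LinearMap.congr_fun hgs
  have hZ : ∀ z : Z.toDGVect, ∃ x, δ.rangeRestrict x = z := LinearMap.surjective_rangeRestrict δ
  have hg'' : DGBimodule.IsHom g' := by
    refine ⟨(hg'.toIsDGMap.comp hs).comp hincl.toIsDGMap, fun a z => ?_, fun a z => ?_⟩
    · obtain ⟨x, rfl⟩ := hZ z
      have e : Z.lact a (δ.rangeRestrict x) = δ.rangeRestrict (X.lact a x) :=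
        Subtype.ext (hδ'.map_lact a x).symm
      rw [e, key, key, hg'.map_lact]
    · obtain ⟨x, rfl⟩ := hZ z
      have e : Z.ract (.op a) (δ.rangeRestrict x) = δ.rangeRestrict (X.ract (.op a) x) :=
        Subtype.ext (hδ'.map_ract a x).symm
      rw [e, key, key, hg'.map_ract]
  obtain ⟨h, hh, hhi⟩ := hQ Z Y incl r g' hincl hr hri hg''
  refine ⟨h, hh, ?_⟩
  ext x
  exact (LinearMap.congr_fun hhi (δ.rangeRestrict x)).trans (key x)

/-- The diagonal representation on a product. -/
def piRep {R : Type u} [Ring R] [Algebra k R] {ι : Type} {V : ι → Type u}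
    [∀ i, AddCommGroup (V i)] [∀ i, Module k (V i)] (ρ : ∀ i, R →ₐ[k] Module.End k (V i)) :
    R →ₐ[k] Module.End k (∀ i, V i) :=
  AlgHom.ofLinearMap
    { toFun := fun a => LinearMap.pi fun i => ρ i a ∘ₗ LinearMap.proj i
      map_add' := fun a b => by ext x; simp
      map_smul' := fun c a => by ext x; simp }
    (by ext x; simp) (fun a b => by ext x; simp)

/-- The product of a finite family of DG bimodules. -/
abbrev DGBimodule.pi {ι : Type} [Finite ι] (X : ι → DGBimodule A) : DGBimodule A where
  toDGVect := DGVect.pi fun i => (X i).toDGVect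
  lact := piRep fun i => (X i).lact
  ract := piRep fun i => (X i).ract
  lact_ract a b m := funext fun i => (X i).lact_ract a b (m i)
  lact_mem ha hm i _ := (X i).lact_mem ha (hm i trivial)
  ract_mem ha hm i _ := (X i).ract_mem ha (hm i trivial)
  leibniz_left ha m := funext fun i => (X i).leibniz_left ha (m i)
  leibniz_right a _ hm := funext fun i => (X i).leibniz_right a (hm i trivial)

/-- Extensions are chosen in each coordinate. The case used is a total complex, where each degree is
a finite product. -/
theorem DGBimodule.isInjective_pi {ι : Type} [Finite ι] {X : ι → DGBimodule A}
    (hX : ∀ i, (bimodules A).IsInjective (X i)) :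
    (bimodules A).IsInjective (DGBimodule.pi X) := by
  intro Y Z i r g hi hr hri hg
  have hg' : DGBimodule.IsHom (M' := DGBimodule.pi X) g := hg
  choose h hh hhi using fun j => hX j Y Z i r (LinearMap.proj j ∘ₗ g) hi hr hri
    ⟨⟨fun hx => hg'.map_mem hx j trivial, fun x => congrFun (hg'.map_d x) j⟩,
      fun a m => congrFun (hg'.map_lact a m) j, fun a m => congrFun (hg'.map_ract a m) j⟩
  refine ⟨LinearMap.pi h, ⟨⟨fun hx j _ => (hh j).map_mem hx, fun x => funext fun j =>
    (hh j).map_d x⟩, fun a m => funext fun j => (hh j).map_lact a m, fun a m => funext fun j =>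
    (hh j).map_ract a m⟩, ?_⟩
  ext x j
  exact LinearMap.congr_fun (hhi j) x

end Bimodules

/-! ### Injectivity of the tensor product of cofree comodules -/

section Pairing
variable {k : Type u} [Field k] {A : DGAlgebra k}

/-- The trilinear map `(z, a, b) ↦ u (a z b)`. -/
def pairing (B : DGBimodule A) {U : Type u} [AddCommGroup U] [Module k U]
    (u : B.carrier →ₗ[k] U) : B.carrier →ₗ[k] A →ₗ[k] A →ₗ[k] U :=
  LinearMap.mk₂ k (fun z a => u ∘ₗ B.lact a ∘ₗ
      (B.ract.toLinearMap ∘ₗ (MulOpposite.opLinearEquiv k).toLinearMap).flip z)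
    (fun _ _ _ => by ext; simp) (fun _ _ _ => by ext; simp)
    (fun _ _ _ => by ext; simp) (fun _ _ _ => by ext; simp)

theorem pairing_apply (B : DGBimodule A) {U : Type u} [AddCommGroup U] [Module k U]
    (u : B.carrier →ₗ[k] U) (z : B.carrier) (a b : A) :
    pairing B u z a b = u (B.lact a (B.ract (.op b) z)) := rfl

theorem pairing_lact (B : DGBimodule A) {U : Type u} [AddCommGroup U] [Module k U]
    (u : B.carrier →ₗ[k] U) (c : A) (z : B.carrier) (a b : A) :
    pairing B u (B.lact c z) a b = pairing B u z (a * c) b := by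
  rw [pairing_apply, pairing_apply, map_mul, Module.End.mul_apply, B.lact_ract c b]

theorem pairing_ract (B : DGBimodule A) {U : Type u} [AddCommGroup U] [Module k U]
    (u : B.carrier →ₗ[k] U) (c : A) (z : B.carrier) (a b : A) :
    pairing B u (B.ract (.op c) z) a b = pairing B u z a (c * b) := by
  rw [pairing_apply, pairing_apply, MulOpposite.op_mul, map_mul, Module.End.mul_apply]

theorem pairing_mem (B : DGBimodule A) {U : DGVect k} {u : B.toDGVect →ₗ[k] U} (hu : IsDGMap u)
    {p i j : ℤ} {z : B.carrier} (hz : z ∈ B.gr p) {a b : A} (ha : a ∈ A.gr i) (hb : b ∈ A.gr j) :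
    pairing B u z a b ∈ U.gr (p + (i + j)) := by
  rw [show p + (i + j) = i + (p + j) by ring]
  exact hu.map_mem (B.lact_mem ha (B.ract_mem hb hz))

/-- The Leibniz rule for a z b, solved for the term with d z. In this form the pairing of d z is
determined by the pairing of z, so a map that preserves pairings commutes with d. -/
theorem pairing_d (B : DGBimodule A) {U : DGVect k} {u : B.toDGVect →ₗ[k] U} (hu : IsDGMap u)
    {p i : ℤ} {z : B.carrier} (hz : z ∈ B.gr p) {a : A} (ha : a ∈ A.gr i) (b : A) :
    pairing B u (B.d z) a b = sgn k i • (U.d (pairing B u z a b) - pairing B u z (A.d a) b) -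
      sgn k p • pairing B u z a (A.d b) := by
  simp only [pairing_apply]
  rw [← hu.map_d, B.leibniz_left ha, B.leibniz_right b hz]
  simp only [map_add, map_smul, smul_add, smul_sub, smul_smul]
  rw [sgn_mul_self, ← mul_assoc, sgn_mul_self]
  module

theorem pairing_ext {U : Type u} [AddCommGroup U] [Module k U] {φ ψ : A →ₗ[k] A →ₗ[k] U}
    (h : ∀ i, ∀ a ∈ A.gr i, ∀ j, ∀ b ∈ A.gr j, φ a b = ψ a b) : φ = ψ :=
  A.V.hom_ext fun i a ha => A.V.hom_ext fun j b hb => h i a ha j b hb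

/-- A DG map `ev : P → U` is cogenerating if every DG map `Z → U` from a DG bimodule lifts to a
unique linear map `Z → P` compatible with the actions. -/
structure Cogenerating (P : DGBimodule A) {U : DGVect k} (ev : P.toDGVect →ₗ[k] U) : Prop where
  isDGMap : IsDGMap ev
  injective : Function.Injective (pairing P ev)
  range : ∀ (Z : DGBimodule A) (v : Z.toDGVect →ₗ[k] U), IsDGMap v →
    ∀ z, pairing Z v z ∈ LinearMap.range (pairing P ev)

/-- The pairing on `P` is injective and its range contains the pairings of `Z`, so `H` is obtained
by inverting it. Each compatibility of `H` is an equality of pairings, where the formulas for `d`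
and for the actions are the same on both sides. -/
theorem Cogenerating.exists_hom {P : DGBimodule A} {U : DGVect k} {ev : P.toDGVect →ₗ[k] U}
    (hP : Cogenerating P ev) (Z : DGBimodule A) (v : Z.toDGVect →ₗ[k] U) (hv : IsDGMap v) :
    ∃ H : Z.toDGVect →ₗ[k] P.toDGVect, DGBimodule.IsHom H ∧
      ∀ z, pairing P ev (H z) = pairing Z v z := by
  let H : Z.toDGVect →ₗ[k] P.toDGVect :=
    (LinearEquiv.ofInjective (pairing P ev) hP.injective).symm.toLinearMap ∘ₗ
      (pairing Z v).codRestrict _ (hP.range Z v hv)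
  have hH : ∀ z, pairing P ev (H z) = pairing Z v z := by
    intro z
    have := LinearEquiv.apply_symm_apply (LinearEquiv.ofInjective (pairing P ev) hP.injective)
      ((pairing Z v).codRestrict _ (hP.range Z v hv) z)
    exact congrArg Subtype.val this
  have hmem : ∀ {n : ℤ} {z : Z.toDGVect}, z ∈ Z.gr n → H z ∈ P.gr n := by
    intro n z hz
    -- For fixed homogeneous `a` and `b` the pairing is homogeneous in its first argument, and the
    -- value at `H z` already lies in one degree, so `H z` and its component of degree n have equal
    -- pairings.
    have e : P.component n (H z) = H z := by
      apply hP.injective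
      refine pairing_ext fun i a ha j b hb => ?_
      have hop : ∀ m, ∀ x ∈ P.gr m, ((LinearMap.applyₗ b) ∘ₗ (LinearMap.applyₗ a) ∘ₗ
          pairing P ev) x ∈ U.gr (m + (i + j)) := fun m x hx =>
        pairing_mem P hP.isDGMap hx ha hb
      refine (DGVect.map_component hop n (H z)).trans ?_
      refine U.component_same ?_
      change pairing P ev (H z) a b ∈ _
      rw [hH]
      exact pairing_mem Z hv hz ha hb
    rw [← e]
    exact P.component_mem n _
  refine ⟨H, ⟨⟨hmem, fun z => ?_⟩, fun c z => ?_, fun c z => ?_⟩, hH⟩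
  · refine Z.induction (P := fun z => H (Z.d z) = P.d (H z)) ?_ ?_ z
    · intro p z hz
      apply hP.injective
      refine pairing_ext fun i a ha j b _ => ?_
      rw [hH, pairing_d Z hv hz ha, pairing_d P hP.isDGMap (hmem hz) ha, hH]
    · intro x y hx hy; simp only [map_add, hx, hy]
  · apply hP.injective
    refine pairing_ext fun i a _ j b _ => ?_
    rw [hH, pairing_lact, pairing_lact, hH]
  · apply hP.injective
    refine pairing_ext fun i a _ j b _ => ?_
    rw [hH, pairing_ract, pairing_ract, hH]

/-- The composite `ev ∘ₗ g ∘ₗ r` is only a DG map to U, and the bimodule map determined by it is the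
extension. On the image of `i` its pairings are those of `g`, because `i` and `g` are bimodule maps
and `r ∘ₗ i` is the identity. -/
theorem Cogenerating.isInjective {P : DGBimodule A} {U : DGVect k} {ev : P.toDGVect →ₗ[k] U}
    (hP : Cogenerating P ev) : (bimodules A).IsInjective P := by
  intro Y Z i r g hi hr hri hg
  have hi' : DGBimodule.IsHom i := hi
  have hg' : DGBimodule.IsHom g := hg
  obtain ⟨H, hH, hpair⟩ := hP.exists_hom Z (ev ∘ₗ g ∘ₗ r)
    (hP.isDGMap.comp (hg'.toIsDGMap.comp hr))
  refine ⟨H, hH, LinearMap.ext fun y => hP.injective ?_⟩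
  refine pairing_ext fun p a _ q b _ => ?_
  rw [LinearMap.comp_apply, hpair, pairing_apply, pairing_apply, ← hi'.map_ract, ← hi'.map_lact,
    ← hg'.map_ract, ← hg'.map_lact]
  exact congrArg (fun x => ev (g x)) (LinearMap.congr_fun hri _)

/-- Dual bases of `A` and of its graded dual, up to degree `N`. -/
theorem DGAlgebra.exists_dualBasis (A : DGAlgebra k) [A.FiniteType] (N : ℤ) :
    ∃ (ι : Type) (_ : Fintype ι) (deg : ι → ℤ) (e : ι → A) (c : ι → A.Dual),
      (∀ l, e l ∈ A.gr (deg l)) ∧ (∀ l, deg l ≤ N) ∧ (∀ l, c l ∈ A.dualDeg (-deg l)) ∧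
      ∀ p ≤ N, ∀ a ∈ A.gr p, ∑ l, A.dualIncl (c l) a • e l = a := by
  have hfin : ∀ n, Module.Finite k (A.gr n) := FiniteType.finite
  let b := fun n : ℤ => Module.finBasis k (A.gr n)
  have hmem : ∀ n i, (b n).coord i ∘ₗ A.proj n ∈ A.dualGr (-n) := by
    intro n i m hm a ha
    rw [LinearMap.comp_apply, A.proj_ne (by simpa using hm) ha, map_zero]
  let c : ∀ (n : ℤ) (_ : Fin (Module.finrank k (A.gr n))), A.Dual := fun n i =>
    ⟨(b n).coord i ∘ₗ A.proj n, Submodule.mem_iSup_of_mem (-n) (hmem n i)⟩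
  have hc : ∀ n i a, A.dualIncl (c n i) a = (b n).coord i (A.proj n a) := fun n i a => rfl
  -- Since A has no negative degrees and is of finite type, bases in the degrees 0, …, N form one
  -- finite family.
  refine ⟨Σ n : ↥(Finset.Icc 0 N), Fin (Module.finrank k (A.gr n.1)), inferInstance,
    fun l => l.1.1, fun l => (b l.1.1 l.2 : A.gr l.1.1), fun l => c l.1.1 l.2,
    fun l => (b l.1.1 l.2).2, fun l => (Finset.mem_Icc.mp l.1.2).2, fun l => hmem _ _, ?_⟩
  intro p hp a ha
  by_cases h0 : p < 0
  · rw [A.gr_neg p h0, Submodule.mem_bot] at ha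
    simp [ha]
  · rw [Fintype.sum_sigma, Finset.sum_eq_single
      (⟨p, Finset.mem_Icc.mpr ⟨not_lt.mp h0, hp⟩⟩ : ↥(Finset.Icc 0 N))]
    · simp only [hc]
      rw [A.proj_same ha]
      have h := congrArg (A.gr p).subtype ((b p).sum_repr ⟨a, ha⟩)
      simp only [map_sum, map_smul, Submodule.subtype_apply] at h
      simpa only [Module.Basis.coord_apply] using h
    · intro n _ hn
      refine Finset.sum_eq_zero fun i _ => ?_
      rw [hc, A.proj_ne (n := n.1) (m := p) (by rintro rfl; exact hn rfl) ha, map_zero, zero_smul]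
    · intro h; exact absurd (Finset.mem_univ _) h

end Pairing

/-! ### The bimodule (V ⊗ DA) ⊗ (DA ⊗ W) as a coinduced bimodule. -/

section CofreeTensor
variable {k : Type u} [Field k] {A : DGAlgebra k} [A.FiniteType]

/-- By the counit axiom, contracting with `a` and then projecting to V is evaluation at `a`. So the
projections of all `a x` together determine x. -/
theorem counitRight_action (V : DGVect k) {i : ℤ} {a : A} (ha : a ∈ A.gr i)
    (x : V.carrier ⊗[k] A.Dual) : counitRight A.dual V ((cofreeRight A.dual V).action a x) =
      sgn k i • V.twist i (A.slice V a x) := by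
  have h : ∀ x, counitRight A.dual V ((cofreeRight A.dual V).contract a x) = A.slice V a x := by
    intro x
    rw [DGRightComodule.contract_apply]
    refine (A.slice_rTensor (counitRight A.dual V) a _).symm.trans ?_
    exact congrArg (A.slice V a) (LinearMap.congr_fun ((rightCofree A.dual).map_ε_η V) x)
  rw [DGRightComodule.action_apply _ ha, DGRightComodule.contract_twist _ ha, map_smul,
    (isDGMap_counitRight A.dual V).map_twist, h]

theorem counitLeft_action (W : DGVect k) {i : ℤ} {a : A} (ha : a ∈ A.gr i)
    (x : A.Dual ⊗[k] W.carrier) : counitLeft A.dual W ((cofreeLeft A.dual W).action a x) =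
      W.twist i (A.lslice W a x) := by
  have h : ∀ x, counitLeft A.dual W ((cofreeLeft A.dual W).contract a x) = A.lslice W a x := by
    intro x
    rw [DGLeftComodule.contract_apply]
    refine (A.lslice_lTensor (counitLeft A.dual W) a _).symm.trans ?_
    exact congrArg (A.lslice W a) (LinearMap.congr_fun ((leftCofree A.dual).map_ε_η W) x)
  rw [DGLeftComodule.action_apply _ ha, DGLeftComodule.contract_twist _ ha, map_smul, map_smul,
    (isDGMap_counitLeft A.dual W).map_twist, h, smul_smul, sgn_mul_self, one_smul]

/-- Such sections, taken over a dual basis, produce elements of V ⊗ DA whose pairings with A are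
prescribed. -/
theorem exists_counitRight_section (V : DGVect k) {n : ℤ} {c : A.Dual} (hc : c ∈ A.dualDeg (-n)) :
    ∃ s : V →ₗ[k] V.carrier ⊗[k] A.Dual, ∀ a,
      counitRight A.dual V ∘ₗ (cofreeRight A.dual V).action a ∘ₗ s =
        A.dualIncl c a • LinearMap.id := by
  -- The sign and the twist undo those of `counitRight_action` for `a` of degree n; in other degrees
  -- `c` vanishes on `a`.
  refine ⟨sgn k n • (TensorProduct.mk k V.carrier A.Dual).flip c ∘ₗ V.twist n, fun a => ?_⟩
  ext v
  refine A.V.induction (P := fun a => counitRight A.dual V ((cofreeRight A.dual V).action a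
    (sgn k n • (V.twist n v ⊗ₜ[k] c))) = A.dualIncl c a • v) ?_ ?_ a
  · intro i a ha
    rw [counitRight_action V ha, map_smul, A.slice_tmul]
    by_cases hi : i = n
    · subst hi
      simp only [map_smul, V.twist_twist, smul_smul]
      rw [← mul_assoc, sgn_mul_self, one_mul]
    · rw [A.mem_dualDeg.mp hc i (by simpa using hi) a ha]
      simp
  · intro x y hx hy; simp only [map_add, LinearMap.add_apply, add_smul, hx, hy]

theorem exists_counitLeft_section (W : DGVect k) {n : ℤ} {c : A.Dual} (hc : c ∈ A.dualDeg (-n)) :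
    ∃ s : W →ₗ[k] A.Dual ⊗[k] W.carrier, ∀ a,
      counitLeft A.dual W ∘ₗ (cofreeLeft A.dual W).action a ∘ₗ s =
        A.dualIncl c a • LinearMap.id := by
  refine ⟨TensorProduct.mk k A.Dual W.carrier c ∘ₗ W.twist n, fun a => ?_⟩
  ext v
  refine A.V.induction (P := fun a => counitLeft A.dual W ((cofreeLeft A.dual W).action a
    (c ⊗ₜ[k] W.twist n v)) = A.dualIncl c a • v) ?_ ?_ a
  · intro i a ha
    rw [counitLeft_action W ha, A.lslice_tmul]
    by_cases hi : i = n
    · subst hi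
      simp only [map_smul, W.twist_twist]
    · rw [A.mem_dualDeg.mp hc i (by simpa using hi) a ha]
      simp
  · intro x y hx hy; simp only [map_add, LinearMap.add_apply, add_smul, hx, hy]

variable (A) in
/-- The DG bimodule `(V ⊗ DA) ⊗ (DA ⊗ W)`. -/
abbrev cofreeTensor (V W : DGVect k) : DGBimodule A :=
  (cofreeRight A.dual V).toModule.tensor (cofreeLeft A.dual W).toModule

variable (A) in
/-- The projection `(V ⊗ DA) ⊗ (DA ⊗ W) → V ⊗ W`. -/
def counitTensor (V W : DGVect k) :
    (cofreeTensor A V W).toDGVect →ₗ[k] (V.tensor W) :=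
  TensorProduct.map (counitRight A.dual V) (counitLeft A.dual W)

theorem pairing_counitTensor (V W : DGVect k) (t : (cofreeTensor A V W).carrier) (a b : A) :
    pairing (cofreeTensor A V W) (counitTensor A V W) t a b =
      TensorProduct.map (counitRight A.dual V ∘ₗ (cofreeRight A.dual V).action a)
        (counitLeft A.dual W ∘ₗ (cofreeLeft A.dual W).action b) t := by
  rw [pairing_apply]
  change TensorProduct.map _ _ (((cofreeRight A.dual V).action a).rTensor _
    (((cofreeLeft A.dual W).action b).lTensor _ t)) = _
  rw [TensorProduct.map_comp, LinearMap.comp_apply, ← LinearMap.comp_apply (LinearMap.rTensor _ _),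
    LinearMap.rTensor_comp_lTensor]

/-- The pairing sends an element of (V ⊗ DA) ⊗ (DA ⊗ W) to its evaluations at pairs (a, b), up to
invertible twists, and these separate elements. It need not reach every bilinear map A × A → V ⊗ W,
but it reaches those of the form (a, b) ↦ v(a z b): for homogeneous z they vanish in large degrees,
because V ⊗ W is bounded above and A has no negative degrees. -/
theorem cogenerating_counitTensor {V W : DGVect k} (hV : V.BoundedAbove) (hW : W.BoundedAbove) :
    Cogenerating (cofreeTensor A V W) (counitTensor A V W) where
  isDGMap := isDGMap_map (isDGMap_counitRight A.dual V) (isDGMap_counitLeft A.dual W)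
  injective := by
    rw [injective_iff_map_eq_zero]
    intro t ht
    have ht' : ∀ a b : A, TensorProduct.map
        (counitRight A.dual V ∘ₗ (cofreeRight A.dual V).action a)
        (counitLeft A.dual W ∘ₗ (cofreeLeft A.dual W).action b) t = 0 := by
      intro a b
      rw [← pairing_counitTensor, ht]
      rfl
    refine lTensor_jointly_injective
      (fun b : A => counitLeft A.dual W ∘ₗ (cofreeLeft A.dual W).action b) ?_ fun b => ?_
    · intro r hr
      refine A.lslice_ext fun i a ha => ?_
      have := hr a
      rw [LinearMap.comp_apply, counitLeft_action W ha] at this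
      rw [map_zero, ← W.twist_twist i (A.lslice W a r), this, map_zero]
    · refine rTensor_jointly_injective
        (fun a : A => counitRight A.dual V ∘ₗ (cofreeRight A.dual V).action a) ?_ fun a => ?_
      · intro r hr
        refine A.slice_ext fun i a ha => ?_
        have := hr a
        rw [LinearMap.comp_apply, counitRight_action V ha] at this
        have h1 : V.twist i (A.slice V a r) = 0 := by
          rw [← one_smul k (V.twist i _), ← sgn_mul_self i, mul_smul, this, smul_zero]
        rw [map_zero, ← V.twist_twist i (A.slice V a r), h1, map_zero]
      · rw [← LinearMap.comp_apply, LinearMap.rTensor_comp_lTensor]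
        exact ht' a b
  range := by
    intro Z v hv z
    refine Z.induction (P := fun z => pairing Z v z ∈
      LinearMap.range (pairing (cofreeTensor A V W) (counitTensor A V W))) ?_ ?_ z
    · intro p z hz
      obtain ⟨B, hB⟩ := hV.tensor hW
      -- With z of degree p, the value v(a z b) has degree p + |a| + |b|, which exceeds the bound B
      -- once |a| or |b| is above B - p.
      obtain ⟨ι, _, deg, e, c, he, hdeg, hc, hsum⟩ := A.exists_dualBasis (B - p)
      choose s hs using fun l => exists_counitRight_section V (hc l)
      choose s' hs' using fun l => exists_counitLeft_section W (hc l)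
      refine ⟨∑ l, ∑ m, TensorProduct.map (s l) (s' m) (pairing Z v z (e l) (e m)), ?_⟩
      refine pairing_ext fun i a ha j b hb => ?_
      have h1 : ∀ l m y, pairing (cofreeTensor A V W) (counitTensor A V W)
          (TensorProduct.map (s l) (s' m) y) a b =
            (A.dualIncl (c l) a * A.dualIncl (c m) b) • y := by
        intro l m y
        rw [pairing_counitTensor, ← LinearMap.comp_apply, ← TensorProduct.map_comp,
          LinearMap.comp_assoc, LinearMap.comp_assoc, hs, hs', TensorProduct.map_smul_left,
          TensorProduct.map_smul_right, TensorProduct.map_id, smul_smul]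
        rfl
      simp only [map_sum, LinearMap.sum_apply, h1]
      by_cases hij : i ≤ B - p ∧ j ≤ B - p
      · have h2 : pairing Z v z a b = pairing Z v z (∑ l, A.dualIncl (c l) a • e l)
            (∑ m, A.dualIncl (c m) b • e m) := by
          rw [hsum i hij.1 a ha, hsum j hij.2 b hb]
        rw [h2]
        simp only [map_sum, LinearMap.sum_apply, map_smul, LinearMap.smul_apply]
        rw [Finset.sum_comm]
        refine Finset.sum_congr rfl fun m _ => ?_
        rw [Finset.smul_sum]
        refine Finset.sum_congr rfl fun l _ => ?_
        rw [smul_smul, mul_comm]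
      -- Outside the range of the dual basis both sides vanish: the pairing for degree reasons, the
      -- sum because its linear forms have degrees at most the cutoff.
      · have h3 : pairing Z v z a b = 0 := by
          by_cases hi : i < 0
          · rw [A.gr_neg i hi, Submodule.mem_bot] at ha
            rw [ha, map_zero, LinearMap.zero_apply]
          by_cases hj : j < 0
          · rw [A.gr_neg j hj, Submodule.mem_bot] at hb
            rw [hb, map_zero]
          have := pairing_mem Z hv hz ha hb
          rw [hB _ (by omega)] at this
          exact this
        rw [h3]
        refine Finset.sum_eq_zero fun l _ => Finset.sum_eq_zero fun m _ => ?_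
        rw [not_and_or] at hij
        have hl := hdeg l
        have hm := hdeg m
        rcases hij with h | h
        · rw [A.mem_dualDeg.mp (hc l) i (by omega) a ha, zero_mul, zero_smul]
        · rw [A.mem_dualDeg.mp (hc m) j (by omega) b hb, mul_zero, zero_smul]
    · intro x y hx hy
      rw [map_add]
      exact add_mem hx hy

theorem isInjective_cofreeTensor {V W : DGVect k} (hV : V.BoundedAbove) (hW : W.BoundedAbove) :
    (bimodules A).IsInjective (cofreeTensor A V W) :=
  (cogenerating_counitTensor hV hW).isInjective

end CofreeTensor

/-! ### The tensor product of two resolutions -/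

section TensorHom
variable {k : Type u} [Field k] {A : DGAlgebra k}

theorem IsDGMap.add {X Y : DGVect k} {g f : X →ₗ[k] Y} (hg : IsDGMap g)
    (hf : IsDGMap f) : IsDGMap (X := X) (Y := Y) (g + f) :=
  ⟨fun h => add_mem (hg.map_mem h) (hf.map_mem h), fun x => by
    simp only [LinearMap.add_apply, hf.map_d, hg.map_d, map_add]⟩

theorem IsDGMap.pi {ι : Type} [Finite ι] {X : DGVect k} {Y : ι → DGVect k}
    {f : ∀ i, X →ₗ[k] Y i} (hf : ∀ i, IsDGMap (f i)) :
    IsDGMap (X := X) (Y := DGVect.pi Y) (LinearMap.pi f) :=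
  ⟨fun h i _ => (hf i).map_mem h, fun x => funext fun i => (hf i).map_d x⟩

theorem IsDGMap.proj {ι : Type} [Finite ι] (Y : ι → DGVect k) (i : ι) :
    IsDGMap (X := DGVect.pi Y) (Y := Y i) (LinearMap.proj i) :=
  ⟨fun h => h i trivial, fun _ => rfl⟩

namespace DGBimodule

theorem IsHom.zero {X Y : DGBimodule A} :
    IsHom (0 : X.toDGVect →ₗ[k] Y.toDGVect) :=
  ⟨⟨fun _ => zero_mem _, fun _ => by simp⟩, fun _ _ => by simp, fun _ _ => by simp⟩

theorem IsHom.add {X Y : DGBimodule A} {f g : X.toDGVect →ₗ[k] Y.toDGVect} (hf : IsHom f)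
    (hg : IsHom g) : IsHom (f + g) :=
  ⟨hf.toIsDGMap.add hg.toIsDGMap,
    fun a m => by simp only [LinearMap.add_apply, hf.map_lact, hg.map_lact, map_add],
    fun a m => by simp only [LinearMap.add_apply, hf.map_ract, hg.map_ract, map_add]⟩

theorem IsHom.smul {X Y : DGBimodule A} {f : X.toDGVect →ₗ[k] Y.toDGVect} (hf : IsHom f)
    (c : k) : IsHom (c • f) :=
  ⟨⟨fun h => Submodule.smul_mem _ _ (hf.map_mem h), fun m => by
    simp only [LinearMap.smul_apply, hf.map_d, map_smul]⟩,
    fun a m => by simp only [LinearMap.smul_apply, hf.map_lact, map_smul],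
    fun a m => by simp only [LinearMap.smul_apply, hf.map_ract, map_smul]⟩

theorem IsHom.comp {X Y Z : DGBimodule A} {g : Y.toDGVect →ₗ[k] Z.toDGVect}
    {f : X.toDGVect →ₗ[k] Y.toDGVect} (hg : IsHom g) (hf : IsHom f) : IsHom (g ∘ₗ f) :=
  (bimodules_isPreadditive A).comp hg hf

theorem IsHom.pi {ι : Type} [Finite ι] {X : DGBimodule A} {Y : ι → DGBimodule A}
    {f : ∀ i, X.toDGVect →ₗ[k] (Y i).toDGVect} (hf : ∀ i, IsHom (f i)) :
    IsHom (M := X) (M' := DGBimodule.pi Y) (LinearMap.pi f) :=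
  ⟨IsDGMap.pi fun i => (hf i).toIsDGMap, fun a m => funext fun i => (hf i).map_lact a m,
    fun a m => funext fun i => (hf i).map_ract a m⟩

theorem IsHom.proj {ι : Type} [Finite ι] (Y : ι → DGBimodule A) (i : ι) :
    IsHom (M := DGBimodule.pi Y) (M' := Y i) (LinearMap.proj i) :=
  ⟨IsDGMap.proj _ i, fun _ _ => rfl, fun _ _ => rfl⟩

end DGBimodule

/-- The compatibilities are separate hypotheses because the lemma also serves for augmentations,
whose source carries the given action of A and whose target carries the one obtained from a
coaction. -/
theorem isHom_map {M M' : DGLeftModule A} {N N' : DGRightModule A}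
    {f : M.toDGVect →ₗ[k] M'.toDGVect} {g : N.toDGVect →ₗ[k] N'.toDGVect}
    (hf : IsDGMap f) (hg : IsDGMap g) (hfa : ∀ (a : A) m, f (M.lact a m) = M'.lact a (f m))
    (hga : ∀ (a : A) m, g (N.ract (.op a) m) = N'.ract (.op a) (g m)) :
    DGBimodule.IsHom (M := M.tensor N) (M' := M'.tensor N') (TensorProduct.map f g) := by
  refine ⟨isDGMap_map hf hg, fun a t => ?_, fun a t => ?_⟩
  · change TensorProduct.map f g ((M.lact a).rTensor N.carrier t) =
      (M'.lact a).rTensor N'.carrier (TensorProduct.map f g t)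
    induction t using TensorProduct.induction_on with
    | zero => simp
    | add x y hx hy => simp only [map_add, hx, hy]
    | tmul x y => simp only [LinearMap.rTensor_tmul, TensorProduct.map_tmul, hfa]
  · change TensorProduct.map f g ((N.ract (.op a)).lTensor M.carrier t) =
      (N'.ract (.op a)).lTensor M'.carrier (TensorProduct.map f g t)
    induction t using TensorProduct.induction_on with
    | zero => simp
    | add x y hx hy => simp only [map_add, hx, hy]
    | tmul x y => simp only [LinearMap.lTensor_tmul, TensorProduct.map_tmul, hga]

theorem isHom_map_toModule [A.FiniteType] {X X' : DGRightComodule A.dual}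
    {Y Y' : DGLeftComodule A.dual} {f : X.toDGVect →ₗ[k] X'.toDGVect}
    {g : Y.toDGVect →ₗ[k] Y'.toDGVect}
    (hf : DGRightComodule.IsHom f) (hg : DGLeftComodule.IsHom g) :
    DGBimodule.IsHom (M := X.toModule.tensor Y.toModule) (M' := X'.toModule.tensor Y'.toModule)
      (TensorProduct.map f g) :=
  isHom_map hf.toIsDGMap hg.toIsDGMap hf.map_action hg.map_action

end TensorHom

/-! ### The total complex of I ⊗ J and its contraction. -/

section Total
variable {k : Type u} [Field k] {A : DGAlgebra k} [A.FiniteType]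

/-- The pairs of natural numbers with sum `p`. -/
abbrev TotIdx (p : ℕ) : Type := {q : ℕ × ℕ // q.1 + q.2 = p}

instance (p : ℕ) : Finite (TotIdx p) :=
  Finite.of_injective
    (fun q => (⟨q.1, Finset.HasAntidiagonal.mem_antidiagonal.mpr q.2⟩ : ↥(Finset.HasAntidiagonal.antidiagonal p)))
    fun _ _ h => Subtype.ext (congrArg (fun q : ↥(Finset.HasAntidiagonal.antidiagonal p) => q.1) h)

theorem map_map_apply {X₁ X₂ X₃ Y₁ Y₂ Y₃ : Type u} [AddCommGroup X₁] [AddCommGroup X₂]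
    [AddCommGroup X₃] [AddCommGroup Y₁] [AddCommGroup Y₂] [AddCommGroup Y₃] [Module k X₁]
    [Module k X₂] [Module k X₃] [Module k Y₁] [Module k Y₂] [Module k Y₃] (f : X₂ →ₗ[k] X₃)
    (g : Y₂ →ₗ[k] Y₃) (f' : X₁ →ₗ[k] X₂) (g' : Y₁ →ₗ[k] Y₂) (t : X₁ ⊗[k] Y₁) :
    TensorProduct.map f g (TensorProduct.map f' g' t) =
      TensorProduct.map (f ∘ₗ f') (g ∘ₗ g') t := by
  rw [TensorProduct.map_comp, LinearMap.comp_apply]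

variable {X : DGRightComodule A.dual} {Y : DGLeftComodule A.dual}
  (I : SplitRes (rightComodules A.dual) X) (J : SplitRes (leftComodules A.dual) Y)

/-- The bimodules `I^i ⊗ J^j`. -/
abbrev biObj (i j : ℕ) : DGBimodule A := (I.obj i).toModule.tensor (J.obj j).toModule

/-- The bimodule `⨁ I^i ⊗ J^j` over `i + j = p`. -/
abbrev totObj (p : ℕ) : DGBimodule A := DGBimodule.pi fun q : TotIdx p => biObj I J q.1.1 q.1.2

/-- The part of the differential of the total complex that comes from `I`. -/
def totDI (p : ℕ) : ∀ q : TotIdx (p + 1),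
    (totObj I J p).toDGVect →ₗ[k] (biObj I J q.1.1 q.1.2).toDGVect
  | ⟨(0, _), _⟩ => 0
  | ⟨(i + 1, j), h⟩ => TensorProduct.map (I.δ i) LinearMap.id ∘ₗ
      LinearMap.proj (⟨(i, j), by simp only at h ⊢; omega⟩ : TotIdx p)

/-- The part of the differential of the total complex that comes from `J`, up to sign. -/
def totDJ (p : ℕ) : ∀ q : TotIdx (p + 1),
    (totObj I J p).toDGVect →ₗ[k] (biObj I J q.1.1 q.1.2).toDGVect
  | ⟨(_, 0), _⟩ => 0
  | ⟨(i, j + 1), h⟩ => TensorProduct.map LinearMap.id (J.δ j) ∘ₗ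
      LinearMap.proj (⟨(i, j), by simp only at h ⊢; omega⟩ : TotIdx p)

/-- The differential `δ_I + (-1)^i δ_J` of the total complex. -/
def totδ (p : ℕ) : (totObj I J p).toDGVect →ₗ[k] (totObj I J (p + 1)).toDGVect :=
  LinearMap.pi fun q => totDI I J p q + sgn k q.1.1 • totDJ I J p q

theorem totδ_apply (p : ℕ) (x : (totObj I J p).toDGVect) (q : TotIdx (p + 1)) :
    totδ I J p x q = totDI I J p q x + sgn k q.1.1 • totDJ I J p q x := rfl

theorem totDI_zero (p j : ℕ) (h : (0, j).1 + (0, j).2 = p + 1) (x : (totObj I J p).toDGVect) :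
    totDI I J p ⟨(0, j), h⟩ x = 0 := rfl

theorem totDI_succ (p i j : ℕ) (h : i + j = p) (h' : (i + 1, j).1 + (i + 1, j).2 = p + 1)
    (x : (totObj I J p).toDGVect) : totDI I J p ⟨(i + 1, j), h'⟩ x =
      TensorProduct.map (I.δ i) LinearMap.id (x ⟨(i, j), h⟩) := rfl

theorem totDJ_zero (p i : ℕ) (h : (i, 0).1 + (i, 0).2 = p + 1) (x : (totObj I J p).toDGVect) :
    totDJ I J p ⟨(i, 0), h⟩ x = 0 := by
  cases i <;> rfl

theorem totDJ_succ (p i j : ℕ) (h : i + j = p) (h' : (i, j + 1).1 + (i, j + 1).2 = p + 1)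
    (x : (totObj I J p).toDGVect) : totDJ I J p ⟨(i, j + 1), h'⟩ x =
      TensorProduct.map LinearMap.id (J.δ j) (x ⟨(i, j), h⟩) := by
  cases i <;> rfl

theorem totδ_hom (p : ℕ) :
    DGBimodule.IsHom (M := totObj I J p) (M' := totObj I J (p + 1)) (totδ I J p) := by
  refine DGBimodule.IsHom.pi fun q => DGBimodule.IsHom.add ?_ (DGBimodule.IsHom.smul ?_ _)
  · obtain ⟨⟨i, j⟩, h⟩ := q
    cases i with
    | zero => exact DGBimodule.IsHom.zero
    | succ i => exact (isHom_map_toModule (I.δ_hom i)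
        ((leftComodules_isPreadditive A.dual).id (J.obj j))).comp (DGBimodule.IsHom.proj _ _)
  · obtain ⟨⟨i, j⟩, h⟩ := q
    cases j with
    | zero => cases i <;> exact DGBimodule.IsHom.zero
    | succ j =>
      have e := isHom_map_toModule ((rightComodules_isPreadditive A.dual).id (I.obj i)) (J.δ_hom j)
      have h' : i + j = p := by simp only at h; omega
      have := e.comp (DGBimodule.IsHom.proj (fun q : TotIdx p => biObj I J q.1.1 q.1.2)
        ⟨(i, j), h'⟩)
      cases i <;> exact this

/-- The mixed terms cancel, since the sign (-1)^i of the J-part changes when δ_I raises i. -/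
theorem totδ_totδ (p : ℕ) (x : (totObj I J p).toDGVect) :
    totδ I J (p + 1) (totδ I J p x) = 0 := by
  have hRI : ∀ i j (h : i + j = p + 1), TensorProduct.map (I.δ i) LinearMap.id
      (totDI I J p ⟨(i, j), h⟩ x) = 0 := by
    intro i j h
    cases i with
    | zero => exact map_zero _
    | succ i => rw [totDI_succ I J p i j (by omega), map_map_apply, I.δ_δ,
        TensorProduct.map_zero_left, LinearMap.zero_apply]
  have hLJ : ∀ i j (h : i + j = p + 1), TensorProduct.map LinearMap.id (J.δ j)
      (totDJ I J p ⟨(i, j), h⟩ x) = 0 := by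
    intro i j h
    cases j with
    | zero => rw [totDJ_zero, map_zero]
    | succ j => rw [totDJ_succ I J p i j (by omega), map_map_apply, J.δ_δ,
        TensorProduct.map_zero_right, LinearMap.zero_apply]
  funext ⟨⟨i, j⟩, h⟩
  change _ = (0 : (I.obj i).carrier ⊗[k] (J.obj j).carrier)
  rw [totδ_apply]
  have h0 : i + j = p + 2 := h
  cases i with
  | zero =>
    cases j with
    | zero => omega
    | succ j =>
      rw [totDI_zero, totDJ_succ I J (p + 1) 0 j (by omega), totδ_apply, totDI_zero]
      simp only [map_add, map_smul, map_zero, hLJ 0 j (by omega), smul_zero, add_zero]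
  | succ i =>
    cases j with
    | zero =>
      rw [totDJ_zero, totDI_succ I J (p + 1) i 0 (by omega), totδ_apply, totDJ_zero]
      have := hRI i 0 (by omega)
      simp only [this, smul_zero, add_zero]
    | succ j =>
      rw [totDI_succ I J (p + 1) i (j + 1) (by omega),
        totDJ_succ I J (p + 1) (i + 1) j (by omega), totδ_apply, totδ_apply, map_add, map_add,
        hRI i (j + 1) (by omega), map_smul, map_smul, hLJ (i + 1) j (by omega),
        totDI_succ I J p i j (by omega), totDJ_succ I J p i j (by omega), map_map_apply,
        map_map_apply]
      simp only [LinearMap.id_comp, LinearMap.comp_id, smul_zero, add_zero, zero_add]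
      push_cast
      rw [sgn_add, sgn_one]
      module

variable (s₀ : (I.obj 0).toDGVect →ₗ[k] X.toDGVect)
  (s : ∀ i, (I.obj (i + 1)).toDGVect →ₗ[k] (I.obj i).toDGVect)
  (t : ∀ i, (J.obj (i + 1)).toDGVect →ₗ[k] (J.obj i).toDGVect)

/-- The contraction `s ⊗ 1 + π ⊗ t` of the total complex, where `π` is the projection of `I`
onto the image of the augmentation. -/
def totS (p : ℕ) : ∀ q : TotIdx p,
    (totObj I J (p + 1)).toDGVect →ₗ[k] (biObj I J q.1.1 q.1.2).toDGVect
  | ⟨(0, j), h⟩ =>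
      TensorProduct.map (s 0) LinearMap.id ∘ₗ
        LinearMap.proj (⟨(1, j), by simp only at h ⊢; omega⟩ : TotIdx (p + 1)) +
      TensorProduct.map (I.aug ∘ₗ s₀) (t j) ∘ₗ
        LinearMap.proj (⟨(0, j + 1), by simp only at h ⊢; omega⟩ : TotIdx (p + 1))
  | ⟨(i + 1, j), h⟩ => TensorProduct.map (s (i + 1)) LinearMap.id ∘ₗ
      LinearMap.proj (⟨(i + 2, j), by simp only at h ⊢; omega⟩ : TotIdx (p + 1))

theorem totS_zero (p j : ℕ) (h : (0, j).1 + (0, j).2 = p)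
    (h1 : 1 + j = p + 1) (h2 : 0 + (j + 1) = p + 1)
    (x : (totObj I J (p + 1)).toDGVect) : totS I J s₀ s t p ⟨(0, j), h⟩ x =
      TensorProduct.map (s 0) LinearMap.id (x ⟨(1, j), h1⟩) +
        TensorProduct.map (I.aug ∘ₗ s₀) (t j) (x ⟨(0, j + 1), h2⟩) := rfl

theorem totS_succ (p i j : ℕ) (h : (i + 1, j).1 + (i + 1, j).2 = p) (h1 : i + 2 + j = p + 1)
    (x : (totObj I J (p + 1)).toDGVect) : totS I J s₀ s t p ⟨(i + 1, j), h⟩ x =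
      TensorProduct.map (s (i + 1)) LinearMap.id (x ⟨(i + 2, j), h1⟩) := rfl

/-- The extra summand of the contraction in the column i = 0 has values in the image of the
augmentation, which δ_I kills. -/
theorem δ_totS (p i j : ℕ) (h : i + j = p) (h1 : i + 1 + j = p + 1)
    (x : (totObj I J (p + 1)).toDGVect) :
    TensorProduct.map (I.δ i) LinearMap.id (totS I J s₀ s t p ⟨(i, j), h⟩ x) =
      TensorProduct.map (I.δ i ∘ₗ s i) LinearMap.id (x ⟨(i + 1, j), h1⟩) := by
  cases i with
  | zero =>
    rw [totS_zero I J s₀ s t p j h (by omega) (by omega), map_add, map_map_apply, map_map_apply,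
      ← LinearMap.comp_assoc, I.δ_aug, LinearMap.zero_comp, TensorProduct.map_zero_left,
      LinearMap.zero_apply, add_zero, LinearMap.id_comp]
  | succ i =>
    rw [totS_succ I J s₀ s t p i j h (by omega), map_map_apply, LinearMap.id_comp]

theorem isDGMap_totS (hs₀ : IsDGMap s₀) (hs : ∀ i, IsDGMap (s i)) (ht : ∀ i, IsDGMap (t i))
    (p : ℕ) : IsDGMap (X := (totObj I J (p + 1)).toDGVect) (Y := (totObj I J p).toDGVect)
      (LinearMap.pi (totS I J s₀ s t p)) := by
  refine IsDGMap.pi fun q => ?_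
  obtain ⟨⟨i, j⟩, h⟩ := q
  cases i with
  | zero =>
    refine IsDGMap.add ?_ ?_
    · exact (isDGMap_map (hs 0) (isDGMap_id _)).comp (IsDGMap.proj _ _)
    · exact (isDGMap_map (((rightComodules_isPreadditive A.dual).isDGMap I.aug_hom).comp hs₀)
        (ht j)).comp (IsDGMap.proj _ _)
  | succ i => exact (isDGMap_map (hs _) (isDGMap_id _)).comp (IsDGMap.proj _ _)

variable {s₀ s t} {t₀ : (J.obj 0).toDGVect →ₗ[k] Y.toDGVect}

/-- With π = `I.aug ∘ₗ s₀`, the identity is 1 ⊗ 1 = (1 - π) ⊗ 1 + π ⊗ 1: the contraction of I gives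
the first summand, and the bottom homotopy identity of J gives the second. -/
theorem totS_contract_zero (hI : I.aug ∘ₗ s₀ + s 0 ∘ₗ I.δ 0 = LinearMap.id)
    (hJ : J.aug ∘ₗ t₀ + t 0 ∘ₗ J.δ 0 = LinearMap.id)
    (x : (totObj I J 0).toDGVect) :
    TensorProduct.map (I.aug ∘ₗ s₀) (J.aug ∘ₗ t₀) (x ⟨(0, 0), rfl⟩) +
      totS I J s₀ s t 0 ⟨(0, 0), rfl⟩ (totδ I J 0 x) = x ⟨(0, 0), rfl⟩ := by
  rw [totS_zero I J s₀ s t 0 0 rfl rfl rfl, totδ_apply, totδ_apply, totDI_zero,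
    totDJ_succ I J 0 0 0 rfl, totDI_succ I J 0 0 0 rfl, totDJ_zero]
  simp only [map_add, map_zero, map_map_apply, Nat.cast_zero, sgn_zero, one_smul,
    LinearMap.comp_id, smul_zero]
  have e1 : TensorProduct.map (I.aug ∘ₗ s₀) (J.aug ∘ₗ t₀) +
      TensorProduct.map (I.aug ∘ₗ s₀) (t 0 ∘ₗ J.δ 0) =
      TensorProduct.map (I.aug ∘ₗ s₀) LinearMap.id := by
    rw [← TensorProduct.map_add_right, hJ]
  have e2 : TensorProduct.map (I.aug ∘ₗ s₀) LinearMap.id +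
      TensorProduct.map (s 0 ∘ₗ I.δ 0) (LinearMap.id : (J.obj 0).carrier →ₗ[k] _) =
      LinearMap.id := by
    rw [← TensorProduct.map_add_left, hI, TensorProduct.map_id]
  have := LinearMap.congr_fun e2 (x ⟨(0, 0), rfl⟩)
  rw [← e1] at this
  simp only [LinearMap.add_apply, LinearMap.id_apply] at this
  refine Eq.trans ?_ this
  abel

/-- For i > 0 the contraction of I suffices. For i = 0 it leaves π ⊗ 1, which the contraction of J
supplies. No sign is needed on π ⊗ t, because this term lives in the column i = 0 only. -/
theorem totS_contract_succ (hI₀ : I.aug ∘ₗ s₀ + s 0 ∘ₗ I.δ 0 = LinearMap.id)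
    (hI : ∀ i, I.δ i ∘ₗ s i + s (i + 1) ∘ₗ I.δ (i + 1) = LinearMap.id)
    (hJ : ∀ i, J.δ i ∘ₗ t i + t (i + 1) ∘ₗ J.δ (i + 1) = LinearMap.id)
    (p : ℕ) (x : (totObj I J (p + 1)).toDGVect) (q : TotIdx (p + 1)) :
    totδ I J p (fun q => totS I J s₀ s t p q x) q +
      totS I J s₀ s t (p + 1) q (totδ I J (p + 1) x) = x q := by
  obtain ⟨⟨i, j⟩, h⟩ := q
  have h0 : i + j = p + 1 := h
  cases i with
  | zero =>
    cases j with
    | zero => omega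
    | succ j =>
      rw [totδ_apply, totDI_zero, totDJ_succ I J p 0 j (by omega),
        totS_zero I J s₀ s t p j (by simp; omega) (by omega) (by omega),
        totS_zero I J s₀ s t (p + 1) (j + 1) (by simp; omega) (by omega) (by omega),
        totδ_apply, totδ_apply,
        totDI_succ I J (p + 1) 0 (j + 1) (by omega), totDJ_succ I J (p + 1) 1 j (by omega),
        totDI_zero, totDJ_succ I J (p + 1) 0 (j + 1) (by omega)]
      -- The terms s ⊗ δ_J from the component (1, j) occur twice, with the signs of the columns 0
      -- and 1, and cancel.
      simp only [map_add, map_smul, map_map_apply, LinearMap.id_comp, LinearMap.comp_id,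
        Nat.cast_zero, sgn_zero, one_smul, zero_add, Nat.cast_one, sgn_one]
      have e1 : TensorProduct.map (I.aug ∘ₗ s₀) (J.δ j ∘ₗ t j) +
          TensorProduct.map (I.aug ∘ₗ s₀) (t (j + 1) ∘ₗ J.δ (j + 1)) =
          TensorProduct.map (I.aug ∘ₗ s₀) LinearMap.id := by
        rw [← TensorProduct.map_add_right, hJ]
      have e2 : TensorProduct.map (I.aug ∘ₗ s₀) LinearMap.id +
          TensorProduct.map (s 0 ∘ₗ I.δ 0) (LinearMap.id : (J.obj (j + 1)).carrier →ₗ[k] _) =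
          LinearMap.id := by
        rw [← TensorProduct.map_add_left, hI₀, TensorProduct.map_id]
      have := LinearMap.congr_fun e2 (x ⟨(0, j + 1), h⟩)
      rw [← e1] at this
      simp only [LinearMap.add_apply, LinearMap.id_apply] at this
      refine Eq.trans ?_ this
      module
  | succ i =>
    have e : ∀ m, TensorProduct.map (I.δ i ∘ₗ s i) LinearMap.id +
        TensorProduct.map (s (i + 1) ∘ₗ I.δ (i + 1)) (LinearMap.id : (J.obj m).carrier →ₗ[k] _) =
        LinearMap.id := fun m => by
      rw [← TensorProduct.map_add_left, hI, TensorProduct.map_id]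
    have e' := LinearMap.congr_fun (e j) (x ⟨(i + 1, j), h⟩)
    simp only [LinearMap.add_apply, LinearMap.id_apply] at e'
    rw [totδ_apply, totDI_succ I J p i j (by omega), δ_totS I J s₀ s t p i j (by omega) (by omega),
      totS_succ I J s₀ s t (p + 1) i j (by simp; omega) (by omega), totδ_apply,
      totDI_succ I J (p + 1) (i + 1) j (by omega), map_add, map_map_apply, map_smul]
    cases j with
    | zero =>
      rw [totDJ_zero, totDJ_zero]
      simpa only [smul_zero, add_zero, map_zero, LinearMap.id_comp] using e'
    | succ j =>
      rw [totDJ_succ I J p (i + 1) j (by omega), totDJ_succ I J (p + 1) (i + 2) j (by omega),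
        totS_succ I J s₀ s t p i j (by simp; omega) (by omega), map_map_apply, map_map_apply]
      simp only [LinearMap.id_comp, LinearMap.comp_id]
      refine Eq.trans ?_ e'
      push_cast
      rw [show (i : ℤ) + 2 = (i + 1) + 1 by ring]
      simp only [sgn_add, sgn_one]
      module

end Total

/-! ### Tot(I ⊗ J) as a split resolution of M ⊗ N. -/

section TotalResolution
variable {k : Type u} [Field k] {A : DGAlgebra k} [A.FiniteType]
  {M : DGLeftModule A} {N : DGRightModule A} {hM : M.BoundedAbove} {hN : N.BoundedAbove}

/-- The total complex of the tensor product of resolutions of `M` and `N`, as a split resolution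
of `M ⊗ N`. -/
abbrev totRes (I : SplitRes (rightComodules A.dual) (M.toComodule hM))
    (J : SplitRes (leftComodules A.dual) (N.toComodule hN)) :
    SplitRes (bimodules A) (M.tensor N) where
  obj := totObj I J
  -- The only pair with sum 0 is (0, 0); the other branches are vacuous, and 0 is a default value.
  aug := LinearMap.pi fun q => match q with
    | ⟨(0, 0), _⟩ => TensorProduct.map I.aug J.aug
    | ⟨(_ + 1, _), _⟩ => 0
    | ⟨(0, _ + 1), _⟩ => 0
  δ := totδ I J
  aug_hom := by
    refine DGBimodule.IsHom.pi fun q => ?_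
    obtain ⟨⟨i, j⟩, h⟩ := q
    have h0 : i + j = 0 := h
    obtain rfl : i = 0 := by omega
    obtain rfl : j = 0 := by omega
    have hI : DGRightComodule.IsHom (M := M.toComodule hM) (M' := I.obj 0) I.aug := I.aug_hom
    have hJ : DGLeftComodule.IsHom (M := N.toComodule hN) (M' := J.obj 0) J.aug := J.aug_hom
    exact isHom_map (M' := (I.obj 0).toModule) (N' := (J.obj 0).toModule)
      hI.toIsDGMap hJ.toIsDGMap
      -- The action of A on M is first replaced by the one recovered from the coaction, for which
      -- `I.aug` is linear.
      (fun a m => (congrArg I.aug (M.toComodule_action hM a m).symm).trans (hI.map_action a m))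
      (fun a m => (congrArg J.aug (N.toComodule_action hN a m).symm).trans (hJ.map_action a m))
  δ_hom := totδ_hom I J
  δ_aug := by
    refine LinearMap.ext fun x => ?_
    funext ⟨⟨i, j⟩, h⟩
    change _ = (0 : (I.obj i).carrier ⊗[k] (J.obj j).carrier)
    have h0 : i + j = 1 := h
    rw [LinearMap.comp_apply, totδ_apply]
    cases i with
    | zero =>
      obtain rfl : j = 1 := by omega
      rw [totDI_zero, totDJ_succ I J 0 0 0 rfl]
      change 0 + _ • TensorProduct.map LinearMap.id (J.δ 0) (TensorProduct.map I.aug J.aug x) = _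
      rw [map_map_apply, J.δ_aug, TensorProduct.map_zero_right]
      simp
    | succ i =>
      obtain rfl : i = 0 := by omega
      obtain rfl : j = 0 := by omega
      rw [totDJ_zero, totDI_succ I J 0 0 0 rfl]
      change TensorProduct.map (I.δ 0) LinearMap.id (TensorProduct.map I.aug J.aug x) + _ = _
      rw [map_map_apply, I.δ_aug, TensorProduct.map_zero_left]
      simp
  δ_δ p := LinearMap.ext fun x => totδ_totδ I J p x
  split := by
    obtain ⟨s₀, s, hs₀, hs, hs1, hs2, hs3⟩ := I.split
    obtain ⟨t₀, t, ht₀, ht, ht1, ht2, ht3⟩ := J.split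
    -- The retraction of the augmentation uses the single component (0, 0).
    refine ⟨TensorProduct.map s₀ t₀ ∘ₗ LinearMap.proj (⟨(0, 0), rfl⟩ : TotIdx 0),
      fun p => LinearMap.pi (totS I J s₀ s t p), ?_, fun p => isDGMap_totS I J s₀ s t hs₀ hs ht p,
      ?_, ?_, fun p => LinearMap.ext fun x => funext fun q =>
        totS_contract_succ I J hs2 hs3 ht3 p x q⟩
    · exact (isDGMap_map hs₀ ht₀).comp (IsDGMap.proj _ _)
    · refine LinearMap.ext fun x => ?_
      refine (map_map_apply s₀ t₀ I.aug J.aug x).trans ?_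
      rw [hs1, ht1, TensorProduct.map_id]
    · refine LinearMap.ext fun x => ?_
      funext ⟨⟨i, j⟩, h⟩
      have h0 : i + j = 0 := h
      obtain rfl : i = 0 := by omega
      obtain rfl : j = 0 := by omega
      refine Eq.trans ?_ (totS_contract_zero I J hs2 ht2 x)
      exact congrArg (fun y => y + totS I J s₀ s t 0 ⟨(0, 0), rfl⟩ (totδ I J 0 x))
        (map_map_apply I.aug J.aug s₀ t₀ _)

end TotalResolution

/-! ### Bimodule maps out of `A` and central elements -/

section Orbit
variable {k : Type u} [Field k] {A : DGAlgebra k}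

/-- The map `t ↦ (a ↦ t a)`. -/
def DGBimodule.orbit (B : DGBimodule A) : B.carrier →ₗ[k] A.carrier →ₗ[k] B.carrier :=
  (B.ract.toLinearMap ∘ₗ (MulOpposite.opLinearEquiv k).toLinearMap).flip

theorem DGBimodule.orbit_apply (B : DGBimodule A) (t : B.carrier) (a : A) :
    B.orbit t a = B.ract (.op a) t := rfl

theorem DGBimodule.orbit_one (B : DGBimodule A) (t : B.carrier) : B.orbit t 1 = t := by
  rw [B.orbit_apply, MulOpposite.op_one, map_one, Module.End.one_apply]

/-- The central elements of degree `n`. -/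
def DGBimodule.IsCentral (B : DGBimodule A) (n : ℤ) (t : B.carrier) : Prop :=
  t ∈ B.gr n ∧ ∀ i, ∀ a ∈ A.gr i, B.ract (.op a) t = sgn k (n * i) • B.lact a t

/-- Right linearity of a ↦ t a is associativity; left linearity with its sign is centrality of `t`.
-/
theorem orbit_mem_bimoduleHom {B : DGBimodule A} {n : ℤ} {t : B.carrier} (ht : B.IsCentral n t) :
    B.orbit t ∈ bimoduleHom B n := by
  refine ⟨fun i a ha => ?_, fun i a ha b => ?_, fun a b => ?_⟩
  · rw [add_comm]
    exact B.ract_mem ha ht.1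
  · rw [B.orbit_apply, B.orbit_apply, MulOpposite.op_mul, map_mul, Module.End.mul_apply,
      ht.2 i a ha, map_smul, B.lact_ract]
  · rw [B.orbit_apply, B.orbit_apply, MulOpposite.op_mul, map_mul, Module.End.mul_apply]

/-- By the Leibniz rule, d(t a) - (-1)^n t d(a) = (d t) a. Hence the differential of Hom(A, B)
restricts to that of B on central elements. -/
theorem homD_orbit (B : DGBimodule A) {n : ℤ} {t : B.carrier} (ht : t ∈ B.gr n) :
    homD B n (B.orbit t) = B.orbit (B.d t) := by
  ext a
  rw [homD_apply, B.orbit_apply, B.orbit_apply, B.orbit_apply, B.leibniz_right a ht,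
    add_sub_cancel_right]

theorem comp_orbit {B B' : DGBimodule A} {h : B.toDGVect →ₗ[k] B'.toDGVect}
    (hh : DGBimodule.IsHom h) (t : B.carrier) : h ∘ₗ B.orbit t = B'.orbit (h t) :=
  LinearMap.ext fun a => hh.map_ract a t

theorem DGBimodule.IsCentral.map {B B' : DGBimodule A} {h : B.toDGVect →ₗ[k] B'.toDGVect}
    (hh : DGBimodule.IsHom h) {n : ℤ} {t : B.carrier} (ht : B.IsCentral n t) :
    B'.IsCentral n (h t) :=
  ⟨hh.map_mem ht.1, fun i a ha => by rw [← hh.map_ract, ht.2 i a ha, map_smul, hh.map_lact]⟩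

/-- Comparing f(1·a) with f(a·1) gives f(1) a = f(a) = (-1)^(n|a|) a f(1). With
`orbit_mem_bimoduleHom` this identifies Hom^n_{A^e}(A, B) with the central elements of degree n. -/
theorem isCentral_of_mem_bimoduleHom {B : DGBimodule A} {n : ℤ}
    {f : A.carrier →ₗ[k] B.carrier} (hf : f ∈ bimoduleHom B n) :
    B.IsCentral n (f 1) ∧ B.orbit (f 1) = f := by
  have h : ∀ a, B.ract (.op a) (f 1) = f a := fun a => by rw [← hf.2.2, one_mul]
  refine ⟨⟨?_, fun i a ha => ?_⟩, LinearMap.ext h⟩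
  · have := hf.1 0 1 SetLike.GradedOne.one_mem
    rwa [zero_add] at this
  · rw [h, ← hf.2.1 i a ha, mul_one]

end Orbit

/-! ### Composition of lifts -/

section LiftComp
variable {k : Type u} [Field k] {T : DGCat k} {X X' X'' : T.Obj}

/-- The identity lift. -/
abbrev SplitRes.Lift.id (hT : T.IsPreadditive) (R : SplitRes T X) :
    SplitRes.Lift (X := X) (X' := X) LinearMap.id R R where
  map _ := LinearMap.id
  map_hom _ := hT.id _
  map_aug := rfl
  map_δ _ := rfl

/-- The composition of lifts. -/
abbrev SplitRes.Lift.comp (hT : T.IsPreadditive) {f : T.U X →ₗ[k] T.U X'}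
    {g : T.U X' →ₗ[k] T.U X''} {h : T.U X →ₗ[k] T.U X''} {R : SplitRes T X} {S : SplitRes T X'}
    {Q : SplitRes T X''} (ψ : SplitRes.Lift g S Q) (φ : SplitRes.Lift f R S) (e : g ∘ₗ f = h) :
    SplitRes.Lift h R Q where
  map i := ψ.map i ∘ₗ φ.map i
  map_hom i := hT.comp (ψ.map_hom i) (φ.map_hom i)
  map_aug := by
    rw [LinearMap.comp_assoc, φ.map_aug, ← LinearMap.comp_assoc, ψ.map_aug, LinearMap.comp_assoc, e]
  map_δ i := by
    rw [LinearMap.comp_assoc, φ.map_δ, ← LinearMap.comp_assoc, ψ.map_δ, LinearMap.comp_assoc]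

/-- A lift between the underlying split resolutions is a lift of injective resolutions. -/
abbrev SplitRes.Lift.toInjRes {f : T.U X →ₗ[k] T.U X'} {I : InjRes T X} {I' : InjRes T X'}
    (φ : SplitRes.Lift f I.toSplitRes I'.toSplitRes) : InjRes.Lift f I I' where
  map := φ.map
  map_hom := φ.map_hom
  map_aug := φ.map_aug
  map_δ := φ.map_δ

theorem InjRes.exists_lift (hT : T.IsPreadditive) (hE : T.HasExtensions)
    {f : T.U X →ₗ[k] T.U X'} (hf : T.IsHom f) (I : InjRes T X) (I' : InjRes T X') :
    Nonempty (InjRes.Lift f I I') :=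
  (SplitRes.exists_lift hT hE hf I.toSplitRes I'.toSplitRes I'.injective).map
    SplitRes.Lift.toInjRes

end LiftComp

/-! ### Independence of DG Hochschild cohomology of the resolution -/

section HochInvariance
open CategoryTheory
variable {k : Type u} [Field k] {A : DGAlgebra k} {B B' : DGBimodule A}
  {f : B.toDGVect →ₗ[k] B'.toDGVect}

/-- Two lifts of the same map are homotopic, and composition with the homotopy is a homotopy of
total complexes. -/
theorem HDG.map_eq {E : InjRes (bimodules A) B} {E' : InjRes (bimodules A) B'}
    (θ θ' : InjRes.Lift (T := bimodules A) f E E') (n : ℤ) : HDG.map θ n = HDG.map θ' n := by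
  obtain ⟨H⟩ := SplitRes.exists_htpy (bimodules_isPreadditive A) (bimodules_hasExtensions A)
    (R := E.toSplitRes) (S := E'.toSplitRes) E'.injective θ.toSplitRes θ'.toSplitRes
  refine subComplexMap_homology_eq
    -- No sign is needed: the internal differential enters with (-1)^p, so the shift of p by one
    -- makes its two contributions cancel.
    (LinearMap.pi fun p => LinearMap.compRight k (H.map p) ∘ₗ LinearMap.proj (p + 1)) ?_ ?_ n
  · intro n x hx p
    have := comp_mem_bimoduleHom (H.map_hom p) (hx (p + 1))
    rwa [show n + 1 - ((p + 1 : ℕ) : ℤ) = n - (p : ℤ) by push_cast; ring] at this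
  · intro n x hx
    funext p
    have e : n + 1 - ((p + 1 : ℕ) : ℤ) = n - (p : ℤ) := by push_cast; ring
    change θ.map p ∘ₗ x p - θ'.map p ∘ₗ x p = (hochDE E' p _ + sgn k p •
      homD (E'.obj p) (n - p) (H.map p ∘ₗ x (p + 1))) + H.map p ∘ₗ (E.δ p ∘ₗ x p +
        sgn k ((p + 1 : ℕ) : ℤ) • homD (E.obj (p + 1)) (n + 1 - ((p + 1 : ℕ) : ℤ)) (x (p + 1)))
    rw [homD_comp (DGBimodule.IsHom.toIsDGMap (H.map_hom p)), e, ← LinearMap.sub_comp,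
      LinearMap.comp_add, LinearMap.comp_smul]
    push_cast
    rw [sgn_add, sgn_one]
    cases p with
    | zero =>
      rw [H.zero]
      change _ = (0 + _) + _
      rw [LinearMap.comp_assoc]
      module
    | succ p =>
      rw [H.succ]
      change _ = (E'.δ p ∘ₗ H.map p ∘ₗ x (p + 1) + _) + _
      rw [LinearMap.add_comp, LinearMap.comp_assoc, LinearMap.comp_assoc]
      module

theorem HDG.map_comp {B'' : DGBimodule A} {g : B'.toDGVect →ₗ[k] B''.toDGVect}
    {h : B.toDGVect →ₗ[k] B''.toDGVect} {E : InjRes (bimodules A) B} {E' : InjRes (bimodules A) B'}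
    {E'' : InjRes (bimodules A) B''} (θ : InjRes.Lift (T := bimodules A) f E E')
    (θ' : InjRes.Lift (T := bimodules A) g E' E'') (e : g ∘ₗ f = h) (n : ℤ) :
    HDG.map θ n ≫ HDG.map θ' n = HDG.map (f := h)
      (SplitRes.Lift.comp (bimodules_isPreadditive A) θ'.toSplitRes θ.toSplitRes e).toInjRes n := by
  refine (HomologicalComplex.homologyMap_comp _ _ _).symm.trans ?_
  exact congrArg (fun u => HomologicalComplex.homologyMap u n)
    (subComplexMap_comp fun n x _ => rfl)

theorem HDG.map_id {E : InjRes (bimodules A) B} (n : ℤ) :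
    HDG.map (f := LinearMap.id)
      (SplitRes.Lift.id (bimodules_isPreadditive A) E.toSplitRes).toInjRes n = 𝟙 (HDG E n) := by
  refine Eq.trans ?_ (HomologicalComplex.homologyMap_id _ _)
  refine congrArg (fun u => HomologicalComplex.homologyMap u n) ?_
  exact subComplexMap_id fun n x _ => rfl

/-- A lift of the identity in the opposite direction induces the inverse: both composites lift the
identity, and so does the identity map of either resolution. -/
theorem HDG.isIso_map {E E' : InjRes (bimodules A) B}
    (θ : InjRes.Lift (T := bimodules A) (X := B) (X' := B) LinearMap.id E E') (n : ℤ) :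
    IsIso (HDG.map (f := LinearMap.id) θ n) := by
  obtain ⟨θ'⟩ := InjRes.exists_lift (bimodules_isPreadditive A) (bimodules_hasExtensions A)
    ((bimodules_isPreadditive A).id B) E' E
  refine ⟨HDG.map (f := LinearMap.id) θ' n, ?_, ?_⟩
  · rw [HDG.map_comp θ θ' (LinearMap.id_comp _), ← HDG.map_id]
    exact HDG.map_eq _ _ n
  · rw [HDG.map_comp θ' θ (LinearMap.id_comp _), ← HDG.map_id]
    exact HDG.map_eq _ _ n

end HochInvariance

/-! ### Independence of Cotor of the resolutions -/

section CotorInvariance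
open CategoryTheory
variable {k : Type u} [Field k] {C : DGCoalgebra k}
  {X X' : DGRightComodule C} {Y Y' : DGLeftComodule C}
  {f : X.toDGVect →ₗ[k] X'.toDGVect} {g : Y.toDGVect →ₗ[k] Y'.toDGVect}
  {I : InjRes (rightComodules C) X} {J : InjRes (leftComodules C) Y}
  {I' : InjRes (rightComodules C) X'} {J' : InjRes (leftComodules C) Y'}

theorem map_sub_left {V V' W W' : Type u} [AddCommGroup V] [AddCommGroup V'] [AddCommGroup W]
    [AddCommGroup W'] [Module k V] [Module k V'] [Module k W] [Module k W'] (u v : V →ₗ[k] V')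
    (w : W →ₗ[k] W') :
    TensorProduct.map (u - v) w = TensorProduct.map u w - TensorProduct.map v w :=
  TensorProduct.ext' fun x y => by simp [TensorProduct.sub_tmul]

theorem map_sub_right {V V' W W' : Type u} [AddCommGroup V] [AddCommGroup V'] [AddCommGroup W]
    [AddCommGroup W'] [Module k V] [Module k V'] [Module k W] [Module k W'] (u : V →ₗ[k] V')
    (v w : W →ₗ[k] W') :
    TensorProduct.map u (v - w) = TensorProduct.map u v - TensorProduct.map u w :=
  TensorProduct.ext' fun x y => by simp [TensorProduct.tmul_sub]

theorem cotorDI_zero (x : CotorAmbient I J) (j : ℕ) : cotorDI I J 0 j x = 0 := rfl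

theorem cotorDI_succ (x : CotorAmbient I J) (i j : ℕ) : cotorDI I J (i + 1) j x =
    TensorProduct.map (I.δ i) LinearMap.id (x i j) := rfl

theorem cotorDJ_zero (x : CotorAmbient I J) (i : ℕ) : cotorDJ I J i 0 x = 0 := by
  cases i <;> rfl

theorem cotorDJ_succ (x : CotorAmbient I J) (i j : ℕ) : cotorDJ I J i (j + 1) x =
    TensorProduct.map LinearMap.id (J.δ j) (x i j) := by
  cases i <;> rfl

/-- The homotopy is H ⊗ ψ with H a homotopy between φ and φ'. It shifts i by one, so the terms of
δ_J and of the internal differential, which carry (-1)^i and (-1)^(i+j), cancel. -/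
theorem Cotor.map_eq_left (φ φ' : InjRes.Lift (T := rightComodules C) f I I')
    (ψ : InjRes.Lift (T := leftComodules C) g J J') (n : ℤ) :
    Cotor.map φ ψ n = Cotor.map φ' ψ n := by
  obtain ⟨H⟩ := SplitRes.exists_htpy (rightComodules_isPreadditive C)
    ((rightCofree C).hasExtensions (rightComodules_isPreadditive C))
    (R := I.toSplitRes) (S := I'.toSplitRes) I'.injective φ.toSplitRes φ'.toSplitRes
  have hH : ∀ i, DGRightComodule.IsHom (M := I.obj (i + 1)) (M' := I'.obj i) (H.map i) := H.map_hom
  let K : CotorAmbient I J →ₗ[k] CotorAmbient I' J' := LinearMap.pi fun i => LinearMap.pi fun j =>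
    TensorProduct.map (H.map i) (ψ.map j) ∘ₗ LinearMap.proj j ∘ₗ LinearMap.proj (i + 1)
  have hK : ∀ x i j, K x i j = TensorProduct.map (H.map i) (ψ.map j) (x (i + 1) j) :=
    fun x i j => rfl
  refine subComplexMap_homology_eq K ?_ ?_ (-n)
  · intro n x hx i j
    refine ⟨map_mem_cotensor (hH i) (ψ.map_hom j) (hx (i + 1) j).1, ?_⟩
    have := (isDGMap_map (hH i).toIsDGMap (ψ.map_hom j).toIsDGMap).map_mem (hx (i + 1) j).2
    rw [show n + 1 - ((i + 1 : ℕ) : ℤ) - (j : ℤ) = n - i - j by push_cast; ring] at this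
    exact this
  · intro n x _
    funext i j
    have hA : cotorDI I' J' i j (K x) +
        TensorProduct.map (H.map i) (ψ.map j) (cotorDI I J (i + 1) j x) =
          TensorProduct.map (φ.map i) (ψ.map j) (x i j) -
            TensorProduct.map (φ'.map i) (ψ.map j) (x i j) := by
      rw [cotorDI_succ, map_map_apply, LinearMap.comp_id, ← LinearMap.sub_apply,
        ← map_sub_left]
      cases i with
      | zero =>
        refine Eq.trans ?_ (congrArg (fun u => TensorProduct.map u (ψ.map j) (x 0 j)) H.zero.symm)
        rw [cotorDI_zero, zero_add]
      | succ i =>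
        refine Eq.trans ?_
          (congrArg (fun u => TensorProduct.map u (ψ.map j) (x (i + 1) j)) (H.succ i).symm)
        rw [cotorDI_succ, hK, map_map_apply, LinearMap.id_comp, TensorProduct.map_add_left,
          LinearMap.add_apply]
    have hB : cotorDJ I' J' i j (K x) =
        TensorProduct.map (H.map i) (ψ.map j) (cotorDJ I J (i + 1) j x) := by
      cases j with
      | zero => rw [cotorDJ_zero, cotorDJ_zero, map_zero]
      | succ j =>
        rw [cotorDJ_succ, cotorDJ_succ, hK, map_map_apply, map_map_apply, LinearMap.id_comp,
          LinearMap.comp_id]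
        exact congrArg (fun u => TensorProduct.map (H.map i) u (x (i + 1) j)) (ψ.map_δ j).symm
    have hC : DGVect.tensorD (I'.obj i).toDGVect (J'.obj j).toDGVect (K x i j) =
        TensorProduct.map (H.map i) (ψ.map j)
          (DGVect.tensorD (I.obj (i + 1)).toDGVect (J.obj j).toDGVect (x (i + 1) j)) :=
      ((isDGMap_map (hH i).toIsDGMap (ψ.map_hom j).toIsDGMap).map_d _).symm
    change TensorProduct.map (φ.map i) (ψ.map j) (x i j) -
        TensorProduct.map (φ'.map i) (ψ.map j) (x i j) =
      cotorD I' J' (K x) i j + TensorProduct.map (H.map i) (ψ.map j) (cotorD I J x (i + 1) j)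
    rw [cotorD_apply, cotorD_apply, hB, hC, ← hA]
    simp only [map_add, map_smul]
    push_cast
    simp only [sgn_add, sgn_one]
    module

/-- Here the homotopy is (-1)^i φ ⊗ H. The sign compensates that of δ_J and makes the homotopy
anticommute with δ_I. -/
theorem Cotor.map_eq_right (φ : InjRes.Lift (T := rightComodules C) f I I')
    (ψ ψ' : InjRes.Lift (T := leftComodules C) g J J') (n : ℤ) :
    Cotor.map φ ψ n = Cotor.map φ ψ' n := by
  obtain ⟨H⟩ := SplitRes.exists_htpy (leftComodules_isPreadditive C)
    ((leftCofree C).hasExtensions (leftComodules_isPreadditive C))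
    (R := J.toSplitRes) (S := J'.toSplitRes) J'.injective ψ.toSplitRes ψ'.toSplitRes
  have hH : ∀ j, DGLeftComodule.IsHom (M := J.obj (j + 1)) (M' := J'.obj j) (H.map j) := H.map_hom
  let K : CotorAmbient I J →ₗ[k] CotorAmbient I' J' := LinearMap.pi fun i => LinearMap.pi fun j =>
    sgn k i • TensorProduct.map (φ.map i) (H.map j) ∘ₗ LinearMap.proj (j + 1) ∘ₗ LinearMap.proj i
  have hK : ∀ x i j, K x i j = sgn k i • TensorProduct.map (φ.map i) (H.map j) (x i (j + 1)) :=
    fun x i j => rfl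
  refine subComplexMap_homology_eq K ?_ ?_ (-n)
  · intro n x hx i j
    refine Submodule.smul_mem _ _
      ⟨map_mem_cotensor (φ.map_hom i) (hH j) (hx i (j + 1)).1, ?_⟩
    have := (isDGMap_map (φ.map_hom i).toIsDGMap (hH j).toIsDGMap).map_mem (hx i (j + 1)).2
    rw [show n + 1 - (i : ℤ) - ((j + 1 : ℕ) : ℤ) = n - i - j by push_cast; ring] at this
    exact this
  · intro n x _
    funext i j
    have hA : sgn k i • cotorDJ I' J' i j (K x) +
        TensorProduct.map (φ.map i) (H.map j) (cotorDJ I J i (j + 1) x) =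
          TensorProduct.map (φ.map i) (ψ.map j) (x i j) -
            TensorProduct.map (φ.map i) (ψ'.map j) (x i j) := by
      rw [cotorDJ_succ, map_map_apply, LinearMap.comp_id, ← LinearMap.sub_apply,
        ← map_sub_right]
      cases j with
      | zero =>
        refine Eq.trans ?_ (congrArg (fun u => TensorProduct.map (φ.map i) u (x i 0)) H.zero.symm)
        rw [cotorDJ_zero, smul_zero, zero_add]
      | succ j =>
        refine Eq.trans ?_
          (congrArg (fun u => TensorProduct.map (φ.map i) u (x i (j + 1))) (H.succ j).symm)
        rw [cotorDJ_succ, hK, map_smul, smul_smul, sgn_mul_self, one_smul, map_map_apply,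
          LinearMap.id_comp, TensorProduct.map_add_right, LinearMap.add_apply]
    have hB : cotorDI I' J' i j (K x) =
        -(sgn k i • TensorProduct.map (φ.map i) (H.map j) (cotorDI I J i (j + 1) x)) := by
      cases i with
      | zero => rw [cotorDI_zero, cotorDI_zero, map_zero, smul_zero, neg_zero]
      | succ i =>
        rw [cotorDI_succ, cotorDI_succ, hK, map_smul, map_map_apply, map_map_apply,
          LinearMap.id_comp, LinearMap.comp_id, φ.map_δ i]
        push_cast
        rw [sgn_add, sgn_one]
        module
    have hC : DGVect.tensorD (I'.obj i).toDGVect (J'.obj j).toDGVect (K x i j) =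
        sgn k i • TensorProduct.map (φ.map i) (H.map j)
          (DGVect.tensorD (I.obj i).toDGVect (J.obj (j + 1)).toDGVect (x i (j + 1))) := by
      rw [hK, map_smul]
      congr 1
      exact ((isDGMap_map (φ.map_hom i).toIsDGMap (hH j).toIsDGMap).map_d _).symm
    change TensorProduct.map (φ.map i) (ψ.map j) (x i j) -
        TensorProduct.map (φ.map i) (ψ'.map j) (x i j) =
      cotorD I' J' (K x) i j +
        sgn k i • TensorProduct.map (φ.map i) (H.map j) (cotorD I J x i (j + 1))
    rw [cotorD_apply, cotorD_apply, hB, hC, ← hA]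
    simp only [map_add, map_smul, smul_add, smul_smul, sgn_mul_self]
    have e : sgn k (i : ℤ) * sgn k j * sgn k i = sgn k j := by
      rw [mul_comm, ← mul_assoc, sgn_mul_self, one_mul]
    push_cast
    simp only [sgn_add, sgn_one, ← mul_assoc, mul_neg, sgn_mul_self, e, one_mul]
    module

theorem Cotor.map_comp {X'' : DGRightComodule C} {Y'' : DGLeftComodule C}
    {f' : X'.toDGVect →ₗ[k] X''.toDGVect} {g' : Y'.toDGVect →ₗ[k] Y''.toDGVect}
    {f'' : X.toDGVect →ₗ[k] X''.toDGVect} {g'' : Y.toDGVect →ₗ[k] Y''.toDGVect}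
    {I'' : InjRes (rightComodules C) X''} {J'' : InjRes (leftComodules C) Y''}
    (φ : InjRes.Lift (T := rightComodules C) f I I')
    (ψ : InjRes.Lift (T := leftComodules C) g J J')
    (φ' : InjRes.Lift (T := rightComodules C) f' I' I'')
    (ψ' : InjRes.Lift (T := leftComodules C) g' J' J'') (ef : f' ∘ₗ f = f'') (eg : g' ∘ₗ g = g'')
    (n : ℤ) :
    Cotor.map φ ψ n ≫ Cotor.map φ' ψ' n = Cotor.map (f := f'') (g := g'')
      (SplitRes.Lift.comp (rightComodules_isPreadditive C) φ'.toSplitRes φ.toSplitRes ef).toInjRes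
      (SplitRes.Lift.comp (leftComodules_isPreadditive C) ψ'.toSplitRes ψ.toSplitRes eg).toInjRes
      n := by
  refine (HomologicalComplex.homologyMap_comp _ _ _).symm.trans ?_
  exact congrArg (fun u => HomologicalComplex.homologyMap u (-n)) (subComplexMap_comp
    fun n x _ => funext fun i => funext fun j => map_map_apply _ _ _ _ _)

theorem Cotor.map_id (n : ℤ) :
    Cotor.map (f := LinearMap.id) (g := LinearMap.id)
      (SplitRes.Lift.id (rightComodules_isPreadditive C) I.toSplitRes).toInjRes
      (SplitRes.Lift.id (leftComodules_isPreadditive C) J.toSplitRes).toInjRes n =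
        𝟙 (Cotor I J n) := by
  refine Eq.trans ?_ (HomologicalComplex.homologyMap_id _ _)
  refine congrArg (fun u => HomologicalComplex.homologyMap u (-n)) ?_
  refine subComplexMap_id fun n x _ => funext fun i => funext fun j => ?_
  exact LinearMap.congr_fun TensorProduct.map_id (x i j)

theorem Cotor.isIso_map {I I' : InjRes (rightComodules C) X} {J J' : InjRes (leftComodules C) Y}
    (φ : InjRes.Lift (T := rightComodules C) (X := X) (X' := X) LinearMap.id I I')
    (ψ : InjRes.Lift (T := leftComodules C) (X := Y) (X' := Y) LinearMap.id J J') (n : ℤ) :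
    IsIso (Cotor.map (f := LinearMap.id) (g := LinearMap.id) φ ψ n) := by
  obtain ⟨φ'⟩ := InjRes.exists_lift (rightComodules_isPreadditive C)
    ((rightCofree C).hasExtensions (rightComodules_isPreadditive C))
    ((rightComodules_isPreadditive C).id X) I' I
  obtain ⟨ψ'⟩ := InjRes.exists_lift (leftComodules_isPreadditive C)
    ((leftCofree C).hasExtensions (leftComodules_isPreadditive C))
    ((leftComodules_isPreadditive C).id Y) J' J
  refine ⟨Cotor.map (f := LinearMap.id) (g := LinearMap.id) φ' ψ' n, ?_, ?_⟩
  · rw [Cotor.map_comp φ ψ φ' ψ' (LinearMap.id_comp _) (LinearMap.id_comp _), ← Cotor.map_id]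
    -- The composite lift is replaced by the identity in one variable at a time.
    exact (Cotor.map_eq_left _ _ _ n).trans (Cotor.map_eq_right _ _ _ n)
  · rw [Cotor.map_comp φ' ψ' φ ψ (LinearMap.id_comp _) (LinearMap.id_comp _), ← Cotor.map_id]
    exact (Cotor.map_eq_left _ _ _ n).trans (Cotor.map_eq_right _ _ _ n)

end CotorInvariance

/-! ### The comparison map -/

section Comparison
open CategoryTheory
variable {k : Type u} [Field k] {A : DGAlgebra k} [A.FiniteType]

section Restrict
variable {X : DGRightComodule A.dual} {Y : DGLeftComodule A.dual}
  (I : InjRes (rightComodules A.dual) X) (J : InjRes (leftComodules A.dual) Y)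

/-- The components on which `i + j = p`. -/
def totRestrict (p : ℕ) : CotorAmbient I J →ₗ[k]
    (totObj I.toSplitRes J.toSplitRes p).toDGVect :=
  LinearMap.pi fun q => LinearMap.proj q.1.2 ∘ₗ LinearMap.proj q.1.1

theorem totRestrict_apply (p : ℕ) (x : CotorAmbient I J) (q : TotIdx p) :
    totRestrict I J p x q = x q.1.1 q.1.2 := rfl

/-- This is `mem_cotensor_iff` in the language of bimodules, the bridge between the two complexes.
-/
theorem isCentral_iff {n : ℤ} {i j : ℕ}
    {t : (biObj I.toSplitRes J.toSplitRes i j).carrier} :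
    (biObj I.toSplitRes J.toSplitRes i j).IsCentral n t ↔
      t ∈ cotensor (I.obj i) (J.obj j) ⊓
        DGVect.tensorGr (I.obj i).toDGVect (J.obj j).toDGVect n :=
  ⟨fun h => ⟨(mem_cotensor_iff h.1).mpr h.2, h.1⟩,
    fun h => ⟨h.2, (mem_cotensor_iff h.2).mp h.1⟩⟩

theorem isCentral_totRestrict {n : ℤ} {x : CotorAmbient I J} (hx : x ∈ cotorDeg I J n) (p : ℕ) :
    (totObj I.toSplitRes J.toSplitRes p).IsCentral (n - p) (totRestrict I J p x) := by
  have h : ∀ q : TotIdx p,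
      (biObj I.toSplitRes J.toSplitRes q.1.1 q.1.2).IsCentral (n - p) (x q.1.1 q.1.2) := by
    rintro ⟨⟨i, j⟩, h⟩
    have e : n - (i : ℤ) - j = n - p := by
      rw [sub_sub, ← Nat.cast_add]
      exact congrArg (fun m : ℕ => n - (m : ℤ)) h
    refine (isCentral_iff I J).mpr ?_
    rw [← e]
    exact hx i j
  exact ⟨fun q _ => (h q).1, fun i a ha => funext fun q => (h q).2 i a ha⟩

theorem totRestrict_zero_cotorD (x : CotorAmbient I J) :
    totRestrict I J 0 (cotorD I J x) =
      (totObj I.toSplitRes J.toSplitRes 0).d (totRestrict I J 0 x) := by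
  funext ⟨⟨i, j⟩, h⟩
  have h0 : i + j = 0 := h
  obtain rfl : i = 0 := by omega
  obtain rfl : j = 0 := by omega
  rw [totRestrict_apply, cotorD_apply, cotorDI_zero, cotorDJ_zero, smul_zero, zero_add, zero_add,
    Nat.cast_zero, add_zero, sgn_zero, one_smul]
  rfl

/-- Grouping the triple complex by p = i + j leaves the double complex with differentials δ_I +
(-1)^i δ_J and (-1)^p d, which is the sign pattern of the Hochschild total complex. -/
theorem totRestrict_succ_cotorD (x : CotorAmbient I J) (p : ℕ) :
    totRestrict I J (p + 1) (cotorD I J x) =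
      totδ I.toSplitRes J.toSplitRes p (totRestrict I J p x) + sgn k ((p + 1 : ℕ) : ℤ) •
        (totObj I.toSplitRes J.toSplitRes (p + 1)).d (totRestrict I J (p + 1) x) := by
  funext ⟨⟨i, j⟩, h⟩
  have h0 : i + j = p + 1 := h
  have e1 : cotorDI I J i j x =
      totDI I.toSplitRes J.toSplitRes p ⟨(i, j), h⟩ (totRestrict I J p x) := by
    cases i with
    | zero => rfl
    | succ i => rw [totDI_succ _ _ p i j (by omega)]; rfl
  have e2 : cotorDJ I J i j x =
      totDJ I.toSplitRes J.toSplitRes p ⟨(i, j), h⟩ (totRestrict I J p x) := by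
    cases j with
    | zero => rw [cotorDJ_zero, totDJ_zero]
    | succ j => rw [cotorDJ_succ, totDJ_succ _ _ p i j (by omega)]; rfl
  have e3 : (i : ℤ) + j = ((p + 1 : ℕ) : ℤ) := by
    rw [← Nat.cast_add, h0]
  rw [totRestrict_apply, cotorD_apply, e1, e2, e3]
  rfl

end Restrict

variable {M M' : DGLeftModule A} {N N' : DGRightModule A} {hM : M.BoundedAbove}
  {hN : N.BoundedAbove} {hM' : M'.BoundedAbove} {hN' : N'.BoundedAbove}
  {I : InjRes (rightComodules A.dual) (M.toComodule hM)}
  {J : InjRes (leftComodules A.dual) (N.toComodule hN)}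
  {I' : InjRes (rightComodules A.dual) (M'.toComodule hM')}
  {J' : InjRes (leftComodules A.dual) (N'.toComodule hN')}
  {B B' : DGBimodule A}
  {E : InjRes (bimodules A) B} {E' : InjRes (bimodules A) B'}
  {f : (M.tensor N).toDGVect →ₗ[k] B.toDGVect}

/-- Given a map `τ` from the total complex of `I ⊗ J` to `E`, the element `x` is sent to the
maps `a ↦ τ x a`. -/
def comparisonAmbient (τ : SplitRes.Lift (T := bimodules A) (X := M.tensor N) f
    (totRes I.toSplitRes J.toSplitRes) E.toSplitRes) : CotorAmbient I J →ₗ[k] HochAmbient E :=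
  LinearMap.pi fun p => (E.obj p).orbit ∘ₗ τ.map p ∘ₗ totRestrict I J p

variable (τ τ' : SplitRes.Lift (T := bimodules A) (X := M.tensor N) f
    (totRes I.toSplitRes J.toSplitRes) E.toSplitRes)

theorem comparisonAmbient_apply (x : CotorAmbient I J) (p : ℕ) :
    comparisonAmbient τ x p = (E.obj p).orbit (τ.map p (totRestrict I J p x)) := rfl

theorem comparisonAmbient_mem (n : ℤ) (x : CotorAmbient I J) (hx : x ∈ cotorDeg I J n) :
    comparisonAmbient τ x ∈ hochDeg E n := fun p =>
  orbit_mem_bimoduleHom (DGBimodule.IsCentral.map (τ.map_hom p) (isCentral_totRestrict I J hx p))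

/-- The internal differential passes through by `homD_orbit` and because τ is a DG map; the
differential of E passes through because τ commutes with the differentials of the resolutions. -/
theorem comparisonAmbient_D (n : ℤ) (x : CotorAmbient I J) (hx : x ∈ cotorDeg I J n) :
    hochD E n (comparisonAmbient τ x) = comparisonAmbient τ (cotorD I J x) := by
  have hτ : ∀ p, DGBimodule.IsHom (M := totObj I.toSplitRes J.toSplitRes p) (τ.map p) := τ.map_hom
  funext p
  rw [hochD_apply, comparisonAmbient_apply, comparisonAmbient_apply,
    homD_orbit _ ((hτ p).map_mem (isCentral_totRestrict I J hx p).1), ← (hτ p).map_d]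
  cases p with
  | zero =>
    rw [totRestrict_zero_cotorD, Nat.cast_zero, sgn_zero, one_smul]
    exact zero_add _
  | succ p =>
    rw [totRestrict_succ_cotorD, map_add, map_add, map_smul, map_smul]
    congr 1
    refine (comp_orbit (E.δ_hom p) _).trans (congrArg _ ?_)
    exact (LinearMap.congr_fun (τ.map_δ p) _).symm

/-- The map from Cotor to DG Hochschild cohomology given by a map from the total complex of `I ⊗ J`
to `E`. -/
def comparison (n : ℤ) : Cotor I J n ⟶ HDG E (-n) :=
  HomologicalComplex.homologyMap
    (subComplexMap (comparisonAmbient τ) (comparisonAmbient_mem τ)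
      (comparisonAmbient_D τ) : cotorComplex I J ⟶ hochComplex E) (-n)

/-- Homotopic lifts give homotopic maps. The choice of τ thus becomes irrelevant, and the identities
of maps below reduce to both sides coming from lifts of the same map. -/
theorem comparison_eq (n : ℤ) : comparison τ n = comparison τ' n := by
  obtain ⟨H⟩ := SplitRes.exists_htpy (bimodules_isPreadditive A) (bimodules_hasExtensions A)
    (S := E.toSplitRes) E.injective τ τ'
  have hH : ∀ p, DGBimodule.IsHom (M := totObj I.toSplitRes J.toSplitRes (p + 1)) (H.map p) :=
    H.map_hom
  refine subComplexMap_homology_eq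
    (LinearMap.pi fun p => (E.obj p).orbit ∘ₗ H.map p ∘ₗ totRestrict I J (p + 1)) ?_ ?_ (-n)
  · intro n x hx p
    have := orbit_mem_bimoduleHom ((isCentral_totRestrict I J hx (p + 1)).map (hH p))
    rwa [show n + 1 - ((p + 1 : ℕ) : ℤ) = n - (p : ℤ) by push_cast; ring] at this
  · intro n x hx
    funext p
    have e : n + 1 - ((p + 1 : ℕ) : ℤ) = n - (p : ℤ) := by push_cast; ring
    have hm := (hH p).map_mem (isCentral_totRestrict I J hx (p + 1)).1
    rw [e] at hm
    change (E.obj p).orbit (τ.map p (totRestrict I J p x)) -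
      (E.obj p).orbit (τ'.map p (totRestrict I J p x)) = (hochDE E p _ + sgn k p •
      homD (E.obj p) (n - p) ((E.obj p).orbit (H.map p (totRestrict I J (p + 1) x)))) +
        (E.obj p).orbit (H.map p (totRestrict I J (p + 1) (cotorD I J x)))
    rw [homD_orbit _ hm, totRestrict_succ_cotorD, map_add, map_smul, (hH p).map_d, map_add,
      map_smul, ← map_sub, ← LinearMap.sub_apply]
    push_cast
    rw [sgn_add, sgn_one]
    cases p with
    | zero =>
      rw [H.zero]
      change _ = (0 + _) + _
      rw [LinearMap.comp_apply]
      module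
    | succ p =>
      rw [H.succ]
      change _ = (E.δ p ∘ₗ (E.obj p).orbit (H.map p (totRestrict I J (p + 1) x)) + _) + _
      rw [comp_orbit (E.δ_hom p), LinearMap.add_apply, map_add, LinearMap.comp_apply,
        LinearMap.comp_apply]
      module

theorem comparison_comp {g : B.toDGVect →ₗ[k] B'.toDGVect}
    {h : (M.tensor N).toDGVect →ₗ[k] B'.toDGVect}
    (θ : InjRes.Lift (T := bimodules A) g E E') (e : g ∘ₗ f = h) (n : ℤ) :
    comparison τ n ≫ HDG.map θ (-n) = comparison (f := h)
      (SplitRes.Lift.comp (T := bimodules A) (bimodules_isPreadditive A) θ.toSplitRes τ e) n := by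
  refine (HomologicalComplex.homologyMap_comp _ _ _).symm.trans ?_
  refine congrArg (fun u => HomologicalComplex.homologyMap u (-n))
    (subComplexMap_comp fun n x _ => funext fun p => ?_)
  exact comp_orbit (θ.map_hom p) _

end Comparison

/-! ### Naturality of the comparison map -/

section Naturality
open CategoryTheory
variable {k : Type u} [Field k] {A : DGAlgebra k} [A.FiniteType]
  {M M' : DGLeftModule A} {N N' : DGRightModule A} {hM : M.BoundedAbove}
  {hN : N.BoundedAbove} {hM' : M'.BoundedAbove} {hN' : N'.BoundedAbove}
  {f : M.toDGVect →ₗ[k] M'.toDGVect} {g : N.toDGVect →ₗ[k] N'.toDGVect}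

/-- The tensor product of lifts, as a map of total complexes. -/
abbrev totMap {I : SplitRes (rightComodules A.dual) (M.toComodule hM)}
    {J : SplitRes (leftComodules A.dual) (N.toComodule hN)}
    {I' : SplitRes (rightComodules A.dual) (M'.toComodule hM')}
    {J' : SplitRes (leftComodules A.dual) (N'.toComodule hN')}
    (φ : SplitRes.Lift (T := rightComodules A.dual) f I I')
    (ψ : SplitRes.Lift (T := leftComodules A.dual) g J J') :
    SplitRes.Lift (T := bimodules A) (X := M.tensor N) (X' := M'.tensor N')
      (TensorProduct.map f g) (totRes I J) (totRes I' J') where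
  map p := LinearMap.pi fun q : TotIdx p => TensorProduct.map (φ.map q.1.1) (ψ.map q.1.2) ∘ₗ
    LinearMap.proj q
  map_hom p := DGBimodule.IsHom.pi fun q =>
    (isHom_map_toModule (φ.map_hom q.1.1) (ψ.map_hom q.1.2)).comp (DGBimodule.IsHom.proj _ q)
  map_aug := by
    refine LinearMap.ext fun x => ?_
    funext ⟨⟨i, j⟩, h⟩
    have h0 : i + j = 0 := h
    obtain rfl : i = 0 := by omega
    obtain rfl : j = 0 := by omega
    change TensorProduct.map (φ.map 0) (ψ.map 0) (TensorProduct.map I.aug J.aug x) =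
      TensorProduct.map I'.aug J'.aug (TensorProduct.map f g x)
    rw [map_map_apply, map_map_apply]
    exact congrArg₂ (fun u v => TensorProduct.map u v x) φ.map_aug ψ.map_aug
  map_δ p := by
    refine LinearMap.ext fun x => ?_
    funext ⟨⟨i, j⟩, h⟩
    have h0 : i + j = p + 1 := h
    change TensorProduct.map (φ.map i) (ψ.map j) (totDI I J p ⟨(i, j), h⟩ x +
      sgn k i • totDJ I J p ⟨(i, j), h⟩ x) = totDI I' J' p ⟨(i, j), h⟩ _ +
        sgn k i • totDJ I' J' p ⟨(i, j), h⟩ _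
    rw [map_add, map_smul]
    congr 1
    · cases i with
      | zero => exact map_zero _
      | succ i =>
        rw [totDI_succ I J p i j (by omega), totDI_succ I' J' p i j (by omega)]
        change _ = TensorProduct.map (I'.δ i) LinearMap.id
          (TensorProduct.map (φ.map i) (ψ.map j) (x ⟨(i, j), by simp only; omega⟩))
        rw [map_map_apply, map_map_apply, φ.map_δ, LinearMap.comp_id, LinearMap.id_comp]
    · congr 1
      cases j with
      | zero => rw [totDJ_zero, totDJ_zero, map_zero]
      | succ j =>
        rw [totDJ_succ I J p i j (by omega), totDJ_succ I' J' p i j (by omega)]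
        change _ = TensorProduct.map LinearMap.id (J'.δ j)
          (TensorProduct.map (φ.map i) (ψ.map j) (x ⟨(i, j), by simp only; omega⟩))
        rw [map_map_apply, map_map_apply, ψ.map_δ, LinearMap.comp_id, LinearMap.id_comp]

variable {I : InjRes (rightComodules A.dual) (M.toComodule hM)}
  {J : InjRes (leftComodules A.dual) (N.toComodule hN)}
  {I' : InjRes (rightComodules A.dual) (M'.toComodule hM')}
  {J' : InjRes (leftComodules A.dual) (N'.toComodule hN')}
  {B : DGBimodule A} {E : InjRes (bimodules A) B}

theorem totRestrict_cotorAmbientMap (φ : InjRes.Lift (T := rightComodules A.dual) f I I')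
    (ψ : InjRes.Lift (T := leftComodules A.dual) g J J') (x : CotorAmbient I J) (p : ℕ) :
    totRestrict I' J' p (cotorAmbientMap φ ψ x) =
      (totMap φ.toSplitRes ψ.toSplitRes).map p (totRestrict I J p x) :=
  funext fun _ => rfl

/-- The map of Cotor induced by φ and ψ corresponds to the map φ ⊗ ψ of total complexes, so
composing with a comparison map amounts to composing lifts. -/
theorem map_comparison {h : (M'.tensor N').toDGVect →ₗ[k] B.toDGVect}
    {h' : (M.tensor N).toDGVect →ₗ[k] B.toDGVect}
    (φ : InjRes.Lift (T := rightComodules A.dual) f I I')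
    (ψ : InjRes.Lift (T := leftComodules A.dual) g J J')
    (τ : SplitRes.Lift (T := bimodules A) (X := M'.tensor N') h
      (totRes I'.toSplitRes J'.toSplitRes) E.toSplitRes)
    (e : h ∘ₗ TensorProduct.map f g = h') (n : ℤ) :
    Cotor.map φ ψ n ≫ comparison (f := h) τ n = comparison (f := h')
      (SplitRes.Lift.comp (T := bimodules A) (X := M.tensor N) (X' := M'.tensor N') (X'' := B)
        (f := TensorProduct.map f g) (g := h) (h := h') (bimodules_isPreadditive A) τ
        (totMap φ.toSplitRes ψ.toSplitRes) e) n := by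
  refine (HomologicalComplex.homologyMap_comp _ _ _).symm.trans ?_
  refine congrArg (fun u => HomologicalComplex.homologyMap u (-n))
    (subComplexMap_comp fun n x _ => funext fun p => ?_)
  rw [comparisonAmbient_apply, comparisonAmbient_apply, totRestrict_cotorAmbientMap,
    LinearMap.comp_apply]

end Naturality

/-! ### The comparison map is an isomorphism -/

section Iso
open CategoryTheory
variable {k : Type u} [Field k] {A : DGAlgebra k} [A.FiniteType]

/-- Each stage tensors with DA, which lives in degrees at most 0. -/
theorem boundedAbove_rightStage {X : DGRightComodule A.dual} (hX : X.BoundedAbove) (n : ℕ) :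
    DGVect.BoundedAbove ((rightComodules A.dual).U ((rightCofree A.dual).stage X n).X) := by
  induction n with
  | zero => exact hX
  | succ n ih => exact ih.tensor A.dual.boundedAbove

theorem boundedAbove_leftStage {Y : DGLeftComodule A.dual} (hY : Y.BoundedAbove) (n : ℕ) :
    DGVect.BoundedAbove ((leftComodules A.dual).U ((leftCofree A.dual).stage Y n).X) := by
  induction n with
  | zero => exact hY
  | succ n ih => exact A.dual.boundedAbove.tensor ih

/-- The standard resolution by cofree comodules. -/
abbrev rightStdRes (X : DGRightComodule A.dual) : InjRes (rightComodules A.dual) X :=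
  (rightCofree A.dual).stdRes (rightComodules_isPreadditive A.dual) X

/-- The standard resolution by cofree comodules. -/
abbrev leftStdRes (Y : DGLeftComodule A.dual) : InjRes (leftComodules A.dual) Y :=
  (leftCofree A.dual).stdRes (leftComodules_isPreadditive A.dual) Y

/-- Each term is a finite product of bimodules (V ⊗ DA) ⊗ (DA ⊗ W), with V and W bounded above as
stages of the standard resolutions. -/
theorem isInjective_totObj_stdRes {X : DGRightComodule A.dual} {Y : DGLeftComodule A.dual}
    (hX : X.BoundedAbove) (hY : Y.BoundedAbove) (p : ℕ) : (bimodules A).IsInjective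
      (totObj (rightStdRes X).toSplitRes (leftStdRes Y).toSplitRes p) :=
  DGBimodule.isInjective_pi fun q =>
    isInjective_cofreeTensor (boundedAbove_rightStage hX q.1.1) (boundedAbove_leftStage hY q.1.2)

variable {M : DGLeftModule A} {N : DGRightModule A} {hM : M.BoundedAbove} {hN : N.BoundedAbove}
  {I : InjRes (rightComodules A.dual) (M.toComodule hM)}
  {J : InjRes (leftComodules A.dual) (N.toComodule hN)}
  {E : InjRes (bimodules A) (M.tensor N)}

/-- When the total complex is itself used as E, the comparison is an isomorphism already at the
level of complexes: the cotensor products are the central elements, and these are the bimodule maps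
out of A. -/
theorem isIso_comparison_id
    (h : ∀ p, (bimodules A).IsInjective (totObj I.toSplitRes J.toSplitRes p)) (n : ℤ) :
    IsIso (comparison (f := LinearMap.id)
      (E := (totRes I.toSplitRes J.toSplitRes).toInjRes h)
      (SplitRes.Lift.id (bimodules_isPreadditive A) (totRes I.toSplitRes J.toSplitRes)) n) := by
  have : IsIso (subComplexMap _ (comparisonAmbient_mem (f := LinearMap.id)
      (E := (totRes I.toSplitRes J.toSplitRes).toInjRes h)
      (SplitRes.Lift.id (bimodules_isPreadditive A) (totRes I.toSplitRes J.toSplitRes)))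
      (comparisonAmbient_D _) : cotorComplex I J ⟶
        hochComplex ((totRes I.toSplitRes J.toSplitRes).toInjRes h)) := by
    refine isIso_subComplexMap ?_ ?_
    · intro n x _ hx
      funext i j
      -- A map of the form a ↦ t a determines t as its value at 1.
      have e : (totObj I.toSplitRes J.toSplitRes (i + j)).orbit
          (totRestrict I J (i + j) x) 1 = 0 :=
        congrArg (fun u : A.carrier →ₗ[k] (totObj I.toSplitRes J.toSplitRes (i + j)).carrier => u 1)
          (congrFun hx (i + j))
      rw [DGBimodule.orbit_one] at e
      exact congrFun e ⟨(i, j), rfl⟩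
    · intro n y hy
      -- The preimage consists of the components of the values at 1; every pair (i, j) occurs in
      -- exactly one p = i + j, so these components form a family over all pairs.
      let y' : ∀ p, (totObj I.toSplitRes J.toSplitRes p).carrier := fun p => y p 1
      let x : CotorAmbient I J := fun i j => y' (i + j) ⟨(i, j), rfl⟩
      have hx : ∀ p, totRestrict I J p x = y' p := by
        intro p
        funext ⟨⟨i, j⟩, e⟩
        subst e
        rfl
      refine ⟨x, fun i j => ?_, ?_⟩
      · have hc := (isCentral_of_mem_bimoduleHom (hy (i + j))).1
        refine (isCentral_iff I J).mp ?_
        rw [sub_sub, ← Nat.cast_add]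
        exact ⟨hc.1 ⟨(i, j), rfl⟩ trivial,
          fun l a ha => congrFun (hc.2 l a ha) ⟨(i, j), rfl⟩⟩
      · funext p
        refine Eq.trans ?_ (isCentral_of_mem_bimoduleHom (hy p)).2
        exact congrArg (totObj I.toSplitRes J.toSplitRes p).orbit (hx p)
  exact Functor.map_isIso (HomologicalComplex.homologyFunctor _ _ (-n)) _

/-- For arbitrary I and J no injectivity of I ⊗ J is claimed. Instead, maps from the standard
resolutions to I, J and from their total complex to E give a commutative square in which the other
three sides are isomorphisms. -/
theorem isIso_comparison (τ : SplitRes.Lift (T := bimodules A) (X := M.tensor N)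
    (X' := M.tensor N) LinearMap.id (totRes I.toSplitRes J.toSplitRes) E.toSplitRes) (n : ℤ) :
    IsIso (comparison (f := LinearMap.id) τ n) := by
  have hinj := isInjective_totObj_stdRes (X := M.toComodule hM) (Y := N.toComodule hN) hM hN
  obtain ⟨φ⟩ := InjRes.exists_lift (rightComodules_isPreadditive A.dual)
    ((rightCofree A.dual).hasExtensions (rightComodules_isPreadditive A.dual))
    ((rightComodules_isPreadditive A.dual).id (M.toComodule hM)) (rightStdRes _) I
  obtain ⟨ψ⟩ := InjRes.exists_lift (leftComodules_isPreadditive A.dual)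
    ((leftCofree A.dual).hasExtensions (leftComodules_isPreadditive A.dual))
    ((leftComodules_isPreadditive A.dual).id (N.toComodule hN)) (leftStdRes _) J
  obtain ⟨θ⟩ := InjRes.exists_lift (bimodules_isPreadditive A) (bimodules_hasExtensions A)
    ((bimodules_isPreadditive A).id (M.tensor N))
    ((totRes (rightStdRes (M.toComodule hM)).toSplitRes
      (leftStdRes (N.toComodule hN)).toSplitRes).toInjRes hinj) E
  have h1 := isIso_comparison_id hinj n
  have h2 := HDG.isIso_map θ (-n)
  have h3 := Cotor.isIso_map φ ψ n
  -- Both sides are comparison maps of lifts of the identity of M ⊗ N from the total complex of the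
  -- standard resolutions to E, so they agree by `comparison_eq`.
  have e : Cotor.map (f := LinearMap.id) (g := LinearMap.id) φ ψ n ≫
      comparison (f := LinearMap.id) τ n = comparison (f := LinearMap.id)
        (E := (totRes (rightStdRes (M.toComodule hM)).toSplitRes
          (leftStdRes (N.toComodule hN)).toSplitRes).toInjRes hinj)
        (SplitRes.Lift.id (bimodules_isPreadditive A) _) n ≫ HDG.map θ (-n) := by
    rw [map_comparison (h' := LinearMap.id) φ ψ τ
        ((LinearMap.id_comp _).trans TensorProduct.map_id),
      comparison_comp (h := LinearMap.id) _ θ (LinearMap.id_comp _)]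
    exact comparison_eq _ _ n
  have h4 : IsIso (Cotor.map (f := LinearMap.id) (g := LinearMap.id) φ ψ n ≫
      comparison (f := LinearMap.id) τ n) := by
    rw [e]
    infer_instance
  exact IsIso.of_isIso_comp_left (Cotor.map (f := LinearMap.id) (g := LinearMap.id) φ ψ n) _

/-- The comparison map as an isomorphism. -/
def comparisonIso (I : InjRes (rightComodules A.dual) (M.toComodule hM))
    (J : InjRes (leftComodules A.dual) (N.toComodule hN)) (E : InjRes (bimodules A) (M.tensor N))
    (n : ℤ) : Cotor I J n ≅ HDG E (-n) :=
  -- By `comparison_eq` the resulting map does not depend on the chosen lift.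
  let τ := Classical.choice (SplitRes.exists_lift (bimodules_isPreadditive A)
    (bimodules_hasExtensions A) ((bimodules_isPreadditive A).id (M.tensor N))
    (totRes I.toSplitRes J.toSplitRes) E.toSplitRes E.injective)
  have := isIso_comparison τ n
  asIso (comparison τ n)

/-- Both composites are comparison maps of lifts of f ⊗ g from the total complex of I ⊗ J to E',
hence equal. -/
theorem comparisonIso_naturality {M' : DGLeftModule A} {N' : DGRightModule A}
    {hM' : M'.BoundedAbove} {hN' : N'.BoundedAbove}
    {f : M.toDGVect →ₗ[k] M'.toDGVect} {g : N.toDGVect →ₗ[k] N'.toDGVect}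
    {I' : InjRes (rightComodules A.dual) (M'.toComodule hM')}
    {J' : InjRes (leftComodules A.dual) (N'.toComodule hN')}
    {E' : InjRes (bimodules A) (M'.tensor N')}
    (φ : InjRes.Lift (T := rightComodules A.dual) f I I')
    (ψ : InjRes.Lift (T := leftComodules A.dual) g J J')
    (θ : InjRes.Lift (T := bimodules A) (TensorProduct.map f g) E E') (n : ℤ) :
    Cotor.map φ ψ n ≫ (comparisonIso I' J' E' n).hom =
      (comparisonIso I J E n).hom ≫ HDG.map θ (-n) :=
  (map_comparison φ ψ _ (LinearMap.id_comp _) n).trans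
    ((comparison_eq _ _ n).trans (comparison_comp _ θ (LinearMap.comp_id _) n).symm)

end Iso

/-! ### Module homomorphisms are comodule homomorphisms -/

section ToComodule
variable {k : Type u} [Field k] {A : DGAlgebra k} [A.FiniteType]

/-- The slices of the coaction are the signed actions, and `f` preserves degrees, so the signs on
the two sides agree. -/
theorem DGLeftModule.IsHom.toComodule {M M' : DGLeftModule A} (hM : M.BoundedAbove)
    (hM' : M'.BoundedAbove) {f : M.toDGVect →ₗ[k] M'.toDGVect} (hf : DGLeftModule.IsHom f) :
    DGRightComodule.IsHom (M := M.toComodule hM) (M' := M'.toComodule hM') f := by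
  refine ⟨hf.toIsDGMap, fun m => ?_⟩
  refine M.toDGVect.induction (P := fun m => M'.coact hM' (f m) =
    f.rTensor A.Dual (M.coact hM m)) ?_ ?_ m
  · intro p m hm
    refine A.slice_ext fun i a ha => ?_
    rw [A.slice_rTensor, DGLeftModule.slice_coact, DGLeftModule.slice_coact,
      M.orbit_apply hm ha, M'.orbit_apply (hf.map_mem hm) ha, map_smul, hf.map_lact]
  · intro x y hx hy
    simp only [map_add, hx, hy]

theorem DGRightModule.IsHom.toComodule {N N' : DGRightModule A} (hN : N.BoundedAbove)
    (hN' : N'.BoundedAbove) {g : N.toDGVect →ₗ[k] N'.toDGVect} (hg : DGRightModule.IsHom g) :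
    DGLeftComodule.IsHom (M := N.toComodule hN) (M' := N'.toComodule hN') g := by
  refine ⟨hg.toIsDGMap, fun m => ?_⟩
  refine N.toDGVect.induction (P := fun m => N'.coact hN' (g m) =
    g.lTensor A.Dual (N.coact hN m)) ?_ ?_ m
  · intro p m hm
    refine A.lslice_ext fun i a ha => ?_
    rw [A.lslice_lTensor, DGRightModule.lslice_coact, DGRightModule.lslice_coact,
      N.orbit_apply hm ha, N'.orbit_apply (hg.map_mem hm) ha, map_smul, hg.map_ract]
  · intro x y hx hy
    simp only [map_add, hx, hy]

end ToComodule

end DGCotor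

end

/-! ### The theorem. -/

theorem mainTheorem4 {k : Type u} [Field k] (A : DGCotor.DGAlgebra k) [A.FiniteType] :
    -- injective resolutions of the objects in question exist
    ((∀ (M : DGCotor.DGLeftModule A) (hM : M.BoundedAbove),
        Nonempty (DGCotor.InjRes (DGCotor.rightComodules A.dual) (M.toComodule hM))) ∧
      (∀ (N : DGCotor.DGRightModule A) (hN : N.BoundedAbove),
        Nonempty (DGCotor.InjRes (DGCotor.leftComodules A.dual) (N.toComodule hN))) ∧
      (∀ (M : DGCotor.DGLeftModule A) (N : DGCotor.DGRightModule A),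
        M.BoundedAbove → N.BoundedAbove →
          Nonempty (DGCotor.InjRes (DGCotor.bimodules A) (M.tensor N)))) ∧
    -- homomorphisms lift to injective resolutions
    ((∀ (M M' : DGCotor.DGLeftModule A) (hM : M.BoundedAbove) (hM' : M'.BoundedAbove)
        (f : M.toDGVect →ₗ[k] M'.toDGVect), DGCotor.DGLeftModule.IsHom f →
        ∀ (I : DGCotor.InjRes (DGCotor.rightComodules A.dual) (M.toComodule hM))
          (I' : DGCotor.InjRes (DGCotor.rightComodules A.dual) (M'.toComodule hM')),
          Nonempty (DGCotor.InjRes.Lift (T := DGCotor.rightComodules A.dual) f I I')) ∧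
      (∀ (N N' : DGCotor.DGRightModule A) (hN : N.BoundedAbove) (hN' : N'.BoundedAbove)
        (g : N.toDGVect →ₗ[k] N'.toDGVect), DGCotor.DGRightModule.IsHom g →
        ∀ (J : DGCotor.InjRes (DGCotor.leftComodules A.dual) (N.toComodule hN))
          (J' : DGCotor.InjRes (DGCotor.leftComodules A.dual) (N'.toComodule hN')),
          Nonempty (DGCotor.InjRes.Lift (T := DGCotor.leftComodules A.dual) g J J')) ∧
      (∀ (M M' : DGCotor.DGLeftModule A) (N N' : DGCotor.DGRightModule A),
        M.BoundedAbove → M'.BoundedAbove → N.BoundedAbove → N'.BoundedAbove →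
        ∀ (f : M.toDGVect →ₗ[k] M'.toDGVect) (g : N.toDGVect →ₗ[k] N'.toDGVect),
          DGCotor.DGLeftModule.IsHom f → DGCotor.DGRightModule.IsHom g →
          ∀ (E : DGCotor.InjRes (DGCotor.bimodules A) (M.tensor N))
            (E' : DGCotor.InjRes (DGCotor.bimodules A) (M'.tensor N')),
            Nonempty (DGCotor.InjRes.Lift (T := DGCotor.bimodules A)
              (TensorProduct.map f g) E E'))) ∧
    -- the natural isomorphism `Cotor^C_n(M, N) ≅ H_DG^{-n}(A, M ⊗ N)`
    ∃ Φ : ∀ (M : DGCotor.DGLeftModule A) (N : DGCotor.DGRightModule A)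
        (hM : M.BoundedAbove) (hN : N.BoundedAbove)
        (I : DGCotor.InjRes (DGCotor.rightComodules A.dual) (M.toComodule hM))
        (J : DGCotor.InjRes (DGCotor.leftComodules A.dual) (N.toComodule hN))
        (E : DGCotor.InjRes (DGCotor.bimodules A) (M.tensor N)) (n : ℤ),
        CategoryTheory.Iso (DGCotor.Cotor I J n) (DGCotor.HDG E (-n)),
      ∀ (M M' : DGCotor.DGLeftModule A) (N N' : DGCotor.DGRightModule A)
        (hM : M.BoundedAbove) (hM' : M'.BoundedAbove)
        (hN : N.BoundedAbove) (hN' : N'.BoundedAbove)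
        (f : M.toDGVect →ₗ[k] M'.toDGVect) (g : N.toDGVect →ₗ[k] N'.toDGVect),
        DGCotor.DGLeftModule.IsHom f → DGCotor.DGRightModule.IsHom g →
        ∀ (I : DGCotor.InjRes (DGCotor.rightComodules A.dual) (M.toComodule hM))
          (I' : DGCotor.InjRes (DGCotor.rightComodules A.dual) (M'.toComodule hM'))
          (J : DGCotor.InjRes (DGCotor.leftComodules A.dual) (N.toComodule hN))
          (J' : DGCotor.InjRes (DGCotor.leftComodules A.dual) (N'.toComodule hN'))
          (E : DGCotor.InjRes (DGCotor.bimodules A) (M.tensor N))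
          (E' : DGCotor.InjRes (DGCotor.bimodules A) (M'.tensor N'))
          (φ : DGCotor.InjRes.Lift (T := DGCotor.rightComodules A.dual) f I I')
          (ψ : DGCotor.InjRes.Lift (T := DGCotor.leftComodules A.dual) g J J')
          (θ : DGCotor.InjRes.Lift (T := DGCotor.bimodules A) (TensorProduct.map f g) E E')
          (n : ℤ),
          CategoryTheory.CategoryStruct.comp (DGCotor.Cotor.map φ ψ n)
              (Φ M' N' hM' hN' I' J' E' n).hom =
            CategoryTheory.CategoryStruct.comp (Φ M N hM hN I J E n).hom
              (DGCotor.HDG.map θ (-n)) := by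
  have hR := DGCotor.rightComodules_isPreadditive A.dual
  have hL := DGCotor.leftComodules_isPreadditive A.dual
  have hB := DGCotor.bimodules_isPreadditive A
  refine ⟨⟨fun M hM => ⟨DGCotor.rightStdRes _⟩, fun N hN => ⟨DGCotor.leftStdRes _⟩,
    -- An injective resolution of M ⊗ N is given by the total complex of the standard resolutions of
    -- M and N.
    fun M N hM hN => ⟨(DGCotor.totRes (hM := hM) (hN := hN)
      (DGCotor.rightStdRes _).toSplitRes (DGCotor.leftStdRes _).toSplitRes).toInjRes
        (DGCotor.isInjective_totObj_stdRes hM hN)⟩⟩,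
    ⟨fun M M' hM hM' f hf I I' => DGCotor.InjRes.exists_lift hR
      ((DGCotor.rightCofree A.dual).hasExtensions hR) (hf.toComodule hM hM') I I',
    fun N N' hN hN' g hg J J' => DGCotor.InjRes.exists_lift hL
      ((DGCotor.leftCofree A.dual).hasExtensions hL) (hg.toComodule hN hN') J J',
    fun M M' N N' _ _ _ _ f g hf hg E E' => DGCotor.InjRes.exists_lift hB
      (DGCotor.bimodules_hasExtensions A)
      (DGCotor.isHom_map hf.toIsDGMap hg.toIsDGMap hf.map_lact hg.map_ract) E E'⟩,
    fun M N hM hN I J E n => DGCotor.comparisonIso I J E n, ?_⟩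
  intro M M' N N' hM hM' hN hN' f g _ _ I I' J J' E E' φ ψ θ n
  exact DGCotor.comparisonIso_naturality φ ψ θ n
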